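/- **Theorem.** There is a single deterministic algorithm with the following property. It takes as input - a finite field $\mathbb F$, presented as $\mathbb F_p[\theta]$ by the prime $p$ and the minimal polynomial of a generator $\theta$ over $\mathbb F_p$, with field elements given by their coordinates in the basis $1,\theta,\theta^2,\dots$; - an integer $k$ and a received word $w=\{(\alpha_j,\beta_j)\}_{j\in[n]}\subseteq\mathbb F^2$ with $\alpha_1,\dots,\alpha_n$ pairwise distinct, where $n>k\ge 1$; - a nonzero polynomial $Q(X,Y)\in\mathbb F[X,Y]$, given by its list of coefficients, under the promise that every polynomial $f\in\mathbb F[X]$ of degree at most $k-1$ with $f(\alpha_j)=\beta_j$ for at least $\sqrt{(k-1)n}$ indices $j\in[n]$ is a $Y$-root of $Q$, i.e. satisfies $Q(X,f(X))=0$. On every such input the algorithm outputs the list, without repetitions, of exactly those polynomials $f\in\mathbb F[X]$ of degree at most $k-1$ that agree with $w$ in at least $\sqrt{(k-1)n}$ positions, and it halts within $\mathrm{poly}(n,\deg_X Q,\deg_Y Q,\log|\mathbb F|)$ steps. In particular, its running time is $\mathrm{poly}(n,\log|\mathbb F|)$ whenever $\deg_X Q$ and $\deg_Y Q$ are $\mathrm{poly}(n)$.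 The polynomial bound does not depend on $\mathbb F$, $n$, $k$, $w$ or $Q$. Here an algorithm is a program over binary trees, the data being bit-level encodings (integers in binary), whose unit-cost elementary operations are forming a pair, taking a component of a pair, and testing for the empty tree, with sequencing, branching and while loops as control structures. -/

import Mathlib

open Polynomial
open scoped Polynomial.Bivariate

/-! ### The machine model

Programs over binary trees (pure Lisp data), in the style of the textbook WHILE language: the only
elementary operations are building a pair, taking the first or the second component of a pair, and
testing for `nil`, and each of them costs one step. There is no arithmetic in the model, so running
times are bit complexities, polynomially related to Turing machine time. -/

/-- The data manipulated by programs: binary trees. -/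
inductive Val : Type
  | nil : Val
  | pair : Val → Val → Val

/-- Programs; each denotes a partial function from `Val` to `Val`. -/
inductive Prog : Type
  /-- return `nil` -/
  | nil : Prog
  /-- return the input -/
  | arg : Prog
  /-- return the first component of the input (`nil` on input `nil`) -/
  | fst : Prog
  /-- return the second component of the input (`nil` on input `nil`) -/
  | snd : Prog
  /-- run both programs on the input and pair the results -/
  | pair : Prog → Prog → Prog
  /-- `seq f g`: run `f` on the input, then run `g` on the result -/
  | seq : Prog → Prog → Prog
  /-- `ite c f g`: if `c` does not return `nil` on the input, run `f` on the input, else `g` -/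
  | ite : Prog → Prog → Prog → Prog
  /-- `loop c f`: while `c` does not return `nil` on the current value, replace the value by the
  result of `f` on it -/
  | loop : Prog → Prog → Prog

/-- `Runs P x y t`: the program `P`, started on the input `x`, halts with the output `y` after
exactly `t` steps. -/
inductive Runs : Prog → Val → Val → ℕ → Prop
  | nil (x : Val) : Runs .nil x .nil 1
  | arg (x : Val) : Runs .arg x x 1
  | fst_nil : Runs .fst .nil .nil 1
  | fst_pair (a b : Val) : Runs .fst (.pair a b) a 1
  | snd_nil : Runs .snd .nil .nil 1
  | snd_pair (a b : Val) : Runs .snd (.pair a b) b 1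
  | pair {f g : Prog} {x y z : Val} {s t : ℕ} :
      Runs f x y s → Runs g x z t → Runs (.pair f g) x (.pair y z) (s + t + 1)
  | seq {f g : Prog} {x y z : Val} {s t : ℕ} :
      Runs f x y s → Runs g y z t → Runs (.seq f g) x z (s + t + 1)
  | ite_true {c f g : Prog} {x a b y : Val} {s t : ℕ} :
      Runs c x (.pair a b) s → Runs f x y t → Runs (.ite c f g) x y (s + t + 1)
  | ite_false {c f g : Prog} {x y : Val} {s t : ℕ} :
      Runs c x .nil s → Runs g x y t → Runs (.ite c f g) x y (s + t + 1)
  | loop_done {c f : Prog} {x : Val} {s : ℕ} :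
      Runs c x .nil s → Runs (.loop c f) x x (s + 1)
  | loop_step {c f : Prog} {x a b y z : Val} {r s t : ℕ} :
      Runs c x (.pair a b) r → Runs f x y s → Runs (.loop c f) y z t →
      Runs (.loop c f) x z (r + s + t + 1)

/-- Programs are deterministic: output and running time are determined by the input. -/
theorem Runs.deterministic {P : Prog} {x y y' : Val} {t t' : ℕ}
    (h : Runs P x y t) (h' : Runs P x y' t') : y = y' ∧ t = t' := by
  induction h generalizing y' t' with
  | nil | arg | fst_nil | fst_pair | snd_nil | snd_pair => cases h'; exact ⟨rfl, rfl⟩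
  | pair _ _ ih₁ ih₂ =>
    cases h' with
    | pair k₁ k₂ => have e₁ := ih₁ k₁; have e₂ := ih₂ k₂; grind
  | seq _ _ ih₁ ih₂ =>
    cases h' with
    | seq k₁ k₂ =>
      obtain ⟨rfl, rfl⟩ := ih₁ k₁
      have e₂ := ih₂ k₂
      grind
  | ite_true _ _ ih₁ ih₂ =>
    cases h' with
    | ite_true k₁ k₂ => have e₁ := ih₁ k₁; have e₂ := ih₂ k₂; grind
    | ite_false k₁ k₂ => exact absurd (ih₁ k₁).1 (by simp)
  | ite_false _ _ ih₁ ih₂ =>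
    cases h' with
    | ite_true k₁ k₂ => exact absurd (ih₁ k₁).1 (by simp)
    | ite_false k₁ k₂ => have e₁ := ih₁ k₁; have e₂ := ih₂ k₂; grind
  | loop_done _ ih =>
    cases h' with
    | loop_done k => have e := ih k; grind
    | loop_step k _ _ => exact absurd (ih k).1 (by simp)
  | loop_step _ _ _ ih₁ ih₂ ih₃ =>
    cases h' with
    | loop_done k => exact absurd (ih₁ k).1 (by simp)
    | loop_step k₁ k₂ k₃ =>
      have e₁ := ih₁ k₁
      obtain ⟨rfl, rfl⟩ := ih₂ k₂
      have e₃ := ih₃ k₃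
      grind

/-! ### Encodings -/

/-- A list of values as a value. -/
def encList : List Val → Val
  | [] => .nil
  | a :: l => .pair a (encList l)

/-- A bit as a value. -/
def encBool : Bool → Val
  | false => .nil
  | true => .pair .nil .nil

/-- A natural number in binary, least significant bit first. -/
def encNat (m : ℕ) : Val :=
  encList (m.bits.map encBool)

/-- A polynomial in dense representation: the list of its coefficients of degree
`0, …, natDegree`, each encoded by `enc`. -/
def encPoly {R : Type*} [Semiring R] (enc : R → Val) (f : R[X]) : Val :=
  encList ((List.range (f.natDegree + 1)).map fun i => enc (f.coeff i))

/-- A residue class modulo `p`, by its representative in `{0, …, p - 1}`. -/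
def encZMod (p : ℕ) (a : ZMod p) : Val :=
  encNat a.val

section Field

variable {p : ℕ} {F : Type*} [Field F] [Algebra (ZMod p) F]

/-- An element of `F = 𝔽_p[θ]`, by its coordinates in the basis `1, θ, …, θ ^ (r - 1)`. -/
noncomputable def encElt (pb : PowerBasis (ZMod p) F) (x : F) : Val :=
  encList (List.ofFn fun i => encZMod p (pb.basis.repr x i))

/-- The field `F = 𝔽_p[θ]` itself, by `p` and the minimal polynomial of `θ` over `𝔽_p`. -/
noncomputable def encField (pb : PowerBasis (ZMod p) F) : Val :=
  .pair (encNat p) (encPoly (encZMod p) (minpoly (ZMod p) pb.gen))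

/-- A received word `(α_j, β_j)_j`. -/
noncomputable def encWord (pb : PowerBasis (ZMod p) F) {n : ℕ} (α β : Fin n → F) : Val :=
  encList (List.ofFn fun j => .pair (encElt pb (α j)) (encElt pb (β j)))

/-- The whole input: the field, the dimension `k`, the received word, and the bivariate polynomial
`Q` as a polynomial in `Y` whose coefficients are polynomials in `X`. -/
noncomputable def encInput (pb : PowerBasis (ZMod p) F) (k : ℕ) {n : ℕ} (α β : Fin n → F)
    (Q : F[X][Y]) : Val :=
  .pair (encField pb) (.pair (encNat k) (.pair (encWord pb α β)
    (encPoly (encPoly (encElt pb)) Q)))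

/-- The output: a list of univariate polynomials. -/
noncomputable def encOutput (pb : PowerBasis (ZMod p) F) (L : List F[X]) : Val :=
  encList (L.map (encPoly (encElt pb)))

end Field

/-! ### Polynomials and received words -/

/-- The degree in `X` of a bivariate polynomial (`natDegree` is the degree in `Y`). -/
noncomputable def degX {F : Type*} [Field F] (Q : F[X][Y]) : ℕ :=
  Q.support.sup fun i => (Q.coeff i).natDegree

/-- The number of positions at which `f` agrees with the received word `(α_j, β_j)_j`. -/
noncomputable def agreement {F : Type*} [Field F] {n : ℕ} (α β : Fin n → F) (f : F[X]) : ℕ :=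
  {j : Fin n | f.eval (α j) = β j}.ncard

/-- `f` has degree at most `k - 1` and agrees with the received word in at least `√((k-1)n)`
positions. -/
def IsClose {F : Type*} [Field F] {n : ℕ} (k : ℕ) (α β : Fin n → F) (f : F[X]) : Prop :=
  f.degree < k ∧ √(((k : ℝ) - 1) * n) ≤ agreement α β f

/-! The obvious method, extracting the Y-roots of Q by factoring, is not open to a deterministic
algorithm over a large field. Instead one computes in an algebra with all roots at once, and asks of
a close f only at which positions it agrees with the word.

Let q = |F| and K = n + deg_X Q + 1. If N is prime to p and divides no q^i - 1 with 0 < i < K, then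
a primitive N-th root of unity z has the K distinct conjugates z, z^q, …, z^(q^(K-1)). An estimate
of the central binomial coefficient provides such an N of polynomial size (`exists_order_gt`); the
algorithm tries all N up to a bound. Since f has coefficients in F, f(z^(q^i)) = f(z)^(q^i). Hence
interpolation at the conjugates expresses f(a), for a in F, through z and f(z) alone, by ring
operations and q-th powers, once denominators are cleared (`neville_spec` on `nevilleStep`).

The algorithm works with indeterminates in place of z and f(z): over E = F[x]/(x^N - 1) it forms A =
E[y]/(relation), where y stands for lc(x) f(x), lc is the leading coefficient of Q in Y, and the
relation is Q made monic. Each root f of Q gives a homomorphism ψ from A to the algebraic closure of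
F with x ↦ z and y ↦ lc(z) f(z). For each position j, fraction-free interpolation yields an element
T_j of A with ψ(T_j) = 0 exactly when f(α_j) = β_j (`Interp.agreeTest_spec`). A is split
successively into the kernel and the image of multiplication by T_j, by linear algebra over the
prime field. One resulting part is an ideal on which ψ does not vanish, and its labels are the
agreement set of f (`Interp.splitAll_spec`, `Interp.patterns_spec`). Dimensions add up, so the
number of parts stays polynomial.

For k ≥ 2 the agreement set has at least k elements (`agreement_ge`), and Newton interpolation
through it returns f. For k = 1 the threshold is 0, every constant is close and hence a root of Q,
so q ≤ deg_Y Q and all constants can be listed. Spurious candidates are removed by testing closeness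
directly.

For the running time, functions between encoded types are shown to be `PolyTime` through closure
properties, the decisive one being `PolyTime.foldl_of_inv`. An `Arith` bounds the results of its
operations by the description of the ring alone, which keeps iterated computations small even on
meaningless data; `Interp` carries the separate proof that the operations mean what they should on
well-formed data. -/

set_option linter.unusedSectionVars false

/-! ### Polynomial-time functions between encoded types -/

/-- The number of nodes of a value. -/
def Val.size : Val → ℕ
  | .nil => 1
  | .pair a b => a.size + b.size + 1

/-- Types whose elements are encoded as values. -/
class Enc (α : Type) where
  /-- the encoding -/
  enc : α → Val

open Enc

instance : Enc Bool := ⟨encBool⟩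
instance : Enc ℕ := ⟨encNat⟩
instance : Enc Unit := ⟨fun _ => .nil⟩
instance {α : Type} [Enc α] : Enc (List α) := ⟨fun l => encList (l.map enc)⟩
instance {α β : Type} [Enc α] [Enc β] : Enc (α × β) := ⟨fun x => .pair (enc x.1) (enc x.2)⟩

/-- The size of the encoding. -/
def sz {α : Type} [Enc α] (a : α) : ℕ := (enc a).size

/-! ### Sizes of encodings -/

section sizes
variable {α β γ : Type} [Enc α] [Enc β] [Enc γ]

theorem Val.one_le_size (v : Val) : 1 ≤ v.size := by cases v <;> simp [Val.size]

theorem one_le_sz (a : α) : 1 ≤ sz a := Val.one_le_size _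

@[simp] theorem sz_pair (a : α) (b : β) : sz (a, b) = sz a + sz b + 1 := rfl
@[simp] theorem sz_nil : sz ([] : List α) = 1 := rfl
@[simp] theorem sz_cons (a : α) (l : List α) : sz (a :: l) = sz a + sz l + 1 := rfl
@[simp] theorem sz_false : sz false = 1 := rfl
@[simp] theorem sz_true : sz true = 3 := rfl

theorem sz_bool_le (b : Bool) : sz b ≤ 3 := by cases b <;> simp

theorem sz_list (l : List α) : sz l = (l.map fun a => sz a + 1).sum + 1 := by
  induction l with
  | nil => rfl
  | cons a l ih => simp [ih]; omega

theorem sz_append (l m : List α) : sz (l ++ m) + 1 = sz l + sz m := by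
  simp [sz_list]; omega

theorem length_lt_sz (l : List α) : l.length < sz l := by
  induction l with
  | nil => simp
  | cons a l ih => simp only [List.length_cons, sz_cons]; omega

theorem sz_le_of_mem {a : α} {l : List α} (h : a ∈ l) : sz a < sz l := by
  induction l with
  | nil => simp at h
  | cons b l ih =>
    rcases List.mem_cons.1 h with rfl | h
    · simp only [sz_cons]; omega
    · have := ih h; simp only [sz_cons]; omega

theorem sz_list_le {l : List α} {B : ℕ} (h : ∀ a ∈ l, sz a ≤ B) :
    sz l ≤ l.length * (B + 1) + 1 := by
  induction l with
  | nil => simp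
  | cons a l ih =>
    have h1 := h a (by simp)
    have h2 := ih fun a ha => h a (by simp [ha])
    simp only [sz_cons, List.length_cons, add_mul]
    omega

theorem sz_reverse (l : List α) : sz l.reverse = sz l := by simp [sz_list]

theorem sz_sublist {l m : List α} (h : l.Sublist m) : sz l ≤ sz m := by
  induction h with
  | slnil => simp
  | cons a _ ih => simp; omega
  | cons_cons a _ ih => simp; omega

end sizes

/-! ### Polynomial bounds in the size of the argument -/

section PolyBdd
variable {α β γ : Type} [Enc α] [Enc β] [Enc γ]

/-- `f` is bounded by a polynomial in the size of its argument. -/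
@[fun_prop] def PolyBdd (f : α → ℕ) : Prop := ∃ b : ℕ[X], ∀ a, f a ≤ b.eval (sz a)

theorem Polynomial.eval_mono_nat (b : ℕ[X]) {x y : ℕ} (h : x ≤ y) : b.eval x ≤ b.eval y := by
  rw [eval_eq_sum_range, eval_eq_sum_range]
  gcongr

theorem PolyBdd.of_le {f g : α → ℕ} (hg : PolyBdd g) (h : ∀ a, f a ≤ g a) : PolyBdd f :=
  hg.imp fun _ hb a => (h a).trans (hb a)

@[fun_prop] theorem PolyBdd.const (n : ℕ) : PolyBdd fun _ : α => n := ⟨C n, by simp⟩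
@[fun_prop] theorem PolyBdd.size : PolyBdd fun a : α => sz a := ⟨X, by simp⟩
@[fun_prop] theorem PolyBdd.add {f g : α → ℕ} (hf : PolyBdd f) (hg : PolyBdd g) :
    PolyBdd fun a => f a + g a := by
  obtain ⟨b, hb⟩ := hf
  obtain ⟨c, hc⟩ := hg
  exact ⟨b + c, fun a => by rw [eval_add]; exact add_le_add (hb a) (hc a)⟩
@[fun_prop] theorem PolyBdd.mul {f g : α → ℕ} (hf : PolyBdd f) (hg : PolyBdd g) :
    PolyBdd fun a => f a * g a := by
  obtain ⟨b, hb⟩ := hf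
  obtain ⟨c, hc⟩ := hg
  exact ⟨b * c, fun a => by rw [eval_mul]; exact Nat.mul_le_mul (hb a) (hc a)⟩
theorem PolyBdd.comp {f : β → ℕ} {g : α → β} (hf : PolyBdd f) (hg : PolyBdd fun a => sz (g a)) :
    PolyBdd fun a => f (g a) := by
  obtain ⟨b, hb⟩ := hf
  obtain ⟨c, hc⟩ := hg
  exact ⟨b.comp c, fun a => by
    rw [eval_comp]; exact (hb _).trans (b.eval_mono_nat (hc a))⟩

@[fun_prop] theorem PolyBdd.eval (b : ℕ[X]) {f : α → ℕ} (hf : PolyBdd f) :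
    PolyBdd fun a => b.eval (f a) := by
  obtain ⟨c, hc⟩ := hf
  exact ⟨b.comp c, fun a => by rw [eval_comp]; exact b.eval_mono_nat (hc a)⟩

end PolyBdd

/-! ### Closure properties of polynomial time -/

section PolyTime
variable {α β γ δ σ : Type} [Enc α] [Enc β] [Enc γ] [Enc δ] [Enc σ]

/-- `f` is computed by a program in polynomial time, and its values have polynomial size. -/
@[fun_prop] def PolyTime (f : α → β) : Prop :=
  ∃ (P : Prog) (b : ℕ[X]), ∀ a, sz (f a) ≤ b.eval (sz a) ∧
    ∃ t ≤ b.eval (sz a), Runs P (enc a) (enc (f a)) t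

/-- The size bound is a separate obligation because it does not follow from the time bound: pairing
a value with itself takes three steps and more than doubles its size. -/
theorem PolyTime.mk {f : α → β} (P : Prog) {T : α → ℕ} (hT : PolyBdd T)
    (hs : PolyBdd fun a => sz (f a)) (h : ∀ a, ∃ t ≤ T a, Runs P (enc a) (enc (f a)) t) :
    PolyTime f := by
  obtain ⟨b, hb⟩ := hT
  obtain ⟨c, hc⟩ := hs
  refine ⟨P, b + c, fun a => ?_⟩
  obtain ⟨t, ht, hr⟩ := h a
  rw [eval_add]
  exact ⟨(hc a).trans (by omega), t, (ht.trans (hb a)).trans (by omega), hr⟩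

@[fun_prop] theorem PolyTime.polyBdd {f : α → β} (hf : PolyTime f) :
    PolyBdd fun a => sz (f a) := by
  obtain ⟨_, b, hb⟩ := hf
  exact ⟨b, fun a => (hb a).1⟩

theorem PolyTime.runs {f : α → β} (hf : PolyTime f) : ∃ (P : Prog) (T : α → ℕ), PolyBdd T ∧
    ∀ a, ∃ t ≤ T a, Runs P (enc a) (enc (f a)) t := by
  obtain ⟨P, b, hb⟩ := hf
  exact ⟨P, fun a => b.eval (sz a), ⟨b, fun a => le_rfl⟩, fun a => (hb a).2⟩

theorem PolyTime.of_eq {f g : α → β} (hf : PolyTime f) (h : ∀ a, f a = g a) : PolyTime g :=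
  funext h ▸ hf

theorem exists_prog_const (v : Val) : ∃ (P : Prog) (t : ℕ), ∀ x, Runs P x v t := by
  induction v with
  | nil => exact ⟨.nil, 1, .nil⟩
  | pair _ _ iha ihb =>
    obtain ⟨P, s, hP⟩ := iha
    obtain ⟨Q, t, hQ⟩ := ihb
    exact ⟨.pair P Q, s + t + 1, fun x => .pair (hP x) (hQ x)⟩

@[fun_prop] theorem PolyTime.const (b : β) : PolyTime fun _ : α => b := by
  obtain ⟨P, t, h⟩ := exists_prog_const (enc b)
  exact .mk P (.const t) (.const (sz b)) fun _ => ⟨t, le_rfl, h _⟩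

@[fun_prop] theorem PolyTime.id : PolyTime fun a : α => a :=
  .mk .arg (.const 1) .size fun _ => ⟨1, le_rfl, .arg _⟩

@[fun_prop] theorem PolyTime.comp {g : β → γ} {f : α → β} (hg : PolyTime g) (hf : PolyTime f) :
    PolyTime fun a => g (f a) := by
  have h1 := hf.polyBdd
  have h2 := hg.polyBdd.comp h1
  obtain ⟨P, S, hS, hP⟩ := hf.runs
  obtain ⟨Q, T, hT, hQ⟩ := hg.runs
  refine .mk (.seq P Q) ((hS.add (hT.comp h1)).add (.const 1)) h2 fun a => ?_
  obtain ⟨s, hs, h1⟩ := hP a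
  obtain ⟨t, ht, h2⟩ := hQ (f a)
  exact ⟨s + t + 1, by omega, .seq h1 h2⟩

@[fun_prop] theorem PolyTime.pair {f : α → β} {g : α → γ} (hf : PolyTime f) (hg : PolyTime g) :
    PolyTime fun a => (f a, g a) := by
  have h1 := hf.polyBdd
  have h2 := hg.polyBdd
  obtain ⟨P, S, hS, hP⟩ := hf.runs
  obtain ⟨Q, T, hT, hQ⟩ := hg.runs
  refine .mk (.pair P Q) ((hS.add hT).add (.const 1)) ((h1.add h2).add (.const 1)) fun a => ?_
  obtain ⟨s, hs, h1⟩ := hP a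
  obtain ⟨t, ht, h2⟩ := hQ a
  exact ⟨s + t + 1, by omega, .pair h1 h2⟩

theorem PolyTime.fst' : PolyTime (Prod.fst : α × β → α) :=
  .mk .fst (.const 1) (.of_le .size fun ⟨_, _⟩ => by simp; omega)
    fun a => ⟨1, le_rfl, .fst_pair _ _⟩

theorem PolyTime.snd' : PolyTime (Prod.snd : α × β → β) :=
  .mk .snd (.const 1) (.of_le .size fun ⟨_, _⟩ => by simp; omega)
    fun a => ⟨1, le_rfl, .snd_pair _ _⟩

@[fun_prop] theorem PolyTime.fst {f : α → β × γ} (hf : PolyTime f) : PolyTime fun a => (f a).1 :=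
  PolyTime.comp PolyTime.fst' hf

@[fun_prop] theorem PolyTime.snd {f : α → β × γ} (hf : PolyTime f) : PolyTime fun a => (f a).2 :=
  PolyTime.comp PolyTime.snd' hf

@[fun_prop] theorem PolyTime.cond {c : α → Bool} {f g : α → β} (hc : PolyTime c) (hf : PolyTime f)
    (hg : PolyTime g) : PolyTime fun a => bif c a then f a else g a := by
  have h1 := hf.polyBdd
  have h2 := hg.polyBdd
  obtain ⟨R, U, hU, hR⟩ := hc.runs
  obtain ⟨P, S, hS, hP⟩ := hf.runs
  obtain ⟨Q, T, hT, hQ⟩ := hg.runs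
  refine .mk (.ite R P Q) ((hU.add (hS.add hT)).add (.const 1))
    (.of_le (h1.add h2) fun a => by cases c a <;> simp) fun a => ?_
  obtain ⟨u, hu, h0⟩ := hR a
  obtain ⟨s, hs, h1⟩ := hP a
  obtain ⟨t, ht, h2⟩ := hQ a
  cases h : c a
  · rw [h] at h0; exact ⟨u + t + 1, by omega, .ite_false h0 h2⟩
  · rw [h] at h0; exact ⟨u + s + 1, by omega, .ite_true h0 h1⟩

@[fun_prop] theorem PolyTime.cons {f : α → β} {g : α → List β} (hf : PolyTime f) (hg : PolyTime g) :
    PolyTime fun a => f a :: g a := by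
  obtain ⟨P, b, h⟩ := hf.pair hg
  exact ⟨P, b, h⟩

theorem PolyTime.tail' : PolyTime (List.tail : List α → List α) :=
  .mk .snd (.const 1) (.of_le .size fun a => by cases a <;> simp; omega)
    fun a => ⟨1, le_rfl, by cases a; exacts [.snd_nil, .snd_pair _ _]⟩

@[fun_prop] theorem PolyTime.tail {f : α → List β} (hf : PolyTime f) :
    PolyTime fun a => (f a).tail := PolyTime.comp PolyTime.tail' hf

theorem PolyTime.isEmpty' : PolyTime (List.isEmpty : List α → Bool) := by
  refine .mk (.ite .arg .nil (.pair .nil .nil)) (.const 5)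
    (.of_le (.const 3) fun a => sz_bool_le _) fun a => ?_
  cases a
  exacts [⟨5, le_rfl, .ite_false (.arg _) (.pair (.nil _) (.nil _))⟩,
    ⟨3, by omega, .ite_true (.arg _) (.nil _)⟩]

@[fun_prop] theorem PolyTime.isEmpty {f : α → List β} (hf : PolyTime f) :
    PolyTime fun a => (f a).isEmpty := PolyTime.comp PolyTime.isEmpty' hf

theorem PolyTime.headD' : PolyTime fun x : List α × α => x.1.headD x.2 := by
  refine .mk (.ite .fst (.seq .fst .fst) .snd) (.const 5) (.of_le .size fun a => ?_) fun a => ?_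
  · rcases a with ⟨_ | _, _⟩ <;> simp <;> omega
  · rcases a with ⟨_ | ⟨a, l⟩, d⟩
    exacts [⟨3, by omega, .ite_false (.fst_pair _ _) (.snd_pair _ _)⟩,
      ⟨5, le_rfl, .ite_true (.fst_pair _ _) (.seq (.fst_pair _ _) (.fst_pair _ _))⟩]

@[fun_prop] theorem PolyTime.headD {f : α → List β} {g : α → β} (hf : PolyTime f)
    (hg : PolyTime g) : PolyTime fun a => (f a).headD (g a) :=
  PolyTime.comp (g := fun x : List β × β => x.1.headD x.2) PolyTime.headD' (hf.pair hg)

/-- Folds whose intermediate states are controlled by an invariant. -/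
theorem PolyTime.foldl_of_inv {l : α → List β} {s : α → σ} {g : α → σ → β → σ}
    (hl : PolyTime l) (hs : PolyTime s) (hg : PolyTime fun x : α × σ × β => g x.1 x.2.1 x.2.2)
    (I : α → ℕ → σ → Prop) (h0 : ∀ a, I a 0 (s a))
    (hI : ∀ a i x st, x ∈ l a → i < (l a).length → I a i st → I a (i + 1) (g a st x))
    {B : α → ℕ} (hB : PolyBdd B) (hIB : ∀ a i st, i ≤ (l a).length → I a i st → sz st ≤ B a) :
    PolyTime fun a => (l a).foldl (g a) (s a) := by
  have hl' := hl.polyBdd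
  obtain ⟨PL, TL, hTL, hPL⟩ := hl.runs
  obtain ⟨PS, TS, hTS, hPS⟩ := hs.runs
  obtain ⟨G, b, hG⟩ := hg
  set Tg : α → ℕ := fun a => b.eval (sz a + (B a + sz (l a) + 1) + 1)
  have hTg : PolyBdd Tg := by fun_prop
  -- The loop runs on the triple (remaining list, state, `a`). The body drops the head of the list,
  -- hands `a`, the state and the head to `G`, and keeps `a`; the 24 below covers the steps of a
  -- round outside `G`.
  let body : Prog := .pair (.seq .fst .snd) (.pair
    (.seq (.pair (.seq .snd .snd) (.pair (.seq .snd .fst) (.seq .fst .fst))) G) (.seq .snd .snd))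
  have key : ∀ (a : α) (m : List β) (i : ℕ) (st : σ), (∀ x ∈ m, x ∈ l a) →
      i + m.length = (l a).length → I a i st →
      sz (m.foldl (g a) st) ≤ B a ∧
      ∃ t ≤ m.length * (Tg a + 24) + 2, Runs (.loop .fst body)
        (.pair (enc m) (.pair (enc st) (enc a)))
        (.pair (enc ([] : List β)) (.pair (enc (m.foldl (g a) st)) (enc a))) t := by
    intro a m
    induction m with
    | nil =>
      intro i st _ hi h
      exact ⟨hIB a i st (by simp at hi; omega) h, 2, by simp, .loop_done (.fst_pair _ _)⟩
    | cons x m ih =>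
      intro i st hm hi h
      simp only [List.length_cons] at hi
      obtain ⟨h1, t, ht, hr⟩ := ih (i + 1) (g a st x) (fun y hy => hm y (by simp [hy])) (by omega)
        (hI a i x st (hm x (by simp)) (by omega) h)
      refine ⟨h1, ?_⟩
      obtain ⟨_, u, hu, hr'⟩ := hG (a, st, x)
      have hu' : u ≤ Tg a := by
        refine hu.trans (b.eval_mono_nat ?_)
        have := hIB a i st (by omega) h
        have := sz_le_of_mem (hm x (by simp))
        simp
        omega
      refine ⟨_, ?_, .loop_step (.fst_pair _ _) (.pair (.seq (.fst_pair _ _) (.snd_pair _ _))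
        (.pair (.seq (.pair (.seq (.snd_pair _ _) (.snd_pair _ _)) (.pair
          (.seq (.snd_pair _ _) (.fst_pair _ _)) (.seq (.fst_pair _ _) (.fst_pair _ _)))) hr')
          (.seq (.snd_pair _ _) (.snd_pair _ _)))) hr⟩
      simp only [List.length_cons, add_mul]
      omega
  refine .mk (.seq (.seq (.pair PL (.pair PS .arg)) (.loop .fst body)) (.seq .snd .fst))
    (T := fun a => TL a + TS a + sz (l a) * (Tg a + 24) + 20) (by fun_prop)
    (hB.of_le fun a => (key a (l a) 0 (s a) (fun _ h => h) (by simp) (h0 a)).1) fun a => ?_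
  obtain ⟨t, ht, hr⟩ := (key a (l a) 0 (s a) (fun _ h => h) (by simp) (h0 a)).2
  obtain ⟨u, hu, hr1⟩ := hPL a
  obtain ⟨v, hv, hr2⟩ := hPS a
  refine ⟨_, ?_, .seq (.seq (.pair hr1 (.pair hr2 (.arg _))) hr)
    (.seq (.snd_pair _ _) (.fst_pair _ _))⟩
  have := Nat.mul_le_mul_right (Tg a + 24) (length_lt_sz (l a)).le
  omega

/-- Folds in which every step increases the size of the state by a bounded amount. -/
theorem PolyTime.foldl {l : α → List β} {s : α → σ} {g : α → σ → β → σ}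
    (hl : PolyTime l) (hs : PolyTime s) (hg : PolyTime fun x : α × σ × β => g x.1 x.2.1 x.2.2)
    {B : α → ℕ} (hB : PolyBdd B) (hgB : ∀ a, ∀ x ∈ l a, ∀ st, sz (g a st x) ≤ sz st + B a) :
    PolyTime fun a => (l a).foldl (g a) (s a) := by
  have hl' := hl.polyBdd
  have hs' := hs.polyBdd
  refine hl.foldl_of_inv hs hg (fun a i st => sz st ≤ sz (s a) + i * B a) (fun a => by simp)
    (fun a i x st hx _ h => ?_) (B := fun a => sz (s a) + sz (l a) * B a) (by fun_prop) ?_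
  · have := hgB a x hx st
    simp only [add_mul]
    omega
  · intro a i st hi h
    have := Nat.mul_le_mul_right (B a) (hi.trans (length_lt_sz (l a)).le)
    omega

@[fun_prop] theorem PolyTime.reverse {l : α → List β} (hl : PolyTime l) :
    PolyTime fun a => (l a).reverse := by
  have hl' := hl.polyBdd
  have := PolyTime.foldl (l := l) (s := fun _ => []) (g := fun _ s x => x :: s) hl (by fun_prop)
    (by fun_prop) (B := fun a => sz (l a) + 1) (by fun_prop) fun a x hx st => by
      have := sz_le_of_mem hx
      simp
      omega
  exact this.of_eq fun a => by simp

theorem PolyTime.foldr {l : α → List β} {s : α → σ} {g : α → β → σ → σ}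
    (hl : PolyTime l) (hs : PolyTime s) (hg : PolyTime fun x : α × β × σ => g x.1 x.2.1 x.2.2)
    {B : α → ℕ} (hB : PolyBdd B) (hgB : ∀ a, ∀ x ∈ l a, ∀ st, sz (g a x st) ≤ sz st + B a) :
    PolyTime fun a => (l a).foldr (g a) (s a) := by
  have hg' : PolyTime fun x : α × σ × β => g x.1 x.2.2 x.2.1 :=
    hg.comp (f := fun x : α × σ × β => (x.1, x.2.2, x.2.1)) (by fun_prop)
  have := PolyTime.foldl (l := fun a => (l a).reverse) (g := fun a s x => g a x s)
    (by fun_prop) hs hg' hB fun a x hx st => hgB a x (by simpa using hx) st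
  exact this.of_eq fun a => by rw [List.foldl_reverse]

@[fun_prop] theorem PolyTime.append {l m : α → List β} (hl : PolyTime l) (hm : PolyTime m) :
    PolyTime fun a => l a ++ m a := by
  have hl' := hl.polyBdd
  have := PolyTime.foldr (l := l) (s := m) (g := fun _ x s => x :: s) hl hm
    (by fun_prop) (B := fun a => sz (l a) + 1) (by fun_prop) fun a x hx st => by
      have := sz_le_of_mem hx
      simp
      omega
  exact this.of_eq fun a => by simp

@[fun_prop] theorem PolyTime.map {l : α → List β} {g : α → β → γ} (hl : PolyTime l)
    (hg : PolyTime fun x : α × β => g x.1 x.2) : PolyTime fun a => (l a).map (g a) := by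
  have hl' := hl.polyBdd
  obtain ⟨b, hb⟩ := hg.polyBdd
  have := PolyTime.foldr (l := l) (s := fun _ => []) (g := fun a x s => g a x :: s) hl
    (by fun_prop) (by fun_prop) (B := fun a => b.eval (sz a + sz (l a) + 1) + 1) (by fun_prop)
    fun a x hx st => by
      have h1 := sz_le_of_mem hx
      have h2 := (hb (a, x)).trans (b.eval_mono_nat (show _ ≤ sz a + sz (l a) + 1 by simp; omega))
      simp at h2 ⊢
      omega
  exact this.of_eq fun a => by induction l a <;> simp_all

@[fun_prop] theorem PolyTime.flatten {l : α → List (List β)} (hl : PolyTime l) :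
    PolyTime fun a => (l a).flatten := by
  have hl' := hl.polyBdd
  have := PolyTime.foldr (l := l) (s := fun _ => []) (g := fun a x s => x ++ s) hl
    (by fun_prop) (by fun_prop) (B := fun a => sz (l a)) (by fun_prop) fun a x hx st => by
      have := sz_le_of_mem hx
      have := sz_append x st
      omega
  exact this.of_eq fun a => by induction l a <;> simp_all

@[fun_prop] theorem PolyTime.flatMap {l : α → List β} {g : α → β → List γ} (hl : PolyTime l)
    (hg : PolyTime fun x : α × β => g x.1 x.2) : PolyTime fun a => (l a).flatMap (g a) := by
  have : PolyTime fun a => ((l a).map (g a)).flatten := by fun_prop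
  exact this

end PolyTime

/-! ### Lists and Booleans -/

section
open Enc
variable {α β γ δ σ : Type} [Enc α] [Enc β] [Enc γ] [Enc δ] [Enc σ]

@[fun_prop] theorem PolyTime.not {f : α → Bool} (hf : PolyTime f) : PolyTime fun a => !(f a) := by
  have : PolyTime fun a => bif f a then false else true := by fun_prop
  exact this.of_eq fun a => by cases f a <;> rfl

@[fun_prop] theorem PolyTime.and {f g : α → Bool} (hf : PolyTime f) (hg : PolyTime g) :
    PolyTime fun a => f a && g a := by
  have : PolyTime fun a => bif f a then g a else false := by fun_prop
  exact this.of_eq fun a => by cases f a <;> rfl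

@[fun_prop] theorem PolyTime.or {f g : α → Bool} (hf : PolyTime f) (hg : PolyTime g) :
    PolyTime fun a => f a || g a := by
  have : PolyTime fun a => bif f a then true else g a := by fun_prop
  exact this.of_eq fun a => by cases f a <;> rfl

@[fun_prop] theorem PolyTime.xor {f g : α → Bool} (hf : PolyTime f) (hg : PolyTime g) :
    PolyTime fun a => f a ^^ g a := by
  have : PolyTime fun a => bif f a then !(g a) else g a := by fun_prop
  exact this.of_eq fun a => by cases f a <;> simp

@[fun_prop] theorem PolyTime.all {l : α → List β} {g : α → β → Bool} (hl : PolyTime l)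
    (hg : PolyTime fun x : α × β => g x.1 x.2) : PolyTime fun a => (l a).all (g a) := by
  have := PolyTime.foldr (l := l) (s := fun _ => true) (g := fun a x s => g a x && s) hl
    (by fun_prop) (by fun_prop) (B := fun _ => 3) (by fun_prop) fun a x _ st =>
      (sz_bool_le _).trans (by omega)
  exact this.of_eq fun a => by induction l a <;> simp_all

@[fun_prop] theorem PolyTime.filter {l : α → List β} {g : α → β → Bool} (hl : PolyTime l)
    (hg : PolyTime fun x : α × β => g x.1 x.2) : PolyTime fun a => (l a).filter (g a) := by
  have : PolyTime fun a => (l a).flatMap fun x => bif g a x then [x] else [] := by fun_prop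
  exact this.of_eq fun a => by
    induction l a with
    | nil => rfl
    | cons x l ih => rw [List.flatMap_cons, ih]; cases h : g a x <;> simp [h]

@[fun_prop] theorem PolyTime.dropLast {f : α → List β} (hf : PolyTime f) :
    PolyTime fun a => (f a).dropLast := by
  have : PolyTime fun a => ((f a).reverse.tail).reverse := by fun_prop
  exact this.of_eq fun a => by simp

@[fun_prop] theorem PolyTime.getLastD {f : α → List β} {g : α → β} (hf : PolyTime f)
    (hg : PolyTime g) : PolyTime fun a => (f a).getLastD (g a) := by
  have : PolyTime fun a => (f a).reverse.headD (g a) := by fun_prop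
  exact this.of_eq fun a => by simp [List.getLastD_eq_getLast?, List.headD_eq_head?_getD]

-- The suffixes of a list serve later as the unary numbers up to its length. They are built from the
-- shortest to the longest, each from the head of the list accumulated so far.
@[fun_prop] theorem PolyTime.tails {f : α → List β} (hf : PolyTime f) :
    PolyTime fun a => (f a).tails := by
  have hf' := hf.polyBdd
  have := PolyTime.foldl_of_inv (l := fun a => (f a).reverse) (s := fun _ => [[]])
    (g := fun a (s : List (List β)) x => (x :: s.headD []) :: s) (by fun_prop) (by fun_prop)
    (by fun_prop) (fun a i s => s.length = i + 1 ∧ ∀ t ∈ s, sz t ≤ 1 + i * sz (f a)) (by simp)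
    (B := fun a => (sz (f a) + 1) * (1 + sz (f a) * sz (f a) + 1) + 1)
    (fun a i x st hx _ h => by
      have h1 := sz_le_of_mem hx
      rw [sz_reverse] at h1
      refine ⟨by simp [h.1], fun t ht => ?_⟩
      rw [List.mem_cons] at ht
      rcases ht with rfl | ht
      · rcases st with _ | ⟨u, st⟩
        · simp at h
        · have := h.2 u (by simp)
          simp [add_mul]
          omega
      · have := h.2 t ht
        rw [add_mul]
        omega) (by fun_prop) fun a i st hi h => by
      have h0 := length_lt_sz (f a)
      rw [List.length_reverse] at hi
      refine (sz_list_le (B := 1 + sz (f a) * sz (f a)) fun t ht => (h.2 t ht).trans ?_).trans ?_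
      · gcongr
        omega
      · gcongr
        omega
  refine this.of_eq fun a => ?_
  rw [List.foldl_reverse]
  induction f a with
  | nil => rfl
  | cons x l ih => rw [List.foldr_cons, ih]; cases l <;> simp

@[fun_prop] theorem PolyTime.zip [Inhabited γ] {f : α → List β} {g : α → List γ} (hf : PolyTime f)
    (hg : PolyTime g) : PolyTime fun a => (f a).zip (g a) := by
  have hf' := hf.polyBdd
  have hg' := hg.polyBdd
  have := PolyTime.foldl_of_inv (l := f) (s := fun a => (g a, ([] : List (β × γ))))
    -- The state holds the unused rest of the second list and the reversed result; the default is
    -- never used.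
    (g := fun _ s x => bif s.1.isEmpty then s else (s.1.tail, (x, s.1.headD default) :: s.2)) hf
    (by fun_prop) (by fun_prop)
    (fun a i s => s.1.Sublist (g a) ∧ sz s.2 ≤ 1 + i * (sz (f a) + sz (g a) + 2)) (by simp)
    (B := fun a => sz (g a) + sz (f a) * (sz (f a) + sz (g a) + 2) + 2)
    (fun a i x st hx _ h => by
      have h1 := sz_le_of_mem hx
      rcases st with ⟨_ | ⟨y, l⟩, m⟩
      · exact ⟨h.1, h.2.trans (by gcongr; omega)⟩
      · have h2 := sz_le_of_mem (h.1.subset List.mem_cons_self)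
        refine ⟨(List.sublist_cons_self y l).trans h.1, ?_⟩
        have := h.2
        simp only [add_mul, List.isEmpty_cons, cond_false, List.headD_cons, sz_cons, sz_pair] at *
        omega) (by fun_prop) fun a i st hi h => by
      have h1 := sz_sublist h.1
      have h2 := Nat.mul_le_mul_right (sz (f a) + sz (g a) + 2)
        (hi.trans (length_lt_sz (f a)).le)
      have h3 := h.2
      rcases st with ⟨s, t⟩
      simp only [sz_pair] at *
      omega
  have := (PolyTime.snd this).reverse
  refine this.of_eq fun a => ?_
  suffices ∀ (l : List β) (m : List γ) (o : List (β × γ)), (l.foldl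
      (fun s x => bif s.1.isEmpty then s else (s.1.tail, (x, s.1.headD default) :: s.2))
      (m, o)).2.reverse = o.reverse ++ l.zip m by simpa using this (f a) (g a) []
  intro l
  induction l with
  | nil => simp
  | cons x l ih =>
    rintro (_ | ⟨y, m⟩) o
    · have := ih [] o
      simp at this
      simpa using this
    · exact (ih m ((x, y) :: o)).trans (by simp)

@[fun_prop] theorem PolyTime.zipWith [Inhabited γ] {f : α → List β} {g : α → List γ}
    {h : α → β → γ → δ} (hf : PolyTime f) (hg : PolyTime g)
    (hh : PolyTime fun x : α × β × γ => h x.1 x.2.1 x.2.2) :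
    PolyTime fun a => (f a).zipWith (h a) (g a) := by
  have : PolyTime fun a => ((f a).zip (g a)).map fun x => h a x.1 x.2 :=
    .map (g := fun a (x : β × γ) => h a x.1 x.2) (by fun_prop) hh
  exact this.of_eq fun a => by rw [List.zip, List.map_zipWith]

end

/-! ### Binary arithmetic -/

section
variable {α : Type} [Enc α]

theorem sz_nat (n : ℕ) : sz n = sz n.bits := rfl

theorem sz_nat_le (n : ℕ) : sz n ≤ 4 * n.size + 1 := by
  rw [sz_nat, ← Nat.size_eq_bits_len]
  exact (sz_list_le fun b _ => sz_bool_le b).trans (by omega)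

theorem size_lt_sz (n : ℕ) : n.size < sz n := by
  rw [sz_nat, ← Nat.size_eq_bits_len]
  exact length_lt_sz _

-- A number and its list of binary digits have the same encoding, so the same program serves for
-- both; `PolyTime.of_bits` is the converse.
@[fun_prop] theorem PolyTime.bits {f : α → ℕ} (hf : PolyTime f) : PolyTime fun a => (f a).bits := by
  obtain ⟨P, b, h⟩ := hf
  exact ⟨P, b, h⟩

/-- Digit lists carry no leading zero, so a zero digit is discarded exactly when no higher digit
follows. -/
theorem Nat.bits_bit (b : Bool) (n : ℕ) :
    (Nat.bit b n).bits = bif b || !(n.bits.isEmpty) then b :: n.bits else [] := by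
  rcases Decidable.em (n = 0 → b = true) with h | h
  · rw [Nat.bits_append_bit n b h]
    cases b
    · have : n.bits ≠ [] := by
        intro h'
        have := congrArg List.length h'
        rw [Nat.size_eq_bits_len] at this
        simp [Nat.size_eq_zero.1 this] at h
      simp [List.isEmpty_eq_false_iff.2 this]
    · simp
  · simp at h
    simp [h]

theorem PolyTime.of_bits {f : α → ℕ} (hf : PolyTime fun a => (f a).bits) : PolyTime f := by
  obtain ⟨P, b, h⟩ := hf
  exact ⟨P, b, h⟩

@[fun_prop] theorem PolyTime.natBit {f : α → Bool} {g : α → ℕ} (hf : PolyTime f)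
    (hg : PolyTime g) : PolyTime fun a => Nat.bit (f a) (g a) := by
  refine .of_bits ?_
  simp only [Nat.bits_bit]
  fun_prop

@[fun_prop] theorem PolyTime.natDiv2 {f : α → ℕ} (hf : PolyTime f) :
    PolyTime fun a => (f a).div2 := by
  refine .of_bits ?_
  simp only [Nat.div2_bits_eq_tail]
  fun_prop

@[fun_prop] theorem PolyTime.natBodd {f : α → ℕ} (hf : PolyTime f) :
    PolyTime fun a => (f a).bodd := by
  simp only [Nat.bodd_eq_bits_head]
  have : PolyTime fun a => (f a).bits.headD false := by fun_prop
  exact this.of_eq fun a => by cases (f a).bits <;> rfl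

theorem Nat.size_div2_le (n : ℕ) : sz n.div2 ≤ sz n := by
  rw [sz_nat, sz_nat, Nat.div2_bits_eq_tail]
  exact sz_sublist (List.tail_sublist _)

/-- The number with the given binary digits, most significant digit first. -/
def ofDigits (l : List Bool) : ℕ := l.foldl (fun m b => Nat.bit b m) 0

theorem sz_natBit_le (b : Bool) (n : ℕ) : sz (Nat.bit b n) ≤ sz n + 4 := by
  rw [sz_nat, Nat.bits_bit, sz_nat]
  have := sz_bool_le b
  cases b || !(n.bits.isEmpty)
  · simp
  · simp only [cond_true, sz_cons]
    omega

@[fun_prop] theorem PolyTime.natOfDigits {f : α → List Bool} (hf : PolyTime f) :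
    PolyTime fun a => ofDigits (f a) :=
  PolyTime.foldl (g := fun _ m b => Nat.bit b m) hf (by fun_prop) (by fun_prop)
    (.const 4) fun a _ _ _ => sz_natBit_le _ _

theorem ofDigits_cons (b : Bool) (l : List Bool) :
    ofDigits (b :: l) = b.toNat * 2 ^ l.length + ofDigits l := by
  have (l : List Bool) (n : ℕ) :
      l.foldl (fun m b => Nat.bit b m) n = n * 2 ^ l.length + ofDigits l := by
    induction l generalizing n with
    | nil => simp [ofDigits]
    | cons b l ih =>
      rw [ofDigits, List.foldl_cons, List.foldl_cons, ih, ih (Nat.bit b 0)]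
      simp [Nat.bit_val, pow_succ]
      ring
  rw [ofDigits, List.foldl_cons, this]
  simp [Nat.bit_val]

/-- One step of binary addition. -/
def addStep (s : Bool × ℕ × ℕ × List Bool) : Bool × ℕ × ℕ × List Bool :=
  ((s.2.1.bodd && s.2.2.1.bodd) || (s.1 && (s.2.1.bodd || s.2.2.1.bodd)), s.2.1.div2, s.2.2.1.div2,
    (s.1 ^^ s.2.1.bodd ^^ s.2.2.1.bodd) :: s.2.2.2)

/-- One step of binary subtraction. -/
def subStep (s : Bool × ℕ × ℕ × List Bool) : Bool × ℕ × ℕ × List Bool :=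
  ((!s.2.1.bodd && (s.2.2.1.bodd || s.1)) || (s.2.2.1.bodd && s.1), s.2.1.div2, s.2.2.1.div2,
    (s.1 ^^ s.2.1.bodd ^^ s.2.2.1.bodd) :: s.2.2.2)

theorem Nat.eq_bodd_add_div2 (n : ℕ) : n = n.bodd.toNat + 2 * n.div2 := by
  conv_lhs => rw [← Nat.bodd_add_div2 n]

/-- Iterate `step` on two binary numbers sufficiently often. -/
def digitLoop (step : Bool × ℕ × ℕ × List Bool → Bool × ℕ × ℕ × List Bool) (a b : ℕ) :
    Bool × ℕ × ℕ × List Bool :=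
  (true :: (a.bits ++ b.bits)).foldl (fun s _ => step s) (false, a, b, [])

theorem PolyTime.natDigitLoop {step : Bool × ℕ × ℕ × List Bool → Bool × ℕ × ℕ × List Bool}
    (h : PolyTime step) (hs : ∀ s, ∃ c d, step s = (c, s.2.1.div2, s.2.2.1.div2, d :: s.2.2.2))
    {f g : α → ℕ} (hf : PolyTime f) (hg : PolyTime g) :
    PolyTime fun a => digitLoop step (f a) (g a) :=
  PolyTime.foldl (g := fun _ s _ => step s) (l := fun a => true :: ((f a).bits ++ (g a).bits))
    (s := fun a => (false, f a, g a, [])) (by fun_prop) (by fun_prop) (by fun_prop) (.const 6)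
    fun a _ _ s => by
      obtain ⟨c, d, h⟩ := hs s
      have h1 := Nat.size_div2_le s.2.1
      have h2 := Nat.size_div2_le s.2.2.1
      have h3 := sz_bool_le c
      have h4 := sz_bool_le d
      have h5 := one_le_sz s.1
      rw [h]
      rcases s with ⟨s1, s2, s3, s4⟩
      simp only [sz_pair, sz_cons] at *
      omega

/-- The digit loop makes one round more than the two lengths together, so `a + b` is below 2 to the
number of rounds and no carry is left over. -/
theorem Nat.lt_two_pow_bits (a b : ℕ) :
    a < 2 ^ (true :: (a.bits ++ b.bits)).length / 2 ∧ b < 2 ^ (true :: (a.bits ++ b.bits)).length / 2 := by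
  simp only [List.length_cons, List.length_append, Nat.size_eq_bits_len, pow_succ]
  rw [Nat.mul_div_cancel _ two_pos]
  exact ⟨a.lt_size_self.trans_le (Nat.pow_le_pow_right two_pos (by omega)),
    b.lt_size_self.trans_le (Nat.pow_le_pow_right two_pos (by omega))⟩

theorem digitLoop_add (a b : ℕ) : ofDigits (digitLoop addStep a b).2.2.2 = a + b := by
  -- Loop invariant: the digits produced so far, plus 2 to their number times (carry plus the rests
  -- of the operands), have constant value.
  have key (l : List Bool) (s : Bool × ℕ × ℕ × List Bool) :
      let s' := l.foldl (fun s _ => addStep s) s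
      s'.2.2.2.length = s.2.2.2.length + l.length ∧
      ofDigits s'.2.2.2 + 2 ^ s'.2.2.2.length * (s'.1.toNat + s'.2.1 + s'.2.2.1) =
      ofDigits s.2.2.2 + 2 ^ s.2.2.2.length * (s.1.toNat + s.2.1 + s.2.2.1) := by
    induction l generalizing s with
    | nil => simp
    | cons x l ih =>
      obtain ⟨h1, h2⟩ := ih (addStep s)
      refine ⟨by rw [List.foldl_cons, h1]; simp [addStep]; omega, ?_⟩
      rw [List.foldl_cons, h2]
      obtain ⟨c, m, n, o⟩ := s
      conv_rhs => rw [Nat.eq_bodd_add_div2 m, Nat.eq_bodd_add_div2 n]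
      simp only [addStep, ofDigits_cons, List.length_cons, pow_succ]
      cases c <;> cases m.bodd <;> cases n.bodd <;> simp <;> ring
  obtain ⟨h1, h2⟩ := key (true :: (a.bits ++ b.bits)) (false, a, b, [])
  have h3 := Nat.lt_two_pow_bits a b
  change (digitLoop addStep a b).2.2.2.length = _ at h1
  change ofDigits (digitLoop addStep a b).2.2.2 + 2 ^ (digitLoop addStep a b).2.2.2.length *
    ((digitLoop addStep a b).1.toNat + (digitLoop addStep a b).2.1 +
      (digitLoop addStep a b).2.2.1) = _ at h2
  generalize digitLoop addStep a b = s at *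
  rw [h1] at h2
  simp only [List.length_nil, zero_add] at h2
  generalize (true :: (a.bits ++ b.bits)).length = N at *
  simp only [ofDigits, List.foldl_nil, Bool.toNat_false, pow_zero, zero_add, one_mul] at h2
  rcases Nat.eq_zero_or_pos (s.1.toNat + s.2.1 + s.2.2.1) with h | h
  · rw [h] at h2
    exact h2
  · have := Nat.le_mul_of_pos_right (2 ^ N) h
    omega

@[fun_prop] theorem PolyTime.natAdd {f g : α → ℕ} (hf : PolyTime f) (hg : PolyTime g) :
    PolyTime fun a => f a + g a := by
  have := PolyTime.natDigitLoop (step := addStep) (by unfold addStep; fun_prop)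
    (fun s => ⟨_, _, rfl⟩) hf hg
  exact (PolyTime.natOfDigits (.snd (.snd (.snd this)))).of_eq fun a => digitLoop_add _ _

theorem digitLoop_sub (a b : ℕ) : (digitLoop subStep a b).1 = decide (a < b) ∧
    (b ≤ a → ofDigits (digitLoop subStep a b).2.2.2 = a - b) := by
  -- The same invariant with signs. At the end both operands are exhausted, so only the borrow is
  -- left; as the produced digits lie in `[0, 2 ^ length)`, it is set exactly when the difference is
  -- negative.
  have key (l : List Bool) (s : Bool × ℕ × ℕ × List Bool) :
      let s' := l.foldl (fun s _ => subStep s) s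
      s'.2.2.2.length = s.2.2.2.length + l.length ∧
      ofDigits s'.2.2.2 + 2 ^ s'.2.2.2.length * ((s'.2.1 : ℤ) - s'.2.2.1 - s'.1.toNat) =
      ofDigits s.2.2.2 + 2 ^ s.2.2.2.length * ((s.2.1 : ℤ) - s.2.2.1 - s.1.toNat) ∧
      s'.2.1 = s.2.1 / 2 ^ l.length ∧ s'.2.2.1 = s.2.2.1 / 2 ^ l.length ∧
      (ofDigits s.2.2.2 < 2 ^ s.2.2.2.length → ofDigits s'.2.2.2 < 2 ^ s'.2.2.2.length) := by
    induction l generalizing s with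
    | nil => simp
    | cons x l ih =>
      obtain ⟨h1, h2, h3, h4, h5⟩ := ih (subStep s)
      refine ⟨by rw [List.foldl_cons, h1]; simp [subStep]; omega, ?_, ?_, ?_, ?_⟩
      · rw [List.foldl_cons, h2]
        obtain ⟨c, m, n, o⟩ := s
        conv_rhs => rw [Nat.eq_bodd_add_div2 m, Nat.eq_bodd_add_div2 n]
        simp only [subStep, ofDigits_cons, List.length_cons, pow_succ]
        cases c <;> cases m.bodd <;> cases n.bodd <;> simp <;> ring
      · rw [List.foldl_cons, h3, List.length_cons, pow_succ', ← Nat.div_div_eq_div_mul]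
        simp [subStep, Nat.div2_val]
      · rw [List.foldl_cons, h4, List.length_cons, pow_succ', ← Nat.div_div_eq_div_mul]
        simp [subStep, Nat.div2_val]
      · intro h
        refine h5 ?_
        simp only [subStep, ofDigits_cons, List.length_cons, pow_succ]
        have := Bool.toNat_le (s.1 ^^ s.2.1.bodd ^^ s.2.2.1.bodd)
        nlinarith
  obtain ⟨h1, h2, h3, h4, h5⟩ := key (true :: (a.bits ++ b.bits)) (false, a, b, [])
  have h6 := Nat.lt_two_pow_bits a b
  rw [Nat.div_eq_of_lt (h6.1.trans_le (Nat.div_le_self _ _))] at h3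
  rw [Nat.div_eq_of_lt (h6.2.trans_le (Nat.div_le_self _ _))] at h4
  rw [h3, h4] at h2
  have h7 := h5 (by simp [ofDigits])
  change (ofDigits (digitLoop subStep a b).2.2.2 : ℤ) + 2 ^ (digitLoop subStep a b).2.2.2.length *
    (((0 : ℕ) : ℤ) - ((0 : ℕ) : ℤ) - (digitLoop subStep a b).1.toNat) = _ at h2
  change ofDigits (digitLoop subStep a b).2.2.2 < 2 ^ (digitLoop subStep a b).2.2.2.length at h7
  generalize digitLoop subStep a b = s at *
  zify at h7
  simp only [ofDigits, List.foldl_nil, List.length_nil, Bool.toNat_false, pow_zero, one_mul,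
    Nat.cast_zero] at h2 h7 ⊢
  cases h : s.1 <;> rw [h] at h2 <;> simp at h2 ⊢ <;> omega

@[fun_prop] theorem PolyTime.natLt {f g : α → ℕ} (hf : PolyTime f) (hg : PolyTime g) :
    PolyTime fun a => decide (f a < g a) := by
  have := PolyTime.natDigitLoop (step := subStep) (by unfold subStep; fun_prop)
    (fun s => ⟨_, _, rfl⟩) hf hg
  exact (PolyTime.fst this).of_eq fun a => (digitLoop_sub _ _).1

@[fun_prop] theorem PolyTime.natSub {f g : α → ℕ} (hf : PolyTime f) (hg : PolyTime g) :
    PolyTime fun a => f a - g a := by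
  have h1 := PolyTime.natDigitLoop (step := subStep) (by unfold subStep; fun_prop)
    (fun s => ⟨_, _, rfl⟩) hf hg
  have h2 := PolyTime.natOfDigits (.snd (.snd (.snd h1)))
  have : PolyTime fun a => bif decide (f a < g a) then 0 else
    ofDigits (digitLoop subStep (f a) (g a)).2.2.2 := by fun_prop
  refine this.of_eq fun a => ?_
  rcases lt_or_ge (f a) (g a) with h | h
  · simp [h]; omega
  · simp [not_lt.2 h, (digitLoop_sub _ _).2 h]

@[fun_prop] theorem PolyTime.natEqZero {f : α → ℕ} (hf : PolyTime f) :
    PolyTime fun a => f a == 0 := by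
  have : PolyTime fun a => !(decide (0 < f a)) := by fun_prop
  refine this.of_eq fun a => ?_
  rcases Nat.eq_zero_or_pos (f a) with h | h
  · simp [h]
  · simp [h]; omega

theorem PolyBdd.natSize {f : α → ℕ} (hf : PolyTime f) : PolyBdd fun a => (f a).size :=
  .of_le hf.polyBdd fun _ => (size_lt_sz _).le

/-- Folds over natural numbers whose bit length increases by a bounded amount in each step. -/
theorem PolyTime.foldr_nat {β : Type} [Enc β] {l : α → List β} {s : α → ℕ} {g : α → β → ℕ → ℕ}
    (hl : PolyTime l) (hs : PolyTime s) (hg : PolyTime fun x : α × β × ℕ => g x.1 x.2.1 x.2.2)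
    {B : α → ℕ} (hB : PolyBdd B) (hgB : ∀ a, ∀ x ∈ l a, ∀ n, g a x n ≤ 2 ^ (B a) * (n + 2 ^ B a)) :
    PolyTime fun a => (l a).foldr (g a) (s a) := by
  have hl' := hl.polyBdd
  have hs' := PolyBdd.natSize hs
  have hg' : PolyTime fun x : α × ℕ × β => g x.1 x.2.2 x.2.1 :=
    hg.comp (f := fun x : α × ℕ × β => (x.1, x.2.2, x.2.1)) (by fun_prop)
  have := PolyTime.foldl_of_inv (l := fun a => (l a).reverse) (g := fun a s x => g a x s)
    -- The summand `B a` makes the bound dominate `2 ^ B a` from the start, so each step costs only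
    -- `B a + 1` further bits.
    (by fun_prop) hs hg' (fun a i n => n.size ≤ (s a).size + B a + i * (B a + 1)) (by simp)
    (fun a i x n hx _ h => by
      have h1 := hgB a x (by simpa using hx) n
      have h2 := Nat.lt_size_self n
      have h3 := h2.trans_le (Nat.pow_le_pow_right two_pos h)
      have h4 : 2 ^ B a ≤ 2 ^ ((s a).size + B a + i * (B a + 1)) :=
        Nat.pow_le_pow_right two_pos (by omega)
      rw [Nat.size_le]
      refine h1.trans_lt ((Nat.mul_lt_mul_of_pos_left
        (show _ < 2 * 2 ^ ((s a).size + B a + i * (B a + 1)) by omega) (by positivity)).trans_eq ?_)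
      ring)
    (B := fun a => 4 * ((s a).size + B a + sz (l a) * (B a + 1)) + 1) (by fun_prop)
    fun a i n hi h => (sz_nat_le n).trans (by
      have := hi.trans (by simpa using (length_lt_sz (l a)).le)
      gcongr
      exact h.trans (by gcongr))
  exact this.of_eq fun a => by rw [List.foldl_reverse]

/-- Horner's scheme: `bits` starts with the least significant digit, so a right fold consumes the
digits from the top. Double-and-add multiplication, long division and fast exponentiation are
instances. -/
theorem Nat.foldr_bits {σ : Type} (n : ℕ) (F : ℕ → σ) (g : Bool → σ → σ)
    (h : ∀ b m, F (Nat.bit b m) = g b (F m)) : F n = n.bits.foldr g (F 0) := by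
  induction n using Nat.binaryRec' with
  | zero => simp
  | bit b n hn ih => rw [Nat.bits_append_bit n b hn, List.foldr_cons, ← ih, h]

@[fun_prop] theorem PolyTime.natMul {f g : α → ℕ} (hf : PolyTime f) (hg : PolyTime g) :
    PolyTime fun a => f a * g a := by
  have hB := PolyBdd.natSize hg
  have := PolyTime.foldr_nat (l := fun a => (f a).bits) (s := fun _ => 0)
    (g := fun a b n => n + n + bif b then g a else 0) (by fun_prop) (by fun_prop) (by fun_prop)
    (B := fun a => (g a).size + 1) (by fun_prop) (fun a x _ n => by
      have h1 := Nat.lt_size_self (g a)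
      have h2 : 2 ^ (g a).size ≥ 1 := Nat.one_le_two_pow
      have : (bif x then g a else 0) ≤ 2 ^ (g a).size := by cases x <;> simp; omega
      rw [pow_succ]
      nlinarith)
  refine this.of_eq fun a => ?_
  refine (zero_mul (g a) ▸ Nat.foldr_bits (f a) (fun n => n * g a) _ fun b m => ?_).symm
  cases b <;> simp [Nat.bit_val] <;> ring

/-- The residue modulo `p`, or `0` if `p = 0`. -/
def modP (p n : ℕ) : ℕ := if p = 0 then 0 else n % p

@[fun_prop] theorem PolyTime.natModP {f g : α → ℕ} (hf : PolyTime f) (hg : PolyTime g) :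
    PolyTime fun a => modP (f a) (g a) := by
  have := PolyTime.foldr_nat (l := fun a => (g a).bits) (s := fun _ => 0)
    (g := fun a b n => bif decide (Nat.bit b n < f a) then Nat.bit b n else Nat.bit b n - f a)
    (by fun_prop) (by fun_prop) (by fun_prop)
    (B := fun a => 1) (by fun_prop) (fun a x _ n => by
      cases decide (Nat.bit x n < f a) <;> cases x <;> simp [Nat.bit_val] <;> omega)
  have : PolyTime fun a => bif f a == 0 then 0 else (g a).bits.foldr (fun b n =>
    bif decide (Nat.bit b n < f a) then Nat.bit b n else Nat.bit b n - f a) 0 := by fun_prop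
  refine this.of_eq fun a => ?_
  rcases Nat.eq_zero_or_pos (f a) with h | h
  · simp [h, _root_.modP]
  · have h' : (f a == 0) = false := by simp; omega
    rw [modP, if_neg h.ne', h', cond_false]
    refine ((Nat.zero_mod (f a)) ▸ Nat.foldr_bits (g a) (fun n => n % f a) _ fun b m => ?_).symm
    have h1 := Nat.mod_lt m h
    have h2 : Nat.bit b m % f a = Nat.bit b (m % f a) % f a := by
      simp [Nat.bit_val, Nat.add_mod, Nat.mul_mod]
    rw [h2]
    set n := m % f a
    rcases lt_or_ge (Nat.bit b n) (f a) with h3 | h3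
    · simp [h3, Nat.mod_eq_of_lt h3]
    -- The previous remainder is below the modulus, so after doubling a single subtraction suffices.
    · have h4 : Nat.bit b n < 2 * f a := by cases b <;> simp [Nat.bit_val] <;> omega
      rw [Nat.mod_eq_sub_mod h3, Nat.mod_eq_of_lt (by omega)]
      simp [not_lt.2 h3]

/-- This needs the convention at `p = 0`, since `n % 0 = n`. The size bounds of an `Arith` are
demanded for all descriptions, also meaningless ones. -/
theorem modP_le (p n : ℕ) : modP p n ≤ p := by
  unfold modP
  split_ifs with h
  · omega
  · exact (Nat.mod_lt _ (by omega)).le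

/-- The factor is there because size is not monotone: a digit one takes more nodes than a digit
zero. -/
theorem sz_nat_mono {m n : ℕ} (h : m ≤ n) : sz m ≤ 4 * sz n := by
  have h1 := sz_nat_le m
  have h2 := size_lt_sz n
  have h3 := Nat.size_le_size h
  omega

@[fun_prop] theorem PolyTime.length {β : Type} [Enc β] {l : α → List β} (hl : PolyTime l) :
    PolyTime fun a => (l a).length := by
  have := PolyTime.foldr_nat (s := fun _ => 0) (g := fun _ _ n => n + 1) hl (by fun_prop)
    (by fun_prop) (.const 1) fun a _ _ n => by omega
  exact this.of_eq fun a => by induction l a <;> simp_all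

end


/-! ### Computable commutative rings

An `Arith γ X` is a family of rings of characteristic `p`, indexed by descriptions of type `γ`,
with elements represented in `X`. -/

/-- Polynomial-time arithmetic in a family of finite-dimensional algebras over prime fields. The
operations return results of size polynomial in the size of the description of the ring. -/
structure Arith (γ X : Type) [Enc γ] [Enc X] where
  /-- addition -/
  add : γ → X → X → X
  /-- multiplication -/
  mul : γ → X → X → X
  /-- negation -/
  neg : γ → X → X
  /-- multiplication by a scalar from the prime field -/
  smul : γ → ℕ → X → X
  /-- zero -/
  zero : γ → X
  /-- one -/
  one : γ → X
  /-- the values at `x` and `y` of some coordinate that does not vanish at `x` if `x ≠ 0` -/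
  piv : γ → X → X → ℕ × ℕ
  /-- a basis over the prime field -/
  basis : γ → List X
  /-- the size of the results -/
  bound : ℕ[X]
  polyTime_add' : PolyTime fun t : γ × X × X => add t.1 t.2.1 t.2.2
  polyTime_mul' : PolyTime fun t : γ × X × X => mul t.1 t.2.1 t.2.2
  polyTime_neg' : PolyTime fun t : γ × X => neg t.1 t.2
  polyTime_smul' : PolyTime fun t : γ × ℕ × X => smul t.1 t.2.1 t.2.2
  polyTime_zero' : PolyTime zero
  polyTime_one' : PolyTime one
  polyTime_piv' : PolyTime fun t : γ × X × X => piv t.1 t.2.1 t.2.2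
  polyTime_basis' : PolyTime basis
  sz_add_le : ∀ c x y, sz (add c x y) ≤ bound.eval (sz c)
  sz_mul_le : ∀ c x y, sz (mul c x y) ≤ bound.eval (sz c)
  sz_neg_le : ∀ c x, sz (neg c x) ≤ bound.eval (sz c)
  sz_smul_le : ∀ c n x, sz (smul c n x) ≤ bound.eval (sz c)
  sz_zero_le : ∀ c, sz (zero c) ≤ bound.eval (sz c)

namespace Arith

section
variable {γ X α : Type} [Enc γ] [Enc X] [Enc α] (M : Arith γ X)

@[fun_prop] theorem polyTime_add {c : α → γ} {x y : α → X} (hc : PolyTime c) (hx : PolyTime x)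
    (hy : PolyTime y) : PolyTime fun a => M.add (c a) (x a) (y a) :=
  PolyTime.comp M.polyTime_add' (hc.pair (hx.pair hy))

@[fun_prop] theorem polyTime_mul {c : α → γ} {x y : α → X} (hc : PolyTime c) (hx : PolyTime x)
    (hy : PolyTime y) : PolyTime fun a => M.mul (c a) (x a) (y a) :=
  PolyTime.comp M.polyTime_mul' (hc.pair (hx.pair hy))

@[fun_prop] theorem polyTime_neg {c : α → γ} {x : α → X} (hc : PolyTime c) (hx : PolyTime x) :
    PolyTime fun a => M.neg (c a) (x a) :=
  PolyTime.comp M.polyTime_neg' (hc.pair hx)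

@[fun_prop] theorem polyTime_smul {c : α → γ} {n : α → ℕ} {x : α → X} (hc : PolyTime c)
    (hn : PolyTime n) (hx : PolyTime x) : PolyTime fun a => M.smul (c a) (n a) (x a) :=
  PolyTime.comp M.polyTime_smul' (hc.pair (hn.pair hx))

@[fun_prop] theorem polyTime_zero {c : α → γ} (hc : PolyTime c) :
    PolyTime fun a => M.zero (c a) := PolyTime.comp M.polyTime_zero' hc

@[fun_prop] theorem polyTime_one {c : α → γ} (hc : PolyTime c) :
    PolyTime fun a => M.one (c a) := PolyTime.comp M.polyTime_one' hc

@[fun_prop] theorem polyTime_piv {c : α → γ} {x y : α → X} (hc : PolyTime c) (hx : PolyTime x)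
    (hy : PolyTime y) : PolyTime fun a => M.piv (c a) (x a) (y a) :=
  PolyTime.comp M.polyTime_piv' (hc.pair (hx.pair hy))

@[fun_prop] theorem polyTime_basis {c : α → γ} (hc : PolyTime c) :
    PolyTime fun a => M.basis (c a) := PolyTime.comp M.polyTime_basis' hc

/-- Subtraction. -/
def sub (c : γ) (x y : X) : X := M.add c x (M.neg c y)

@[fun_prop] theorem polyTime_sub {c : α → γ} {x y : α → X} (hc : PolyTime c) (hx : PolyTime x)
    (hy : PolyTime y) : PolyTime fun a => M.sub (c a) (x a) (y a) := by
  unfold sub; fun_prop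

/-- Test for zero. -/
def isZero (c : γ) (x : X) : Bool := (M.piv c x x).1 == 0

@[fun_prop] theorem polyTime_isZero {c : α → γ} {x : α → X} (hc : PolyTime c) (hx : PolyTime x) :
    PolyTime fun a => M.isZero (c a) (x a) := by
  unfold isZero; fun_prop

/-- The power of `x` whose exponent has the given binary digits. -/
def pow (c : γ) (x : X) (l : List Bool) : X :=
  l.foldr (fun b y => bif b then M.mul c (M.mul c y y) x else M.mul c y y) (M.one c)

@[fun_prop] theorem polyTime_pow {c : α → γ} {x : α → X} {l : α → List Bool} (hc : PolyTime c)
    (hx : PolyTime x) (hl : PolyTime l) : PolyTime fun a => M.pow (c a) (x a) (l a) :=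
  PolyTime.foldr (g := fun a b y => bif b then M.mul (c a) (M.mul (c a) y y) (x a) else
    M.mul (c a) y y) (by fun_prop) (by fun_prop) (by fun_prop)
    (B := fun a => M.bound.eval (sz (c a))) (by fun_prop)
    fun a b _ y => by cases b <;> exact (M.sz_mul_le _ _ _).trans (by omega)

/-- The `n`-fold `p`-power, where `n` is the length of `l` and `p` has the binary digits `d`. -/
def frob {β : Type} (c : γ) (d : List Bool) (l : List β) (x : X) : X :=
  l.foldl (fun y _ => M.pow c y d) x

theorem sz_pow_le (c : γ) (x : X) (l : List Bool) :
    sz (M.pow c x l) ≤ M.bound.eval (sz c) + sz (M.one c) := by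
  unfold pow
  rcases l with _ | ⟨b, l⟩
  · simp
  · cases b <;> exact (M.sz_mul_le _ _ _).trans (by omega)

@[fun_prop] theorem polyTime_frob {β : Type} [Enc β] {c : α → γ} {x : α → X} {d : α → List Bool}
    {l : α → List β} (hc : PolyTime c) (hd : PolyTime d) (hl : PolyTime l) (hx : PolyTime x) :
    PolyTime fun a => M.frob (c a) (d a) (l a) (x a) :=
  PolyTime.foldl (g := fun a y _ => M.pow (c a) y (d a)) (by fun_prop) (by fun_prop) (by fun_prop)
    (B := fun a => M.bound.eval (sz (c a)) + sz (M.one (c a))) (by fun_prop)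
    fun a b _ y => (M.sz_pow_le _ _ _).trans (by omega)

end

/-! #### Prime fields -/

section
variable {α : Type} [Enc α]

/-- Arithmetic modulo `p`. -/
noncomputable def prime : Arith ℕ ℕ where
  add p x y := modP p (x + y)
  mul p x y := modP p (x * y)
  neg p x := modP p (p - modP p x)
  smul p x y := modP p (x * y)
  zero _ := 0
  one p := modP p 1
  piv _ x y := (x, y)
  basis p := [modP p 1]
  bound := 4 * Polynomial.X
  polyTime_add' := by fun_prop
  polyTime_mul' := by fun_prop
  polyTime_neg' := by fun_prop
  polyTime_smul' := by fun_prop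
  polyTime_zero' := by fun_prop
  polyTime_one' := by fun_prop
  polyTime_piv' := by fun_prop
  polyTime_basis' := by fun_prop
  sz_add_le p x y := by simpa using sz_nat_mono (modP_le p (x + y))
  sz_mul_le p x y := by simpa using sz_nat_mono (modP_le p (x * y))
  sz_neg_le p x := by simpa using sz_nat_mono (modP_le p _)
  sz_smul_le p x y := by simpa using sz_nat_mono (modP_le p (x * y))
  sz_zero_le p := by simpa using sz_nat_mono (Nat.zero_le p)

end

/-! #### Simple extensions

The description of the extension `R[g]` consists of the description of `R` and the list of the
coefficients of `g ^ d` in the basis `1, g, …, g ^ (d - 1)`. -/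

namespace Ext
variable {γ X α : Type} [Enc γ] [Enc X] [Enc α] [Inhabited X] (M : Arith γ X)

/-- addition -/
def add (c : γ × List X) (a b : List X) : List X :=
  -- Zipping with `c.2` cuts the result to the length prescribed by the ring, so its size is
  -- controlled even for ill-formed operands.
  (c.2.zip (a.zip b)).map fun t => M.add c.1 t.2.1 t.2.2

/-- negation -/
def neg (c : γ × List X) (a : List X) : List X := (c.2.zip a).map fun t => M.neg c.1 t.2

/-- scalar multiplication -/
def smul (c : γ × List X) (n : ℕ) (a : List X) : List X :=
  (c.2.zip a).map fun t => M.smul c.1 n t.2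

/-- zero -/
def zero (c : γ × List X) : List X := c.2.map fun _ => M.zero c.1

/-- the inclusion of the base ring -/
def const (c : γ × List X) (x : X) : List X := (x :: zero M c).dropLast

/-- multiplication by the generator -/
def shift (c : γ × List X) (a : List X) : List X :=
  -- The last coefficient moves to `g ^ d` and is rewritten through `c.2`.
  add M c (M.zero c.1 :: a).dropLast (c.2.map fun t => M.mul c.1 (a.getLastD (M.zero c.1)) t)

/-- multiplication -/
def mul (c : γ × List X) (a b : List X) : List X :=
  a.foldr (fun x y => add M c (b.map fun t => M.mul c.1 x t) (shift M c y)) (zero M c)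

/-- coordinates -/
def piv (c : γ × List X) (a b : List X) : ℕ × ℕ :=
  (a.zip b).foldr (fun t s => bif (M.piv c.1 t.1 t.2).1 == 0 then s else M.piv c.1 t.1 t.2) (0, 0)

/-- the multiples of an element by powers of the generator -/
def shifts (c : γ × List X) (a : List X) : List (List X) :=
  (c.2.foldl (fun s _ => (shift M c s.1, s.1 :: s.2)) (a, [])).2

/-- basis -/
def basis (c : γ × List X) : List (List X) :=
  (M.basis c.1).flatMap fun e => shifts M c (const M c e)

theorem sz_le_of_length_le {c : γ × List X} {l : List X} (hl : l.length ≤ c.2.length)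
    (h : ∀ t ∈ l, sz t ≤ M.bound.eval (sz c.1)) :
    sz l ≤ sz c * (M.bound.eval (sz c) + 1) + 1 := by
  have h0 : sz c.1 ≤ sz c ∧ sz c.2 ≤ sz c := by
    rcases c with ⟨c, h⟩
    simp only [sz_pair]
    omega
  refine (sz_list_le (B := M.bound.eval (sz c)) fun a ha =>
    (h a ha).trans (M.bound.eval_mono_nat h0.1)).trans ?_
  have := length_lt_sz c.2
  gcongr
  omega

theorem sz_map_le {β : Type} (c : γ × List X) (l : List β) (g : X × β → X)
    (h : ∀ t, sz (g t) ≤ M.bound.eval (sz c.1)) :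
    sz ((c.2.zip l).map g) ≤ sz c * (M.bound.eval (sz c) + 1) + 1 :=
  sz_le_of_length_le M (by simp) fun a ha => by
    obtain ⟨t, _, rfl⟩ := List.mem_map.1 ha
    exact h t

theorem sz_zero_le (c : γ × List X) : sz (zero M c) ≤ sz c * (M.bound.eval (sz c) + 1) + 1 :=
  sz_le_of_length_le M (by simp [zero]) fun a ha => by
    obtain ⟨t, _, rfl⟩ := List.mem_map.1 ha
    exact M.sz_zero_le _

variable {c : α → γ × List X}

@[fun_prop] theorem polyTime_add (hc : PolyTime c) {x y : α → List X} (hx : PolyTime x)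
    (hy : PolyTime y) : PolyTime fun a => add M (c a) (x a) (y a) := by unfold add; fun_prop

@[fun_prop] theorem polyTime_neg (hc : PolyTime c) {x : α → List X} (hx : PolyTime x) :
    PolyTime fun a => neg M (c a) (x a) := by unfold neg; fun_prop

@[fun_prop] theorem polyTime_smul (hc : PolyTime c) {n : α → ℕ} (hn : PolyTime n) {x : α → List X}
    (hx : PolyTime x) : PolyTime fun a => smul M (c a) (n a) (x a) := by unfold smul; fun_prop

@[fun_prop] theorem polyTime_zero (hc : PolyTime c) : PolyTime fun a => zero M (c a) := by
  unfold zero; fun_prop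

@[fun_prop] theorem polyTime_const (hc : PolyTime c) {x : α → X} (hx : PolyTime x) :
    PolyTime fun a => const M (c a) (x a) := by unfold const; fun_prop

@[fun_prop] theorem polyTime_shift (hc : PolyTime c) {x : α → List X} (hx : PolyTime x) :
    PolyTime fun a => shift M (c a) (x a) := by unfold shift; fun_prop

theorem sz_add_le (c : γ × List X) (a b : List X) :
    sz (add M c a b) ≤ sz c * (M.bound.eval (sz c) + 1) + 1 :=
  sz_map_le M c _ _ fun _ => M.sz_add_le _ _ _

@[fun_prop] theorem polyTime_mul (hc : PolyTime c) {x y : α → List X} (hx : PolyTime x)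
    (hy : PolyTime y) : PolyTime fun a => mul M (c a) (x a) (y a) :=
  PolyTime.foldr (g := fun a t s => add M (c a) ((y a).map fun u => M.mul (c a).1 t u)
    (shift M (c a) s)) (by fun_prop) (by fun_prop) (by fun_prop)
    (B := fun a => sz (c a) * (M.bound.eval (sz (c a)) + 1) + 1) (by fun_prop)
    fun a b _ y => (sz_add_le M _ _ _).trans (by omega)

@[fun_prop] theorem polyTime_piv (hc : PolyTime c) {x y : α → List X} (hx : PolyTime x)
    (hy : PolyTime y) : PolyTime fun a => piv M (c a) (x a) (y a) := by
  obtain ⟨b, hb⟩ := M.polyTime_piv'.polyBdd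
  refine PolyTime.foldr (g := fun a (t : X × X) s => bif (M.piv (c a).1 t.1 t.2).1 == 0 then s else
    M.piv (c a).1 t.1 t.2) (l := fun a => (x a).zip (y a)) (by fun_prop) (by fun_prop) (by fun_prop)
    (B := fun a => b.eval (sz (c a).1 + sz (x a) + sz (y a) + 2)) (by fun_prop)
    fun a t ht s => ?_
  have h1 := sz_le_of_mem (List.of_mem_zip ht).1
  have h2 := sz_le_of_mem (List.of_mem_zip ht).2
  have h3 := (hb ((c a).1, t)).trans (b.eval_mono_nat (show _ ≤ sz (c a).1 + sz (x a) + sz (y a) + 2 by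
    rcases t with ⟨t, u⟩; simp only [sz_pair] at *; omega))
  cases (M.piv (c a).1 t.1 t.2).1 == 0
  · exact h3.trans (by omega)
  · exact Nat.le_add_right _ _

@[fun_prop] theorem polyTime_shifts (hc : PolyTime c) {x : α → List X} (hx : PolyTime x) :
    PolyTime fun a => shifts M (c a) (x a) := by
  refine PolyTime.snd (PolyTime.foldl_of_inv (l := fun a => (c a).2)
    (g := fun a (s : List X × List (List X)) _ => (shift M (c a) s.1, s.1 :: s.2))
    (s := fun a => (x a, [])) (by fun_prop) (by fun_prop) (by fun_prop)
    (fun a i s => sz s.1 ≤ sz (x a) + sz (c a) * (M.bound.eval (sz (c a)) + 1) + 1 ∧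
      sz s.2 ≤ i * (sz (x a) + sz (c a) * (M.bound.eval (sz (c a)) + 1) + 2) + 1)
    (fun a => by simp; omega) (fun a i t s _ _ h => ?_)
    (B := fun a => (sz (x a) + sz (c a) * (M.bound.eval (sz (c a)) + 1) + 1) +
      (sz (c a).2 * (sz (x a) + sz (c a) * (M.bound.eval (sz (c a)) + 1) + 2) + 1) + 1)
    (by fun_prop) fun a i s hi h => ?_)
  · refine ⟨(sz_add_le M _ _ _).trans (by omega), ?_⟩
    have := h.1
    have := h.2
    simp only [sz_cons]
    rw [add_mul]
    omega
  · have h1 := h.1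
    have h2 := h.2.trans (Nat.add_le_add_right (Nat.mul_le_mul_right _
      (hi.trans (length_lt_sz _).le)) 1)
    rcases s with ⟨s, t⟩
    simp only [sz_pair] at *
    omega

@[fun_prop] theorem polyTime_basis (hc : PolyTime c) : PolyTime fun a => basis M (c a) := by
  unfold basis; fun_prop

end Ext

/-- Arithmetic in simple extensions. -/
noncomputable def ext {γ X : Type} [Enc γ] [Enc X] [Inhabited X] (M : Arith γ X) :
    Arith (γ × List X) (List X) where
  add := Ext.add M
  mul := Ext.mul M
  neg := Ext.neg M
  smul := Ext.smul M
  zero := Ext.zero M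
  one c := Ext.const M c (M.one c.1)
  piv := Ext.piv M
  basis := Ext.basis M
  bound := Polynomial.X * (M.bound + 1) + 1
  polyTime_add' := by fun_prop
  polyTime_mul' := by fun_prop
  polyTime_neg' := by fun_prop
  polyTime_smul' := by fun_prop
  polyTime_zero' := by fun_prop
  polyTime_one' := by fun_prop
  polyTime_piv' := by fun_prop
  polyTime_basis' := by fun_prop
  sz_add_le c x y := (Ext.sz_add_le M c x y).trans (by simp)
  sz_mul_le c x y := by
    rcases x with _ | ⟨t, x⟩
    · exact (Ext.sz_zero_le M c).trans (by simp)
    · exact (Ext.sz_add_le M c _ _).trans (by simp)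
  sz_neg_le c x := (Ext.sz_map_le M c _ _ fun _ => M.sz_neg_le _ _).trans (by simp)
  sz_smul_le c n x := (Ext.sz_map_le M c _ _ fun _ => M.sz_smul_le _ _ _).trans (by simp)
  sz_zero_le c := (Ext.sz_zero_le M c).trans (by simp)

end Arith


/-! ### Interpretation of the representations -/

/-- The data described by `c` represent the elements of the ring `R`. -/
structure Interp {γ X : Type} [Enc γ] [Enc X] (M : Arith γ X) (c : γ) (p : ℕ) (R : Type*)
    [CommRing R] [Algebra (ZMod p) R] where
  /-- well-formed representatives -/
  wf : X → Prop
  /-- the represented element -/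
  val : X → R
  inj : ∀ {x y}, wf x → wf y → val x = val y → x = y
  wf_zero : wf (M.zero c)
  wf_one : wf (M.one c)
  wf_add : ∀ {x y}, wf x → wf y → wf (M.add c x y)
  wf_mul : ∀ {x y}, wf x → wf y → wf (M.mul c x y)
  wf_neg : ∀ {x}, wf x → wf (M.neg c x)
  wf_smul : ∀ {n x}, wf x → wf (M.smul c n x)
  val_zero : val (M.zero c) = 0
  val_one : val (M.one c) = 1
  val_add : ∀ {x y}, wf x → wf y → val (M.add c x y) = val x + val y
  val_mul : ∀ {x y}, wf x → wf y → val (M.mul c x y) = val x * val y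
  val_neg : ∀ {x}, wf x → val (M.neg c x) = -val x
  val_smul : ∀ {n x}, wf x → val (M.smul c n x) = (n : ZMod p) • val x
  -- The functional is chosen from `x` before `y` is known, so one fixed coordinate serves to clear
  -- a whole column. The bound by `p` lets a comparison of numbers with zero decide vanishing modulo
  -- `p`.
  piv : ∀ {x}, wf x → ∃ φ : R →ₗ[ZMod p] ZMod p, (val x ≠ 0 → φ (val x) ≠ 0) ∧
    ∀ {y}, wf y → (M.piv c x y).1 < p ∧ ((M.piv c x y).1 : ZMod p) = φ (val x) ∧
      ((M.piv c x y).2 : ZMod p) = φ (val y)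
  wf_basis : ∀ x ∈ M.basis c, wf x
  span_basis : Submodule.span (ZMod p) {a | ∃ x ∈ M.basis c, val x = a} = ⊤

namespace Interp

section
variable {γ X : Type} [Enc γ] [Enc X] {M : Arith γ X} {c : γ} {p : ℕ} {R : Type*}
    [CommRing R] [Algebra (ZMod p) R] (I : Interp M c p R)
include I

theorem wf_sub {x y : X} (hx : I.wf x) (hy : I.wf y) : I.wf (M.sub c x y) :=
  I.wf_add hx (I.wf_neg hy)

theorem val_sub {x y : X} (hx : I.wf x) (hy : I.wf y) :
    I.val (M.sub c x y) = I.val x - I.val y := by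
  rw [Arith.sub, I.val_add hx (I.wf_neg hy), I.val_neg hy, sub_eq_add_neg]

theorem piv_eq_zero {x y : X} (hx : I.wf x) (hy : I.wf y) :
    (M.piv c x y).1 = 0 ↔ I.val x = 0 := by
  obtain ⟨φ, h1, h2⟩ := I.piv hx
  obtain ⟨h3, h4, -⟩ := h2 hy
  constructor
  · intro h
    by_contra h'
    exact h1 h' (by rw [← h4, h, Nat.cast_zero])
  · intro h
    rw [h, map_zero, ZMod.natCast_eq_zero_iff] at h4
    exact Nat.eq_zero_of_dvd_of_lt h4 h3

theorem isZero_iff {x : X} (hx : I.wf x) : M.isZero c x = true ↔ I.val x = 0 := by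
  rw [Arith.isZero, beq_iff_eq, I.piv_eq_zero hx hx]

theorem pow_spec {x : X} (hx : I.wf x) (n : ℕ) :
    I.wf (M.pow c x n.bits) ∧ I.val (M.pow c x n.bits) = I.val x ^ n := by
  have (l : List Bool) : I.wf (M.pow c x l) ∧
      I.val (M.pow c x l) = I.val x ^ l.foldr (fun b n => Nat.bit b n) 0 := by
    induction l with
    | nil => exact ⟨I.wf_one, by simp [Arith.pow, I.val_one]⟩
    | cons b l ih =>
      obtain ⟨h1, h2⟩ := ih
      have h3 := I.wf_mul h1 h1
      have h4 := I.val_mul h1 h1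
      cases b
      · exact ⟨h3, h4.trans (by rw [h2, List.foldr_cons, Nat.bit_val]; simp; ring)⟩
      · exact ⟨I.wf_mul h3 hx, (I.val_mul h3 hx).trans
          (by rw [h4, h2, List.foldr_cons, Nat.bit_val]; simp; ring)⟩
  convert this n.bits using 3
  exact Nat.foldr_bits n (fun n => n) _ fun _ _ => rfl

theorem frob_spec {β : Type} {x : X} (hx : I.wf x) (n : ℕ) (l : List β) :
    I.wf (M.frob c n.bits l x) ∧ I.val (M.frob c n.bits l x) = I.val x ^ n ^ l.length := by
  induction l generalizing x with
  | nil => exact ⟨hx, by simp [Arith.frob]⟩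
  | cons b l ih =>
    obtain ⟨h1, h2⟩ := I.pow_spec hx n
    obtain ⟨h3, h4⟩ := ih h1
    exact ⟨h3, h4.trans (by rw [h2, ← pow_mul, List.length_cons, pow_succ'])⟩

end

theorem modP_of_pos {p : ℕ} (hp : 0 < p) (n : ℕ) : modP p n = n % p := if_neg hp.ne'

/-- Residues represent the elements of the prime field. -/
def prime (p : ℕ) (hp : p.Prime) : Interp Arith.prime p p (ZMod p) where
  wf x := x < p
  val x := x
  inj {x y} hx hy h := by
    rwa [ZMod.natCast_eq_natCast_iff', Nat.mod_eq_of_lt hx, Nat.mod_eq_of_lt hy] at h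
  wf_zero := hp.pos
  wf_one := by simpa [Arith.prime, modP_of_pos hp.pos] using Nat.mod_lt 1 hp.pos
  wf_add {x y} _ _ := by simpa [Arith.prime, modP_of_pos hp.pos] using Nat.mod_lt _ hp.pos
  wf_mul {x y} _ _ := by simpa [Arith.prime, modP_of_pos hp.pos] using Nat.mod_lt _ hp.pos
  wf_neg {x} _ := by simpa [Arith.prime, modP_of_pos hp.pos] using Nat.mod_lt _ hp.pos
  wf_smul {n x} _ := by simpa [Arith.prime, modP_of_pos hp.pos] using Nat.mod_lt _ hp.pos
  val_zero := by simp [Arith.prime]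
  val_one := by simp [Arith.prime, modP_of_pos hp.pos]
  val_add {x y} _ _ := by simp [Arith.prime, modP_of_pos hp.pos]
  val_mul {x y} _ _ := by simp [Arith.prime, modP_of_pos hp.pos]
  val_neg {x} _ := by
    simp [Arith.prime, modP_of_pos hp.pos, Nat.cast_sub (Nat.mod_lt x hp.pos).le]
  val_smul {n x} _ := by simp [Arith.prime, modP_of_pos hp.pos]
  piv {x} hx := ⟨LinearMap.id, fun h => h, fun {y} _ => ⟨hx, rfl, rfl⟩⟩
  wf_basis x hx := by
    simp only [Arith.prime, List.mem_singleton] at hx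
    subst hx
    simpa [Arith.prime, modP_of_pos hp.pos] using Nat.mod_lt 1 hp.pos
  span_basis := by
    simp only [Arith.prime, List.mem_singleton, exists_eq_left, modP_of_pos hp.pos,
      ZMod.natCast_mod, Nat.cast_one]
    rw [eq_top_iff]
    intro a _
    rw [← mul_one a]
    exact Submodule.smul_mem _ a (Submodule.subset_span rfl)

theorem algebraMap_smul_of_tower {K R A : Type*} [CommSemiring K] [CommSemiring R] [Semiring A]
    [Algebra K R] [Algebra R A] [Algebra K A] [IsScalarTower K R A] (n : K) (r : R) :
    algebraMap R A (n • r) = n • algebraMap R A r :=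
  map_smul (IsScalarTower.toAlgHom K R A) n r

/-! ### Correctness of the arithmetic in simple extensions -/

section Ext
open Arith

variable {γ X : Type} [Enc γ] [Enc X] [Inhabited X] {M : Arith γ X} {c : γ} {p : ℕ} {R : Type*}
    [CommRing R] [Algebra (ZMod p) R] (I : Interp M c p R)
    {A : Type*} [CommRing A] [Algebra R A] [Algebra (ZMod p) A] [IsScalarTower (ZMod p) R A]

/-- The value at `g` of the polynomial with the coefficients `l`. -/
def evalList (I : Interp M c p R) (g : A) (l : List X) : A :=
  l.foldr (fun x a => algebraMap R A (I.val x) + g * a) 0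

@[simp] theorem evalList_nil (g : A) : I.evalList g [] = 0 := rfl

@[simp] theorem evalList_cons (g : A) (x : X) (l : List X) :
    I.evalList g (x :: l) = algebraMap R A (I.val x) + g * I.evalList g l := rfl

theorem evalList_append_singleton (g : A) (l : List X) (x : X) :
    I.evalList g (l ++ [x]) = I.evalList g l + g ^ l.length * algebraMap R A (I.val x) := by
  induction l with
  | nil => simp
  | cons y l ih => simp [ih, pow_succ]; ring

theorem evalList_eq_sum (g : A) (l : List X) :
    I.evalList g l = ∑ i : Fin l.length, algebraMap R A (I.val l[i]) * g ^ (i : ℕ) := by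
  induction l with
  | nil => simp
  | cons x l ih =>
    rw [evalList_cons, ih, Finset.mul_sum]
    simp only [List.length_cons, Fin.sum_univ_succ]
    simp [pow_succ]
    exact Finset.sum_congr rfl fun i _ => by ring

/-- well-formed lists -/
def ListWf (I : Interp M c p R) (d : ℕ) (l : List X) : Prop := l.length = d ∧ ∀ x ∈ l, I.wf x

section ops
variable {h : List X} {g : A} {d : ℕ} (hh : I.ListWf d h)
include hh

theorem zero_spec : I.ListWf d (Ext.zero M (c, h)) ∧ I.evalList g (Ext.zero M (c, h)) = 0 := by
  refine ⟨⟨by simp [Ext.zero, hh.1], fun x hx => ?_⟩, ?_⟩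
  · obtain ⟨_, _, rfl⟩ := List.mem_map.1 hx
    exact I.wf_zero
  · unfold Ext.zero
    generalize (c, h).2 = l
    induction l with
    | nil => rfl
    | cons a l ih => rw [List.map_cons, evalList_cons, ih, I.val_zero]; simp

/-- The common core of addition, negation and scalar multiplication: a coordinatewise operation in
which `h` contributes nothing but its length. -/
theorem zip_map_spec {β : Type} {l : List β} (hl : l.length = d) {k : X × β → X} {P : β → Prop}
    {v : β → R} (hP : ∀ b ∈ l, P b) (hk : ∀ t, P t.2 → I.wf (k t) ∧ I.val (k t) = v t.2) :
    I.ListWf d ((h.zip l).map k) ∧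
    I.evalList g ((h.zip l).map k) = l.foldr (fun x a => algebraMap R A (v x) + g * a) 0 := by
  obtain ⟨rfl, -⟩ := hh
  induction l generalizing h with
  | nil => simp at hl; simp [hl.symm, ListWf]
  | cons b l ih =>
    rcases h with _ | ⟨a, h⟩
    · simp at hl
    · obtain ⟨⟨h1, h2⟩, h3⟩ := ih (h := h) (fun b hb => hP b (by simp [hb])) (by simpa using hl)
      obtain ⟨h4, h5⟩ := hk (a, b) (hP b (by simp))
      refine ⟨⟨by simp at hl; simp [hl], ?_⟩, by simp [h5, h3]⟩
      simpa [h4] using h2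

theorem add_spec {a b : List X} (ha : I.ListWf d a) (hb : I.ListWf d b) :
    I.ListWf d (Ext.add M (c, h) a b) ∧
    I.evalList g (Ext.add M (c, h) a b) = I.evalList g a + I.evalList g b := by
  obtain ⟨h1, h2⟩ := I.zip_map_spec hh (g := g) (l := a.zip b) (by simp [ha.1, hb.1])
    (k := fun t => M.add c t.2.1 t.2.2) (P := fun t => I.wf t.1 ∧ I.wf t.2)
    (v := fun t => I.val t.1 + I.val t.2)
    (fun t ht => ⟨ha.2 _ (List.of_mem_zip ht).1, hb.2 _ (List.of_mem_zip ht).2⟩)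
    fun t ht => ⟨I.wf_add ht.1 ht.2, I.val_add ht.1 ht.2⟩
  refine ⟨h1, h2.trans ?_⟩
  have h3 : a.length = b.length := ha.1.trans hb.1.symm
  clear h1 h2 ha hb hh
  induction a generalizing b with
  | nil => simp at h3; simp [List.length_eq_zero_iff.1 h3.symm]
  | cons x a ih =>
    rcases b with _ | ⟨y, b⟩
    · simp at h3
    · rw [List.zip_cons_cons, List.foldr_cons, ih (by simpa using h3), map_add, evalList_cons,
        evalList_cons]
      ring

theorem neg_spec {a : List X} (ha : I.ListWf d a) : I.ListWf d (Ext.neg M (c, h) a) ∧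
    I.evalList g (Ext.neg M (c, h) a) = -I.evalList g a := by
  obtain ⟨h1, h2⟩ := I.zip_map_spec hh (g := g) ha.1 (k := fun t => M.neg c t.2) (P := I.wf)
    (v := fun t => - I.val t) ha.2 fun t ht => ⟨I.wf_neg ht, I.val_neg ht⟩
  refine ⟨h1, h2.trans ?_⟩
  clear h1 h2 ha hh
  induction a with
  | nil => simp
  | cons x a ih => rw [List.foldr_cons, ih, map_neg, evalList_cons]; ring

theorem smul_spec {n : ℕ} {a : List X} (ha : I.ListWf d a) : I.ListWf d (Ext.smul M (c, h) n a) ∧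
    I.evalList g (Ext.smul M (c, h) n a) = (n : ZMod p) • I.evalList g a := by
  obtain ⟨h1, h2⟩ := I.zip_map_spec hh (g := g) ha.1 (k := fun t => M.smul c n t.2) (P := I.wf)
    (v := fun t => (n : ZMod p) • I.val t) ha.2 fun t ht => ⟨I.wf_smul ht, I.val_smul ht⟩
  refine ⟨h1, h2.trans ?_⟩
  clear h1 h2 ha hh
  induction a with
  | nil => simp
  | cons x a ih =>
    rw [List.foldr_cons, ih, algebraMap_smul_of_tower, evalList_cons, smul_add, mul_smul_comm]

omit hh in
theorem scale_spec {x : X} (hx : I.wf x) {a : List X} (ha : I.ListWf d a) :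
    I.ListWf d (a.map fun t => M.mul c x t) ∧
    I.evalList g (a.map fun t => M.mul c x t) = algebraMap R A (I.val x) * I.evalList g a := by
  refine ⟨⟨by simp [ha.1], fun y hy => ?_⟩, ?_⟩
  · obtain ⟨t, ht, rfl⟩ := List.mem_map.1 hy
    exact I.wf_mul hx (ha.2 t ht)
  · replace ha := ha.2
    induction a with
    | nil => simp
    | cons y a ih =>
      simp [ih fun z hz => ha z (by simp [hz]), I.val_mul hx (ha y (by simp))]
      ring

theorem const_spec (hd : 0 < d) {x : X} (hx : I.wf x) : I.ListWf d (Ext.const M (c, h) x) ∧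
    I.evalList g (Ext.const M (c, h) x) = algebraMap R A (I.val x) := by
  obtain ⟨d, rfl⟩ : ∃ e, d = e + 1 := ⟨d - 1, by omega⟩
  rcases h with _ | ⟨y, h⟩
  · simp [ListWf] at hh
  · have h1 : Ext.const M (c, y :: h) x = x :: Ext.zero M (c, h) := by
      simp [Ext.const, Ext.zero]
    have h2 : I.ListWf d h := ⟨by simpa using hh.1, fun x hx => hh.2 x (by simp [hx])⟩
    obtain ⟨h3, h4⟩ := I.zero_spec h2 (g := g)
    rw [h1]
    refine ⟨⟨by simp [h3.1], ?_⟩, by simp [h4]⟩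
    simpa [hx] using h3.2

/-- Split off the last coefficient `x` of `a`: multiplication by `g` shifts the others and turns the
last term into `x * g ^ d`, which `hg` replaces by `x` times the value of `h`. -/
theorem shift_spec (hd : 0 < d) (hg : g ^ d = I.evalList g h) {a : List X} (ha : I.ListWf d a) :
    I.ListWf d (Ext.shift M (c, h) a) ∧
    I.evalList g (Ext.shift M (c, h) a) = g * I.evalList g a := by
  rcases List.eq_nil_or_concat a with rfl | ⟨a, x, rfl⟩
  · simp [ListWf] at ha; omega
  · have hx := ha.2 x (by simp)
    have ha' : I.ListWf d (M.zero c :: a) := ⟨by simpa using ha.1, by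
      intro y hy
      rw [List.mem_cons] at hy
      rcases hy with rfl | hy
      · exact I.wf_zero
      · exact ha.2 y (by simp [hy])⟩
    have h1 := I.scale_spec (g := g) hx hh
    have h2 := I.add_spec hh (g := g) ha' h1.1
    have h3 : Ext.shift M (c, h) (a.concat x) = Ext.add M (c, h) (M.zero c :: a)
        (h.map fun t => M.mul c x t) := by
      simp [Ext.shift, List.dropLast_cons_of_ne_nil]
    simp only [List.concat_eq_append] at h3 ⊢
    rw [h3]
    refine ⟨h2.1, h2.2.trans ?_⟩
    rw [h1.2, ← hg, evalList_append_singleton, evalList_cons, I.val_zero, map_zero]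
    obtain rfl : a.length + 1 = d := by simpa using ha.1
    ring

theorem mul_spec (hd : 0 < d) (hg : g ^ d = I.evalList g h) {a b : List X} (ha : I.ListWf d a)
    (hb : I.ListWf d b) : I.ListWf d (Ext.mul M (c, h) a b) ∧
    I.evalList g (Ext.mul M (c, h) a b) = I.evalList g a * I.evalList g b := by
  replace ha := ha.2
  induction a with
  | nil => simpa [Ext.mul] using I.zero_spec hh
  | cons x a ih =>
    obtain ⟨h1, h2⟩ := ih fun y hy => ha y (by simp [hy])
    obtain ⟨h3, h4⟩ := I.shift_spec hh hd hg h1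
    obtain ⟨h5, h6⟩ := I.scale_spec (g := g) (ha x (by simp)) hb
    obtain ⟨h7, h8⟩ := I.add_spec hh (g := g) h5 h3
    refine ⟨h7, h8.trans ?_⟩
    rw [h6, h4, h2, evalList_cons]
    ring

theorem shifts_spec (hd : 0 < d) (hg : g ^ d = I.evalList g h) {a : List X} (ha : I.ListWf d a) :
    (∀ x ∈ Ext.shifts M (c, h) a, I.ListWf d x) ∧
    ∀ i < d, ∃ x ∈ Ext.shifts M (c, h) a, I.evalList g x = g ^ i * I.evalList g a := by
  have key (l : List X) (o : List (List X)) (a : List X) (ha : I.ListWf d a) :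
      let s := l.foldl (fun s _ => (Ext.shift M (c, h) s.1, s.1 :: s.2)) (a, o)
      (∀ x ∈ s.2, I.ListWf d x ∨ x ∈ o) ∧ (∀ x ∈ o, x ∈ s.2) ∧
      ∀ i < l.length, ∃ x ∈ s.2, I.evalList g x = g ^ i * I.evalList g a := by
    induction l generalizing a o with
    | nil => exact ⟨fun x hx => Or.inr hx, fun x hx => hx, by simp⟩
    | cons y l ih =>
      obtain ⟨h1, h2⟩ := I.shift_spec hh hd hg ha
      obtain ⟨h3, h4, h5⟩ := ih (a :: o) _ h1
      refine ⟨fun x hx => ?_, fun x hx => h4 x (by simp [hx]), fun i hi => ?_⟩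
      · rcases h3 x hx with h | h
        · exact Or.inl h
        · rw [List.mem_cons] at h
          rcases h with rfl | h
          exacts [Or.inl ha, Or.inr h]
      · rcases i with _ | i
        · exact ⟨a, h4 a (by simp), by simp⟩
        · obtain ⟨x, hx, hx'⟩ := h5 i (by simpa using hi)
          exact ⟨x, hx, by rw [hx', h2]; ring⟩
  obtain ⟨h1, -, h3⟩ := key h [] a ha
  exact ⟨fun x hx => (h1 x hx).resolve_right (by simp), fun i hi => h3 i (by rwa [hh.1])⟩

end ops

theorem ext_piv_zero {a b : List X} (ha : ∀ x ∈ a, I.wf x) (hb : ∀ x ∈ b, I.wf x) (h : List X)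
    (h0 : ∀ x ∈ a, I.val x = 0) : Ext.piv M (c, h) a b = (0, 0) := by
  induction a generalizing b with
  | nil => simp [Ext.piv]
  | cons x a ih =>
    rcases b with _ | ⟨y, b⟩
    · simp [Ext.piv]
    · have h1 := (I.piv_eq_zero (ha x (by simp)) (hb y (by simp))).2 (h0 x (by simp))
      have h2 := ih (b := b) (fun z hz => ha z (by simp [hz])) (fun z hz => hb z (by simp [hz]))
        fun z hz => h0 z (by simp [hz])
      simp only [Ext.piv] at h2
      simp [Ext.piv, h1, h2]

/-- The position `i` is that of the first nonzero coefficient of `a`. Only `a` enters into its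
choice, so the same coordinate is read off from every `b`. -/
theorem ext_piv_ne_zero {a : List X} (ha : ∀ x ∈ a, I.wf x) (h : List X)
    (h0 : ∃ x ∈ a, I.val x ≠ 0) : ∃ i, ∃ hi : i < a.length, I.val a[i] ≠ 0 ∧
      ∀ b : List X, ∀ hb : b.length = a.length, (∀ x ∈ b, I.wf x) →
      Ext.piv M (c, h) a b = M.piv c a[i] b[i] := by
  induction a with
  | nil => simp at h0
  | cons x a ih =>
    by_cases hx : I.val x = 0
    · obtain ⟨i, hi, h1, h2⟩ := ih (fun z hz => ha z (by simp [hz])) (by simpa [hx] using h0)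
      refine ⟨i + 1, by simpa using hi, by simpa using h1, fun b hb hb' => ?_⟩
      rcases b with _ | ⟨y, b⟩
      · simp at hb
      · have h3 := h2 b (by simpa using hb) fun z hz => hb' z (by simp [hz])
        have h4 := (I.piv_eq_zero (ha x (by simp)) (hb' y (by simp))).2 hx
        simp only [Ext.piv] at h3
        simp [Ext.piv, h4, h3]
    · refine ⟨0, by simp, by simpa using hx, fun b hb hb' => ?_⟩
      rcases b with _ | ⟨y, b⟩
      · simp at hb
      · have h4 := (I.piv_eq_zero (ha x (by simp)) (hb' y (by simp))).not.2 hx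
        have h5 : ((M.piv c x y).1 == 0) = false := by simpa using h4
        simp [Ext.piv, h5]

theorem coord_evalList (pb : PowerBasis R A) {a : List X} (ha : a.length = pb.dim)
    (i : ℕ) (hi : i < pb.dim) : pb.basis.repr (I.evalList pb.gen a) ⟨i, hi⟩ = I.val a[i] := by
  obtain ⟨d, hd⟩ : ∃ d, d = pb.dim := ⟨_, rfl⟩
  have : I.evalList pb.gen a =
      ∑ j : Fin pb.dim, I.val (a[j]'(by rw [ha]; exact j.2)) • pb.basis j := by
    rw [evalList_eq_sum]
    refine Fintype.sum_equiv (finCongr ha) _ _ fun j => ?_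
    simp [Algebra.smul_def]
  rw [this]
  simp only [map_sum, map_smul, Module.Basis.repr_self, Finsupp.coe_finsetSum, Finset.sum_apply,
    Finsupp.smul_apply, Finsupp.single_apply, smul_eq_mul, mul_ite, mul_one, mul_zero]
  rw [Finset.sum_ite_eq' Finset.univ (⟨i, hi⟩ : Fin pb.dim)]
  simp

/-- Lists of coefficients represent the elements of a simple extension. -/
def ext (pb : PowerBasis R A) (h : List X) (hd : 0 < pb.dim) (hh : I.ListWf pb.dim h)
    (hg : pb.gen ^ pb.dim = I.evalList pb.gen h) : Interp M.ext (c, h) p A where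
  wf := I.ListWf pb.dim
  val := I.evalList pb.gen
  inj {x y} hx hy hxy := by
    refine List.ext_getElem (hx.1.trans hy.1.symm) fun i hi hi' => ?_
    refine I.inj (hx.2 _ (List.getElem_mem _)) (hy.2 _ (List.getElem_mem _)) ?_
    rw [← I.coord_evalList pb hx.1 i (hx.1 ▸ hi), hxy, I.coord_evalList pb hy.1]
  wf_zero := (I.zero_spec hh (g := pb.gen)).1
  wf_one := (I.const_spec hh hd I.wf_one (g := pb.gen)).1
  wf_add hx hy := (I.add_spec hh hx hy (g := pb.gen)).1
  wf_mul hx hy := (I.mul_spec hh hd hg hx hy).1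
  wf_neg hx := (I.neg_spec hh hx (g := pb.gen)).1
  wf_smul hx := (I.smul_spec hh hx (g := pb.gen)).1
  val_zero := (I.zero_spec hh).2
  val_one := (I.const_spec hh hd I.wf_one).2.trans (by rw [I.val_one, map_one])
  val_add hx hy := (I.add_spec hh hx hy).2
  val_mul hx hy := (I.mul_spec hh hd hg hx hy).2
  val_neg hx := (I.neg_spec hh hx).2
  val_smul hx := (I.smul_spec hh hx).2
  piv {x} hx := by
    by_cases h0 : ∃ y ∈ x, I.val y ≠ 0
    · obtain ⟨i, hi, h1, h2⟩ := I.ext_piv_ne_zero hx.2 h h0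
      obtain ⟨φ, h3, h4⟩ := I.piv (hx.2 _ (List.getElem_mem hi))
      have hi' : i < pb.dim := hx.1 ▸ hi
      refine ⟨φ ∘ₗ (pb.basis.coord ⟨i, hi'⟩).restrictScalars (ZMod p), fun _ => ?_,
        fun {y} hy => ?_⟩
      · simpa [I.coord_evalList pb hx.1] using h3 h1
      · have hy' := hy.1.trans hx.1.symm
        obtain ⟨h5, h6, h7⟩ := h4 (hy.2 _ (List.getElem_mem (hy'.symm ▸ hi)))
        rw [show M.ext.piv (c, h) x y = _ from h2 y hy' hy.2]
        refine ⟨h5, ?_, ?_⟩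
        · simpa [I.coord_evalList pb hx.1] using h6
        · simpa [I.coord_evalList pb hy.1] using h7
    · push Not at h0
      have hx0 : I.evalList pb.gen x = 0 := by
        clear hx
        induction x with
        | nil => rfl
        | cons y x ih =>
          rw [evalList_cons, h0 y (by simp), ih fun z hz => h0 z (by simp [hz])]
          simp
      refine ⟨0, fun h => (h hx0).elim, fun {y} hy => ?_⟩
      rw [show M.ext.piv (c, h) x y = _ from I.ext_piv_zero hx.2 hy.2 h h0]
      -- Only the positivity of `p` is drawn from this.
      obtain ⟨φ, -, h2⟩ := I.piv I.wf_zero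
      exact ⟨(Nat.zero_le _).trans_lt (h2 I.wf_zero).1, by simp, by simp⟩
  wf_basis x hx := by
    obtain ⟨e, he, hx⟩ := List.mem_flatMap.1 hx
    exact (I.shifts_spec hh hd hg (I.const_spec hh hd (I.wf_basis e he) (g := pb.gen)).1).1 x hx
  span_basis := by
    set S := Submodule.span (ZMod p) {a | ∃ x ∈ M.ext.basis (c, h), I.evalList pb.gen x = a}
    have h1 (i : ℕ) (hi : i < pb.dim) (r : R) : algebraMap R A r * pb.gen ^ i ∈ S := by
      have : r ∈ Submodule.span (ZMod p) {a | ∃ x ∈ M.basis c, I.val x = a} := by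
        rw [I.span_basis]; trivial
      induction this using Submodule.span_induction with
      | mem r hr =>
        obtain ⟨e, he, rfl⟩ := hr
        have h2 := I.const_spec hh hd (I.wf_basis e he) (g := pb.gen)
        obtain ⟨x, hx, hx'⟩ := (I.shifts_spec hh hd hg h2.1).2 i hi
        refine Submodule.subset_span ⟨x, List.mem_flatMap.2 ⟨e, he, hx⟩, ?_⟩
        rw [hx', h2.2, mul_comm]
      | zero => simp
      | add x y _ _ hx hy => rw [map_add, add_mul]; exact S.add_mem hx hy
      | smul n x _ hx =>
        rw [algebraMap_smul_of_tower, smul_mul_assoc]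
        exact S.smul_mem _ hx
    rw [eq_top_iff]
    intro a _
    rw [← pb.basis.sum_repr a]
    refine S.sum_mem fun i _ => ?_
    rw [Algebra.smul_def, pb.basis_eq_pow]
    exact h1 i i.2 _

end Ext

end Interp

/-! ### Kernels and images -/

namespace Arith

section
variable {γ X α : Type} [Enc γ] [Enc X] [Enc α] (M : Arith γ X)

/-- Eliminate the pivot of the row `q` from the row `r`. -/
def reduceRow (c : γ) (r q : X × X) : X × X :=
  -- With φ the pivot functional of `q.1`, the row φ(q.1) r - φ(r.1) q is killed by φ;
  -- cross-multiplying avoids inverses modulo `p`.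
  (M.sub c (M.smul c (M.piv c q.1 r.1).1 r.1) (M.smul c (M.piv c q.1 r.1).2 q.1),
    M.sub c (M.smul c (M.piv c q.1 r.1).1 r.2) (M.smul c (M.piv c q.1 r.1).2 q.2))

/-- Eliminate the pivots of all rows in `R` from the row `r`. -/
def reduceRows (c : γ) (R : List (X × X)) (r : X × X) : X × X := R.foldl (M.reduceRow c) r

/-- Insert a row; the state consists of the kernel found so far and of the pivot rows. -/
def insertRow (c : γ) (s : List X × List (X × X)) (r : X × X) : List X × List (X × X) :=
  bif M.isZero c (M.reduceRows c s.2 r).1 then ((M.reduceRows c s.2 r).2 :: s.1, s.2)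
  else (s.1, s.2 ++ [M.reduceRows c s.2 r])

/-- The elimination for the multiplication by `T` on the span of `W`. -/
def eliminate (c : γ) (T : X) (W : List X) : List X × List (X × X) :=
  W.foldl (fun s w => M.insertRow c s (M.mul c T w, w)) ([], [])

@[fun_prop] theorem polyTime_reduceRow {c : α → γ} {q r : α → X × X} (hc : PolyTime c)
    (hq : PolyTime q) (hr : PolyTime r) : PolyTime fun a => M.reduceRow (c a) (r a) (q a) := by
  unfold reduceRow; fun_prop

theorem sz_reduceRow_le (c : γ) (q r : X × X) :
    sz (M.reduceRow c r q).1 ≤ M.bound.eval (sz c) ∧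
    sz (M.reduceRow c r q).2 ≤ M.bound.eval (sz c) :=
  ⟨M.sz_add_le _ _ _, M.sz_add_le _ _ _⟩

@[fun_prop] theorem polyTime_reduceRows {c : α → γ} {R : α → List (X × X)} {r : α → X × X}
    (hc : PolyTime c) (hR : PolyTime R) (hr : PolyTime r) :
    PolyTime fun a => M.reduceRows (c a) (R a) (r a) :=
  PolyTime.foldl (g := fun a r q => M.reduceRow (c a) r q) hR hr (by fun_prop)
    (B := fun a => 2 * M.bound.eval (sz (c a)) + 1) (by fun_prop) fun a q _ r => by
      have h := M.sz_reduceRow_le (c a) q r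
      have : sz (M.reduceRow (c a) r q) = sz (M.reduceRow (c a) r q).1 +
        sz (M.reduceRow (c a) r q).2 + 1 := rfl
      omega

/-- If any reduction happens at all, the last one is a ring operation, whose result is small
whatever its operands. -/
theorem reduceRows_small (c : γ) (R : List (X × X)) (r : X × X) :
    M.reduceRows c R r = r ∨ sz (M.reduceRows c R r).1 ≤ M.bound.eval (sz c) ∧
      sz (M.reduceRows c R r).2 ≤ M.bound.eval (sz c) := by
  rcases List.eq_nil_or_concat R with rfl | ⟨R, q, rfl⟩
  · exact Or.inl rfl
  · rw [reduceRows, List.concat_eq_append, List.foldl_append]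
    exact Or.inr (M.sz_reduceRow_le _ _ _)

@[fun_prop] theorem polyTime_insertRow {c : α → γ} {s : α → List X × List (X × X)} {r : α → X × X}
    (hc : PolyTime c) (hs : PolyTime s) (hr : PolyTime r) :
    PolyTime fun a => M.insertRow (c a) (s a) (r a) := by
  unfold insertRow; fun_prop

@[fun_prop] theorem polyTime_eliminate {c : α → γ} {T : α → X} {W : α → List X}
    (hc : PolyTime c) (hT : PolyTime T) (hW : PolyTime W) :
    PolyTime fun a => M.eliminate (c a) (T a) (W a) :=
  PolyTime.foldl (g := fun a s w => M.insertRow (c a) s (M.mul (c a) (T a) w, w)) hW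
    (by fun_prop) (by fun_prop) (B := fun a => 2 * M.bound.eval (sz (c a)) + sz (W a) + 2)
    (by fun_prop) fun a w hw s => by
      set r := (M.mul (c a) (T a) w, w)
      have h1 := sz_le_of_mem hw
      have h2 : sz (M.reduceRows (c a) s.2 r).1 ≤ M.bound.eval (sz (c a)) := by
        rcases M.reduceRows_small (c a) s.2 r with h | h
        · rw [h]; exact M.sz_mul_le _ _ _
        · exact h.1
      have h3 : sz (M.reduceRows (c a) s.2 r).2 ≤ M.bound.eval (sz (c a)) + sz w := by
        rcases M.reduceRows_small (c a) s.2 r with h | h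
        · rw [h]; exact Nat.le_add_left _ _
        · omega
      have h4 : sz (M.reduceRows (c a) s.2 r) = sz (M.reduceRows (c a) s.2 r).1 +
        sz (M.reduceRows (c a) s.2 r).2 + 1 := rfl
      have h5 : sz s = sz s.1 + sz s.2 + 1 := rfl
      unfold insertRow
      cases M.isZero (c a) (M.reduceRows (c a) s.2 r).1
      · have h6 := sz_append s.2 [M.reduceRows (c a) s.2 r]
        simp only [sz_cons, sz_nil] at h6
        rw [cond_false, sz_pair]
        omega
      · rw [cond_true, sz_pair, sz_cons]
        omega

theorem eliminate_append_singleton (c : γ) (T : X) (W : List X) (w : X) :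
    M.eliminate c T (W ++ [w]) = M.insertRow c (M.eliminate c T W) (M.mul c T w, w) := by
  simp [eliminate]

/-- Rank plus nullity, at the level of lists: every member of `W` yields either a kernel element or
a pivot row. This is what limits the number of parts in the splitting. -/
theorem length_eliminate (c : γ) (T : X) (W : List X) :
    (M.eliminate c T W).1.length + (M.eliminate c T W).2.length = W.length := by
  induction W using List.reverseRecOn with
  | nil => rfl
  | append_singleton W w ih =>
    rw [eliminate_append_singleton, insertRow]
    cases M.isZero c (M.reduceRows c (M.eliminate c T W).2 (M.mul c T w, w)).1 <;>
      simp <;> omega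

/-- The same `B` bounds input and output, so entries do not grow when splittings are iterated. -/
theorem eliminate_small (c : γ) (T : X) (W : List X) (B : ℕ) (hB : M.bound.eval (sz c) ≤ B)
    (hW : ∀ w ∈ W, sz w ≤ B) : (∀ x ∈ (M.eliminate c T W).1, sz x ≤ B) ∧
      ∀ x ∈ (M.eliminate c T W).2, sz x.1 ≤ B := by
  induction W using List.reverseRecOn with
  | nil => simp [eliminate]
  | append_singleton W w ih =>
    obtain ⟨h1, h2⟩ := ih fun x hx => hW x (by simp [hx])
    have hw := hW w (by simp)
    have h3 := M.reduceRows_small c (M.eliminate c T W).2 (M.mul c T w, w)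
    set r := M.reduceRows c (M.eliminate c T W).2 (M.mul c T w, w)
    have h4 : sz r.1 ≤ B ∧ sz r.2 ≤ B := by
      rcases h3 with h | h
      · rw [h]; exact ⟨(M.sz_mul_le _ _ _).trans hB, hw⟩
      · exact ⟨h.1.trans hB, h.2.trans hB⟩
    rw [eliminate_append_singleton, insertRow]
    change (∀ x ∈ (bif M.isZero c r.1 then _ else _ : List X × List (X × X)).1, _) ∧
      ∀ x ∈ (bif M.isZero c r.1 then _ else _ : List X × List (X × X)).2, _
    cases M.isZero c r.1
    · refine ⟨h1, fun x hx => ?_⟩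
      simp only [cond_false, List.mem_append, List.mem_singleton] at hx
      rcases hx with hx | rfl
      exacts [h2 x hx, h4.1]
    · refine ⟨fun x hx => ?_, h2⟩
      simp only [cond_true, List.mem_cons] at hx
      rcases hx with rfl | hx
      exacts [h4.2, h1 x hx]

end

end Arith

namespace Interp

variable {γ X : Type} [Enc γ] [Enc X] {M : Arith γ X} {c : γ} {p : ℕ} {R : Type*}
    [CommRing R] [Algebra (ZMod p) R] (I : Interp M c p R)

/-- The span of the elements represented by the members of a list. -/
def span (l : List X) : Submodule (ZMod p) R := Submodule.span (ZMod p) {a | ∃ x ∈ l, I.val x = a}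

theorem val_mem_span {l : List X} {x : X} (h : x ∈ l) : I.val x ∈ I.span l :=
  Submodule.subset_span ⟨x, h, rfl⟩

theorem span_le {l : List X} {S : Submodule (ZMod p) R} (h : ∀ x ∈ l, I.val x ∈ S) :
    I.span l ≤ S := by
  rw [span, Submodule.span_le]
  rintro _ ⟨x, hx, rfl⟩
  exact h x hx

theorem span_mono {l m : List X} (h : l ⊆ m) : I.span l ≤ I.span m :=
  I.span_le fun _ hx => I.val_mem_span (h hx)

theorem span_append (l m : List X) : I.span (l ++ m) = I.span l ⊔ I.span m := by
  refine le_antisymm (I.span_le fun x hx => ?_)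
    (sup_le (I.span_mono (by simp)) (I.span_mono (by simp)))
  rcases List.mem_append.1 hx with h | h
  exacts [Submodule.mem_sup_left (I.val_mem_span h), Submodule.mem_sup_right (I.val_mem_span h)]

theorem exists_of_mem_span_cons {x : X} {l : List X} {a : R} (h : a ∈ I.span (x :: l)) :
    ∃ t : ZMod p, ∃ b ∈ I.span l, a = t • I.val x + b := by
  have h0 : I.span [x] = Submodule.span (ZMod p) {I.val x} := by
    unfold span
    congr 1
    ext a
    simp [eq_comm]
  have : I.span (x :: l) = Submodule.span (ZMod p) {I.val x} ⊔ I.span l := by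
    rw [← h0, ← span_append, List.singleton_append]
  rw [this, Submodule.mem_sup] at h
  obtain ⟨y, hy, b, hb, rfl⟩ := h
  obtain ⟨t, rfl⟩ := Submodule.mem_span_singleton.1 hy
  exact ⟨t, b, hb, rfl⟩

/-- A list of pairs of well-formed elements `(T w, w)`. -/
def Rows (T : R) (L : List (X × X)) : Prop :=
  ∀ r ∈ L, I.wf r.1 ∧ I.wf r.2 ∧ I.val r.1 = T * I.val r.2

/-- Each row has a pivot that is eliminated from the following rows. -/
def Triangular : List (X × X) → Prop
  | [] => True
  | r :: L => I.val r.1 ≠ 0 ∧ (∀ s ∈ L, ((M.piv c r.1 s.1).2 : ZMod p) = 0) ∧ Triangular L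

variable {I}

theorem Rows.mul_mem {T : R} {L : List (X × X)} (hL : I.Rows T L) {a : R}
    (ha : a ∈ I.span (L.map Prod.snd)) : T * a ∈ I.span (L.map Prod.fst) := by
  induction ha using Submodule.span_induction with
  | mem a ha =>
    obtain ⟨x, hx, rfl⟩ := ha
    obtain ⟨r, hr, rfl⟩ := List.mem_map.1 hx
    rw [← (hL r hr).2.2]
    exact I.val_mem_span (List.mem_map_of_mem hr)
  | zero => simp
  | add x y _ _ hx hy => rw [mul_add]; exact Submodule.add_mem _ hx hy
  | smul t x _ hx => rw [mul_smul_comm]; exact Submodule.smul_mem _ t hx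

variable [Fact p.Prime]

theorem pivot_eq_zero {r : X × X} {L : List (X × X)} {T : R}
    (hL : I.Rows T L) (h : ∀ s ∈ L, ((M.piv c r.1 s.1).2 : ZMod p) = 0)
    {φ : R →ₗ[ZMod p] ZMod p} (hφ : ∀ {y}, I.wf y → (M.piv c r.1 y).1 < p ∧
      ((M.piv c r.1 y).1 : ZMod p) = φ (I.val r.1) ∧ ((M.piv c r.1 y).2 : ZMod p) = φ (I.val y))
    {a : R} (ha : a ∈ I.span (L.map Prod.fst)) : φ a = 0 := by
  have : I.span (L.map Prod.fst) ≤ LinearMap.ker φ := I.span_le fun x hx => by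
    obtain ⟨s, hs, rfl⟩ := List.mem_map.1 hx
    rw [LinearMap.mem_ker, ← (hφ (hL s hs).1).2.2, h s hs]
  exact this ha

/-- Multiplication by `T` is injective on the span of the second components: the pivot functional of
the first row kills all later rows, so applied to `T * a = 0` it shows that the coefficient of the
first row is zero; then induct. -/
theorem Triangular.eq_zero {T : R} {L : List (X × X)} (hL : I.Rows T L) (ht : I.Triangular L)
    {a : R} (ha : a ∈ I.span (L.map Prod.snd)) (hTa : T * a = 0) : a = 0 := by
  induction L generalizing a with
  | nil => simpa [span] using ha
  | cons r L ih =>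
    obtain ⟨h1, h2, h3⟩ := ht
    have hL' : I.Rows T L := fun s hs => hL s (by simp [hs])
    obtain ⟨hr1, hr2, hr3⟩ := hL r (by simp)
    obtain ⟨t, b, hb, rfl⟩ := I.exists_of_mem_span_cons ha
    obtain ⟨φ, h4, h5⟩ := I.piv hr1
    have h6 := congrArg φ hTa
    rw [mul_add, mul_smul_comm, ← hr3, map_add, map_smul, map_zero,
      pivot_eq_zero hL' h2 h5 (hL'.mul_mem hb), add_zero, smul_eq_mul] at h6
    have ht := (mul_eq_zero.1 h6).resolve_right (h4 h1)
    rw [ht, zero_smul, zero_add] at hTa ⊢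
    exact ih hL' h3 hb hTa

theorem reduceRow_spec {T : R} {q r : X × X} (h : I.Rows T [q, r]) (hq0 : I.val q.1 ≠ 0) :
    I.Rows T [M.reduceRow c r q] ∧ ((M.piv c q.1 (M.reduceRow c r q).1).2 : ZMod p) = 0 ∧
    ∃ u v : ZMod p, u ≠ 0 ∧ I.val (M.reduceRow c r q).1 = u • I.val r.1 + v • I.val q.1 ∧
      I.val (M.reduceRow c r q).2 = u • I.val r.2 + v • I.val q.2 := by
  obtain ⟨hq1, hq2, hq3⟩ := h q (by simp)
  obtain ⟨hr1, hr2, hr3⟩ := h r (by simp)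
  obtain ⟨φ, h1, h2⟩ := I.piv hq1
  obtain ⟨-, h3, h4⟩ := h2 hr1
  have w1 := I.wf_sub (I.wf_smul (n := (M.piv c q.1 r.1).1) hr1)
    (I.wf_smul (n := (M.piv c q.1 r.1).2) hq1)
  have w2 := I.wf_sub (I.wf_smul (n := (M.piv c q.1 r.1).1) hr2)
    (I.wf_smul (n := (M.piv c q.1 r.1).2) hq2)
  have e1 : I.val (M.reduceRow c r q).1 = φ (I.val q.1) • I.val r.1 +
      (-φ (I.val r.1)) • I.val q.1 := by
    rw [Arith.reduceRow, I.val_sub (I.wf_smul hr1) (I.wf_smul hq1), I.val_smul hr1,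
      I.val_smul hq1, h3, h4, neg_smul, sub_eq_add_neg]
  have e2 : I.val (M.reduceRow c r q).2 = φ (I.val q.1) • I.val r.2 +
      (-φ (I.val r.1)) • I.val q.2 := by
    rw [Arith.reduceRow, I.val_sub (I.wf_smul hr2) (I.wf_smul hq2), I.val_smul hr2,
      I.val_smul hq2, h3, h4, neg_smul, sub_eq_add_neg]
  refine ⟨fun s hs => ?_, ?_, _, _, h1 hq0, e1, e2⟩
  · rw [List.mem_singleton] at hs
    subst hs
    refine ⟨w1, w2, ?_⟩
    rw [e1, e2, hr3, hq3, mul_add, mul_smul_comm, mul_smul_comm]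
  · refine (h2 w1).2.2.trans ?_
    change φ (I.val (M.reduceRow c r q).1) = 0
    rw [e1]
    simp
    ring

/-- A pivot once eliminated stays eliminated: after a scaling, later reductions add only
combinations of later rows, on which the earlier pivot functional vanishes. The unit `u` guarantees
that no part of the span is lost. -/
theorem reduceRows_spec {T : R} {L : List (X × X)} {r : X × X} (hL : I.Rows T L)
    (hr : I.Rows T [r]) (ht : I.Triangular L) :
    I.Rows T [M.reduceRows c L r] ∧
    (∀ s ∈ L, ((M.piv c s.1 (M.reduceRows c L r).1).2 : ZMod p) = 0) ∧
    ∃ u : ZMod p, u ≠ 0 ∧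
      I.val (M.reduceRows c L r).1 - u • I.val r.1 ∈ I.span (L.map Prod.fst) ∧
      I.val (M.reduceRows c L r).2 - u • I.val r.2 ∈ I.span (L.map Prod.snd) := by
  induction L generalizing r with
  | nil => exact ⟨hr, by simp, 1, one_ne_zero, by simp [Arith.reduceRows],
      by simp [Arith.reduceRows]⟩
  | cons q L ih =>
    obtain ⟨t1, t2, t3⟩ := ht
    have hL' : I.Rows T L := fun s hs => hL s (by simp [hs])
    have hq := hL q (by simp)
    obtain ⟨h1, h2, u, v, hu, h3, h4⟩ := reduceRow_spec (T := T) (q := q) (r := r)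
      (fun s hs => by
        rw [List.mem_cons] at hs
        rcases hs with rfl | hs
        exacts [hq, hr s hs]) t1
    obtain ⟨h5, h6, u', hu', h7, h8⟩ := ih hL' h1 t3
    change I.Rows T [M.reduceRows c L (M.reduceRow c r q)] ∧
      (∀ s ∈ q :: L, ((M.piv c s.1 (M.reduceRows c L (M.reduceRow c r q)).1).2 : ZMod p) = 0) ∧
      ∃ u : ZMod p, u ≠ 0 ∧ I.val (M.reduceRows c L (M.reduceRow c r q)).1 - u • I.val r.1 ∈ _ ∧
        I.val (M.reduceRows c L (M.reduceRow c r q)).2 - u • I.val r.2 ∈ _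
    refine ⟨h5, fun s hs => ?_, u' * u, mul_ne_zero hu' hu, ?_, ?_⟩
    · rw [List.mem_cons] at hs
      rcases hs with rfl | hs
      · obtain ⟨φ, h9, h10⟩ := I.piv hq.1
        have h11 := pivot_eq_zero hL' t2 h10 h7
        rw [map_sub, map_smul, ← (h10 (h1 _ List.mem_cons_self).1).2.2, h2, smul_zero,
          sub_zero] at h11
        exact (h10 (h5 _ List.mem_cons_self).1).2.2.trans h11
      · exact h6 s hs
    · have : I.val (M.reduceRows c L (M.reduceRow c r q)).1 - (u' * u) • I.val r.1 =
          (I.val (M.reduceRows c L (M.reduceRow c r q)).1 - u' • I.val (M.reduceRow c r q).1) +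
          (u' * v) • I.val q.1 := by
        rw [h3, smul_add, smul_smul, smul_smul]; abel
      rw [this]
      exact Submodule.add_mem _ (I.span_mono (by simp) h7)
        (Submodule.smul_mem _ _ (I.val_mem_span (by simp)))
    · have : I.val (M.reduceRows c L (M.reduceRow c r q)).2 - (u' * u) • I.val r.2 =
          (I.val (M.reduceRows c L (M.reduceRow c r q)).2 - u' • I.val (M.reduceRow c r q).2) +
          (u' * v) • I.val q.2 := by
        rw [h4, smul_add, smul_smul, smul_smul]; abel
      rw [this]
      exact Submodule.add_mem _ (I.span_mono (by simp) h8)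
        (Submodule.smul_mem _ _ (I.val_mem_span (by simp)))

theorem Triangular.append_singleton {L : List (X × X)} {r : X × X} (ht : I.Triangular L)
    (h : ∀ s ∈ L, ((M.piv c s.1 r.1).2 : ZMod p) = 0) (hr : I.val r.1 ≠ 0) :
    I.Triangular (L ++ [r]) := by
  induction L with
  | nil => exact ⟨hr, by simp, trivial⟩
  | cons q L ih =>
    refine ⟨ht.1, fun s hs => ?_, ih ht.2.2 fun s hs => h s (by simp [hs])⟩
    rcases List.mem_append.1 hs with hs | hs
    · exact ht.2.1 s hs
    · rw [List.mem_singleton] at hs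
      exact hs ▸ h q (by simp)

variable (I)

/-- The invariant of the elimination. Inserting `w` replaces it by a nonzero multiple of `w` plus a
combination of second components already present, so the span persists. -/
theorem eliminate_inv {T : X} (hT : I.wf T) {W : List X} (hW : ∀ w ∈ W, I.wf w) :
    (∀ x ∈ (M.eliminate c T W).1, I.wf x ∧ I.val T * I.val x = 0) ∧
    I.Rows (I.val T) (M.eliminate c T W).2 ∧ I.Triangular (M.eliminate c T W).2 ∧
    I.span ((M.eliminate c T W).1 ++ (M.eliminate c T W).2.map Prod.snd) = I.span W := by
  induction W using List.reverseRecOn with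
  | nil => exact ⟨by simp [Arith.eliminate], fun r hr => by simp [Arith.eliminate] at hr, trivial,
      by simp [Arith.eliminate]⟩
  | append_singleton W w ih =>
    obtain ⟨h1, h2, h3, h4⟩ := ih fun x hx => hW x (by simp [hx])
    have hw := hW w (by simp)
    have hr0 : I.Rows (I.val T) [(M.mul c T w, w)] := fun r hr => by
      rw [List.mem_singleton] at hr
      subst hr
      exact ⟨I.wf_mul hT hw, hw, I.val_mul hT hw⟩
    rw [Arith.eliminate_append_singleton, Arith.insertRow]
    generalize M.eliminate c T W = s at *
    obtain ⟨h5, h6, u, hu, h7, h8⟩ := reduceRows_spec h2 hr0 h3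
    generalize M.reduceRows c s.2 (M.mul c T w, w) = r at *
    obtain ⟨hr1, hr2, hr3⟩ := h5 r (by simp)
    have h9 : I.span (s.1 ++ r.2 :: s.2.map Prod.snd) = I.span (W ++ [w]) := by
      rw [I.span_append W, ← h4, span_append, span_append]
      apply le_antisymm
      · refine sup_le (le_sup_of_le_left le_sup_left) (I.span_le fun x hx => ?_)
        rw [List.mem_cons] at hx
        rcases hx with rfl | hx
        · have : I.val r.2 = (I.val r.2 - u • I.val w) + u • I.val w := by abel
          rw [this]
          exact Submodule.add_mem _ (Submodule.mem_sup_left (Submodule.mem_sup_right h8))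
            (Submodule.mem_sup_right (Submodule.smul_mem _ _ (I.val_mem_span (by simp))))
        · exact Submodule.mem_sup_left (Submodule.mem_sup_right (I.val_mem_span hx))
      · refine sup_le (sup_le le_sup_left (le_sup_of_le_right (I.span_mono (by simp))))
          (I.span_le fun x hx => ?_)
        rw [List.mem_singleton] at hx
        subst hx
        have : I.val x = u⁻¹ • (I.val r.2 - (I.val r.2 - u • I.val x)) := by
          rw [sub_sub_cancel, smul_smul, inv_mul_cancel₀ hu, one_smul]
        rw [this]
        exact Submodule.mem_sup_right (Submodule.smul_mem _ _ (Submodule.sub_mem _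
          (I.val_mem_span (by simp)) (I.span_mono (by simp) h8)))
    cases hz : M.isZero c r.1
    · have hz' : I.val r.1 ≠ 0 := fun h => by simp [(I.isZero_iff hr1).2 h] at hz
      refine ⟨h1, fun q hq => ?_, h3.append_singleton h6 hz', ?_⟩
      · rcases List.mem_append.1 hq with hq | hq
        exacts [h2 q hq, h5 q hq]
      · rw [← h9]
        exact le_antisymm (I.span_mono (by simp)) (I.span_mono (by simp))
    · have hz' := (I.isZero_iff hr1).1 hz
      refine ⟨fun x hx => ?_, h2, h3, ?_⟩
      · rw [cond_true, List.mem_cons] at hx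
        rcases hx with rfl | hx
        · exact ⟨hr2, by rw [← hr3, hz']⟩
        · exact h1 x hx
      · rw [← h9]
        refine le_antisymm (I.span_mono ?_) (I.span_mono ?_) <;> intro x <;> simp <;> tauto

/-- The span of `W` is the sum of a subspace killed by `T` and one on which `T` is injective; hence
the former is the whole kernel, and `T` maps the latter onto the image. -/
theorem eliminate_spec {T : X} (hT : I.wf T) {W : List X} (hW : ∀ w ∈ W, I.wf w) :
    (∀ x ∈ (M.eliminate c T W).1, I.wf x) ∧ (∀ x ∈ (M.eliminate c T W).2.map Prod.fst, I.wf x) ∧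
    (∀ a, a ∈ I.span (M.eliminate c T W).1 ↔ a ∈ I.span W ∧ I.val T * a = 0) ∧
    ∀ a, a ∈ I.span ((M.eliminate c T W).2.map Prod.fst) ↔ ∃ b ∈ I.span W, a = I.val T * b := by
  obtain ⟨h1, h2, h3, h4⟩ := I.eliminate_inv hT hW
  generalize M.eliminate c T W = s at *
  have h5 : ∀ a ∈ I.span s.1, I.val T * a = 0 := fun a ha => by
    have : I.span s.1 ≤ LinearMap.ker (LinearMap.mulLeft (ZMod p) (I.val T)) :=
      I.span_le fun x hx => by simpa using (h1 x hx).2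
    simpa using this ha
  refine ⟨fun x hx => (h1 x hx).1, fun x hx => ?_, fun a => ⟨fun ha => ⟨?_, h5 a ha⟩, ?_⟩,
    fun a => ⟨fun ha => ?_, ?_⟩⟩
  · obtain ⟨r, hr, rfl⟩ := List.mem_map.1 hx
    exact (h2 r hr).1
  · rw [← h4]
    exact I.span_mono (by simp) ha
  · rintro ⟨ha, hTa⟩
    rw [← h4, span_append, Submodule.mem_sup] at ha
    obtain ⟨k, hk, b, hb, rfl⟩ := ha
    rw [mul_add, h5 k hk, zero_add] at hTa
    rw [h3.eq_zero h2 hb hTa, add_zero]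
    exact hk
  · have : I.span (s.2.map Prod.fst) ≤
        (I.span W).map (LinearMap.mulLeft (ZMod p) (I.val T)) := I.span_le fun x hx => by
      obtain ⟨r, hr, rfl⟩ := List.mem_map.1 hx
      refine ⟨I.val r.2, ?_, by simp [(h2 r hr).2.2]⟩
      rw [← h4]
      exact I.val_mem_span (by
        simp only [List.mem_append, List.mem_map]
        exact Or.inr ⟨r, hr, rfl⟩)
    obtain ⟨b, hb, rfl⟩ := this ha
    exact ⟨b, hb, by simp⟩
  · rintro ⟨b, hb, rfl⟩
    rw [← h4, span_append, Submodule.mem_sup] at hb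
    obtain ⟨k, hk, d, hd, rfl⟩ := hb
    rw [mul_add, h5 k hk, zero_add]
    exact h2.mul_mem hd

end Interp


/-! ### Splitting the algebra by a list of elements -/

namespace Arith

section
variable {γ X τ α : Type} [Enc γ] [Enc X] [Enc τ] [Enc α] (M : Arith γ X)

/-- Split the node `n` into the kernel and the image of the multiplication by `q.2`. -/
def splitNode (c : γ) (q : τ × X) (n : List τ × List X) : List (List τ × List X) :=
  [(q.1 :: n.1, (M.eliminate c q.2 n.2).1),
    (n.1, (M.eliminate c q.2 n.2).2.map Prod.fst)].filter fun n => !n.2.isEmpty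

/-- Split `W` successively by the elements in a list; each part is labelled with the labels of
the elements that annihilate it. -/
def splitAll (c : γ) (L : List (τ × X)) (W : List X) : List (List τ × List X) :=
  L.foldl (fun N q => N.flatMap (M.splitNode c q)) [([], W)]

@[fun_prop] theorem polyTime_splitNode {c : α → γ} {q : α → τ × X} {n : α → List τ × List X}
    (hc : PolyTime c) (hq : PolyTime q) (hn : PolyTime n) :
    PolyTime fun a => M.splitNode (c a) (q a) (n a) := by
  unfold splitNode; fun_prop

/-- Splitting preserves the total length of the bases, and empty parts are discarded, so there are
never more parts than basis elements. Without this the number of parts could double with each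
position. -/
theorem splitNode_sum (c : γ) (q : τ × X) (n : List τ × List X) :
    (M.splitNode c q n).length ≤ ((M.splitNode c q n).map fun n => n.2.length).sum ∧
    ((M.splitNode c q n).map fun n => n.2.length).sum = n.2.length := by
  have h := M.length_eliminate c q.2 n.2
  unfold splitNode
  generalize M.eliminate c q.2 n.2 = s at *
  rcases s with ⟨_ | ⟨a, s⟩, _ | ⟨b, t⟩⟩ <;> simp at h ⊢ <;> omega

theorem flatMap_splitNode_sum (c : γ) (q : τ × X) (N : List (List τ × List X)) :
    (N.flatMap (M.splitNode c q)).length ≤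
      ((N.flatMap (M.splitNode c q)).map fun n => n.2.length).sum ∧
    ((N.flatMap (M.splitNode c q)).map fun n => n.2.length).sum =
      (N.map fun n => n.2.length).sum := by
  induction N with
  | nil => simp
  | cons n N ih =>
    have := M.splitNode_sum c q n
    simp only [List.flatMap_cons, List.length_append, List.map_append, List.sum_append,
      List.map_cons, List.sum_cons]
    omega

@[fun_prop] theorem polyTime_splitAll {c : α → γ} {L : α → List (τ × X)} {W : α → List X}
    (hc : PolyTime c) (hL : PolyTime L) (hW : PolyTime W) :
    PolyTime fun a => M.splitAll (c a) (L a) (W a) := by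
  set B : α → ℕ := fun a => M.bound.eval (sz (c a)) + sz (W a)
  have hB : PolyBdd B := by fun_prop
  refine PolyTime.foldl_of_inv (g := fun a N q => N.flatMap (M.splitNode (c a) q)) hL
    (s := fun a => [([], W a)]) (by fun_prop) (by fun_prop)
    -- The `+ 1` allows for the initial node, which is kept even if `W` is empty.
    (fun a i N => N.length ≤ (N.map fun n => n.2.length).sum + 1 ∧
      (N.map fun n => n.2.length).sum ≤ (W a).length ∧
      ∀ n ∈ N, (∀ x ∈ n.2, sz x ≤ B a) ∧ sz n.1 ≤ 1 + i * sz (L a)) (fun a => ?_)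
    (fun a i q N hq _ h => ?_)
    (B := fun a => (sz (W a) + 1) * ((1 + sz (L a) * sz (L a) + (sz (W a) * (B a + 1) + 1) + 1) + 1) + 1)
    (by fun_prop) fun a i N hi h => ?_
  · refine ⟨by simp, by simp, fun n hn => ?_⟩
    rw [List.mem_singleton] at hn
    subst hn
    exact ⟨fun x hx => (sz_le_of_mem hx).le.trans (Nat.le_add_left _ _), by simp⟩
  · obtain ⟨h1, h2⟩ := M.flatMap_splitNode_sum (c a) q N
    refine ⟨by omega, by omega, fun n hn => ?_⟩
    obtain ⟨m, hm, hn⟩ := List.mem_flatMap.1 hn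
    obtain ⟨h3, h4⟩ := h.2.2 m hm
    obtain ⟨h5, h6⟩ := M.eliminate_small (c a) q.2 m.2 (B a) (Nat.le_add_right _ _) h3
    have h7 := sz_le_of_mem hq
    have h8 : sz q = sz q.1 + sz q.2 + 1 := rfl
    have hn := List.mem_of_mem_filter hn
    simp only [List.mem_cons, List.not_mem_nil, or_false] at hn
    rcases hn with rfl | rfl
    · refine ⟨h5, ?_⟩
      simp only [sz_cons, add_mul]
      omega
    · refine ⟨fun x hx => ?_, ?_⟩
      · obtain ⟨r, hr, rfl⟩ := List.mem_map.1 hx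
        exact h6 r hr
      · simp only [add_mul]
        omega
  · obtain ⟨h1, h2, h3⟩ := h
    have hi' := hi.trans (length_lt_sz (L a)).le
    have hW' := length_lt_sz (W a)
    refine (sz_list_le (B := 1 + sz (L a) * sz (L a) + (sz (W a) * (B a + 1) + 1) + 1)
      fun n hn => ?_).trans ?_
    · obtain ⟨h4, h5⟩ := h3 n hn
      have h6 := sz_list_le h4
      have h7 : n.2.length ≤ sz (W a) :=
        (List.le_sum_of_mem (List.mem_map_of_mem (f := fun n : List τ × List X => n.2.length)
          hn)).trans (h2.trans hW'.le)
      have h8 := Nat.mul_le_mul_right (B a + 1) h7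
      have h9 := Nat.mul_le_mul_right (sz (L a)) hi'
      have h10 : sz n = sz n.1 + sz n.2 + 1 := rfl
      omega
    · gcongr
      omega

end

end Arith

namespace Interp

variable {γ X τ : Type} [Enc γ] [Enc X] [Enc τ] {M : Arith γ X} {c : γ} {p : ℕ} {R : Type*}
    [CommRing R] [Algebra (ZMod p) R] (I : Interp M c p R) [Fact p.Prime]

/-- Follows the homomorphism `ev` through one splitting. From an ideal on which `ev` is nonzero one
passes to the image of `q.2` if `ev` is nonzero at `q.2`, and to its kernel otherwise; both are
again ideals, and `ev` stays nonzero on the one chosen. -/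
theorem splitNode_spec {K : Type*} [Field K] (ev : R →+* K) {q : τ × X} (hq : I.wf q.2)
    (hfit : ∃ a, I.val q.2 = I.val q.2 ^ 2 * a) {n : List τ × List X} (hn : ∀ x ∈ n.2, I.wf x)
    (hid : ∀ a, ∀ b ∈ I.span n.2, a * b ∈ I.span n.2) (hev : ∃ a ∈ I.span n.2, ev a ≠ 0)
    {b : Bool} (hb : b = true ↔ ev (I.val q.2) = 0) :
    ∃ m ∈ M.splitNode c q n, m.1 = (bif b then q.1 :: n.1 else n.1) ∧ (∀ x ∈ m.2, I.wf x) ∧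
      (∀ a, ∀ b ∈ I.span m.2, a * b ∈ I.span m.2) ∧ ∃ a ∈ I.span m.2, ev a ≠ 0 := by
  obtain ⟨h1, h2, h3, h4⟩ := I.eliminate_spec hq hn
  obtain ⟨a, ha, ha'⟩ := hev
  have hne {l : List X} (h : ∃ a ∈ I.span l, ev a ≠ 0) : (!l.isEmpty) = true := by
    obtain ⟨a, ha, ha'⟩ := h
    rcases l with _ | ⟨x, l⟩
    · have : a = 0 := by simpa [span] using ha
      simp [this] at ha'
    · rfl
  cases b
  · have h0 : ev (I.val q.2) ≠ 0 := by simpa using hb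
    have h5 : ∃ b ∈ I.span ((M.eliminate c q.2 n.2).2.map Prod.fst), ev b ≠ 0 :=
      ⟨I.val q.2 * a, (h4 _).2 ⟨a, ha, rfl⟩, by rw [map_mul]; exact mul_ne_zero h0 ha'⟩
    refine ⟨_, List.mem_filter.2 ⟨List.mem_cons_of_mem _ List.mem_cons_self, hne h5⟩, rfl, h2,
      fun d b hb => ?_, h5⟩
    obtain ⟨e, he, rfl⟩ := (h4 _).1 hb
    exact (h4 _).2 ⟨d * e, hid d e he, by ring⟩
  · have h0 : ev (I.val q.2) = 0 := hb.1 rfl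
    obtain ⟨d, hd⟩ := hfit
    have h5 : ∃ b ∈ I.span (M.eliminate c q.2 n.2).1, ev b ≠ 0 := by
      -- With u = u² d the factor 1 - u d is annihilated by u, while `ev` sends it to 1 because it
      -- kills u.
      refine ⟨a - I.val q.2 * d * a, (h3 _).2 ⟨Submodule.sub_mem _ ha (hid _ a ha), ?_⟩, ?_⟩
      · have : I.val q.2 * (a - I.val q.2 * d * a) =
          (I.val q.2 - I.val q.2 ^ 2 * d) * a := by ring
        rw [this, ← hd, sub_self, zero_mul]
      · simpa [h0] using ha'
    refine ⟨_, List.mem_filter.2 ⟨List.mem_cons_self, hne h5⟩, rfl, h1, fun d b hb => ?_, h5⟩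
    obtain ⟨h6, h7⟩ := (h3 _).1 hb
    exact (h3 _).2 ⟨hid d b h6, by rw [mul_left_comm, h7, mul_zero]⟩

/-- Iteration of `splitNode_spec` from the whole ring, where `ev 1 = 1` is nonzero. The label of the
branch followed is the zero pattern of `ev`. -/
theorem splitAll_spec {K : Type*} [Field K] (ev : R →+* K) {L : List (τ × X)} {W : List X}
    (hL : ∀ q ∈ L, I.wf q.2 ∧ ∃ a, I.val q.2 = I.val q.2 ^ 2 * a) (hW : ∀ x ∈ W, I.wf x)
    (hid : I.span W = ⊤) {P : τ → Bool} (hP : ∀ q ∈ L, P q.1 = true ↔ ev (I.val q.2) = 0) :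
    ∃ m ∈ M.splitAll c L W, m.1 = ((L.map Prod.fst).filter P).reverse := by
  suffices ∃ m ∈ M.splitAll c L W, m.1 = ((L.map Prod.fst).filter P).reverse ∧
      (∀ x ∈ m.2, I.wf x) ∧ (∀ a, ∀ b ∈ I.span m.2, a * b ∈ I.span m.2) ∧
      ∃ a ∈ I.span m.2, ev a ≠ 0 by
    obtain ⟨m, hm, h, -⟩ := this
    exact ⟨m, hm, h⟩
  induction L using List.reverseRecOn with
  | nil =>
    exact ⟨([], W), by simp [Arith.splitAll], by simp, hW, by simp [hid], 1, by simp [hid]⟩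
  | append_singleton L q ih =>
    obtain ⟨m, hm, h1, h2, h3, h4⟩ := ih (fun q hq => hL q (by simp [hq]))
      fun q hq => hP q (by simp [hq])
    obtain ⟨h5, h6⟩ := hL q (by simp)
    obtain ⟨m', hm', h7, h8⟩ := I.splitNode_spec ev h5 h6 h2 h3 h4 (hP q (by simp))
    refine ⟨m', ?_, ?_, h8⟩
    · rw [Arith.splitAll, List.foldl_append]
      exact List.mem_flatMap.2 ⟨m, hm, hm'⟩
    · rw [h7, h1]
      cases h : P q.1 <;> simp [List.filter_append, h]

end Interp


/-! ### Univariate polynomials -/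

namespace Arith

section
variable {γ X α : Type} [Enc γ] [Enc X] [Enc α] (M : Arith γ X)

/-- The value at `x` of the polynomial with the coefficients `l`. -/
def horner (c : γ) (l : List X) (x : X) : X :=
  l.foldr (fun a y => M.add c a (M.mul c x y)) (M.zero c)

@[fun_prop] theorem polyTime_horner {c : α → γ} {l : α → List X} {x : α → X} (hc : PolyTime c)
    (hl : PolyTime l) (hx : PolyTime x) : PolyTime fun a => M.horner (c a) (l a) (x a) :=
  PolyTime.foldr (g := fun b a y => M.add (c b) a (M.mul (c b) (x b) y)) (by fun_prop)
    (by fun_prop) (by fun_prop) (B := fun a => M.bound.eval (sz (c a))) (by fun_prop)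
    fun a b _ y => (M.sz_add_le _ _ _).trans (by omega)

/-- Inversion in a field with `p ^ m` elements, where `m` is the length of `l`. -/
def inv {β : Type} (c : γ) (p : ℕ) (l : List β) (x : X) : X :=
  M.mul c (M.pow c (l.tail.foldl (fun y _ =>
    M.mul c (M.pow c y p.bits) (M.pow c x (p - 1).bits)) (M.one c)) p.bits) (M.pow c x (p - 2).bits)

@[fun_prop] theorem polyTime_inv {β : Type} [Enc β] {c : α → γ} {p : α → ℕ} {l : α → List β}
    {x : α → X} (hc : PolyTime c) (hp : PolyTime p) (hl : PolyTime l) (hx : PolyTime x) :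
    PolyTime fun a => M.inv (c a) (p a) (l a) (x a) := by
  have : PolyTime fun a => (l a).tail.foldl (fun y _ =>
      M.mul (c a) (M.pow (c a) y (p a).bits) (M.pow (c a) (x a) (p a - 1).bits)) (M.one (c a)) :=
    PolyTime.foldl (g := fun a y _ => M.mul (c a) (M.pow (c a) y (p a).bits)
      (M.pow (c a) (x a) (p a - 1).bits)) (by fun_prop) (by fun_prop) (by fun_prop)
      (B := fun a => M.bound.eval (sz (c a))) (by fun_prop)
      fun a b _ y => (M.sz_mul_le _ _ _).trans (by omega)
  unfold inv
  fun_prop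

/-- One step of Newton interpolation: `s.1` is the current interpolating polynomial, `s.2` is the
polynomial vanishing at the nodes, and `q` is the next node with the value there. -/
def newtonStep {β : Type} (c : γ) (p : ℕ) (l : List β) (s : List X × List X) (q : X × X) :
    List X × List X :=
  (List.zipWith (M.add c) (s.1 ++ [M.zero c]) (s.2.map (M.mul c
      (M.mul c (M.sub c q.2 (M.horner c s.1 q.1)) (M.inv c p l (M.horner c s.2 q.1))))),
    List.zipWith (M.add c) (M.zero c :: s.2) (s.2.map (M.mul c (M.neg c q.1)) ++ [M.zero c]))

/-- Newton interpolation. -/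
def newton {β : Type} (c : γ) (p : ℕ) (l : List β) (J : List (X × X)) : List X :=
  (J.foldl (M.newtonStep c p l) ([], [M.one c])).1

theorem sz_zipWith_add_le (c : γ) (a b : List X) (n : ℕ) (h : a.length ≤ n) :
    sz (List.zipWith (M.add c) a b) ≤ n * (M.bound.eval (sz c) + 1) + 1 := by
  refine (sz_list_le (B := M.bound.eval (sz c)) fun x hx => ?_).trans ?_
  · obtain ⟨i, hi, rfl⟩ := List.getElem_of_mem hx
    rw [List.getElem_zipWith]
    exact M.sz_add_le _ _ _
  · gcongr
    simp
    omega

@[fun_prop] theorem polyTime_newtonStep [Inhabited X] {β : Type} [Enc β] {c : α → γ} {p : α → ℕ}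
    {l : α → List β} {s : α → List X × List X} {q : α → X × X} (hc : PolyTime c) (hp : PolyTime p)
    (hl : PolyTime l) (hs : PolyTime s) (hq : PolyTime q) :
    PolyTime fun a => M.newtonStep (c a) (p a) (l a) (s a) (q a) := by
  unfold newtonStep
  have h1 : PolyTime fun x : α × X × X => M.add (c x.1) x.2.1 x.2.2 := by fun_prop
  have h2 : PolyTime fun a => M.mul (c a) (M.sub (c a) (q a).2 (M.horner (c a) (s a).1 (q a).1))
    (M.inv (c a) (p a) (l a) (M.horner (c a) (s a).2 (q a).1)) := by fun_prop
  exact .pair (.zipWith (h := fun a => M.add (c a)) (by fun_prop)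
      (.map (g := fun a => M.mul (c a) _) (by fun_prop) (by fun_prop)) h1)
    (.zipWith (h := fun a => M.add (c a)) (by fun_prop) (by fun_prop) h1)

@[fun_prop] theorem polyTime_newton [Inhabited X] {β : Type} [Enc β] {c : α → γ} {p : α → ℕ}
    {l : α → List β} {J : α → List (X × X)} (hc : PolyTime c) (hp : PolyTime p)
    (hl : PolyTime l) (hJ : PolyTime J) :
    PolyTime fun a => M.newton (c a) (p a) (l a) (J a) := by
  refine PolyTime.fst (PolyTime.foldl_of_inv (l := J)
    (g := fun a s q => M.newtonStep (c a) (p a) (l a) s q) (s := fun a => ([], [M.one (c a)]))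
    (by fun_prop) (by fun_prop) (by fun_prop)
    (fun a i s => s.1.length ≤ i ∧ s.2.length ≤ i + 1 ∧
      sz s.1 ≤ i * (M.bound.eval (sz (c a)) + 1) + 1 ∧
      sz s.2 ≤ (i + 1) * (M.bound.eval (sz (c a)) + 1) + 1 + (sz (M.one (c a)) + 1))
    (fun a => by simp) (fun a i q s _ _ h => ?_)
    (B := fun a => (sz (J a) * (M.bound.eval (sz (c a)) + 1) + 1) +
      ((sz (J a) + 1) * (M.bound.eval (sz (c a)) + 1) + 1 + (sz (M.one (c a)) + 1)) + 1)
    (by fun_prop) fun a i s hi h => ?_)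
  · refine ⟨?_, ?_, M.sz_zipWith_add_le _ _ _ _ ?_,
      (M.sz_zipWith_add_le _ _ _ (i + 1 + 1) ?_).trans (Nat.le_add_right _ _)⟩ <;>
      simp [newtonStep] <;> omega
  · obtain ⟨-, -, h1, h2⟩ := h
    have hi' := hi.trans (length_lt_sz (J a)).le
    have h3 := Nat.mul_le_mul_right (M.bound.eval (sz (c a)) + 1) hi'
    have h4 := Nat.mul_le_mul_right (M.bound.eval (sz (c a)) + 1) (Nat.succ_le_succ hi')
    have h5 : sz s = sz s.1 + sz s.2 + 1 := rfl
    simp only [Nat.succ_eq_add_one] at h4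
    omega

/-- Remove leading zeros, but keep at least one coefficient. -/
def trim (c : γ) (l : List X) : List X :=
  let t := l.foldr (fun a t => bif t.isEmpty && M.isZero c a then [] else a :: t) []
  bif t.isEmpty then [M.zero c] else t

@[fun_prop] theorem polyTime_trim {c : α → γ} {l : α → List X} (hc : PolyTime c)
    (hl : PolyTime l) : PolyTime fun a => M.trim (c a) (l a) := by
  have hl' := hl.polyBdd
  have : PolyTime fun a => (l a).foldr (fun x t =>
      bif t.isEmpty && M.isZero (c a) x then [] else x :: t) [] :=
    PolyTime.foldr (g := fun a x t => bif t.isEmpty && M.isZero (c a) x then [] else x :: t)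
      (by fun_prop) (by fun_prop) (by fun_prop) (B := fun a => sz (l a) + 1) (by fun_prop)
      fun a x hx t => by
        have h1 := sz_le_of_mem hx
        have h2 := one_le_sz t
        cases t.isEmpty && M.isZero (c a) x <;> simp <;> omega
  unfold trim
  fun_prop

/-- Equality of coefficient lists. -/
def listEq (c : γ) (a b : List X) : Bool :=
  !(decide (a.length < b.length)) && (!(decide (b.length < a.length)) &&
    (a.zip b).all fun t => M.isZero c (M.sub c t.1 t.2))

@[fun_prop] theorem polyTime_listEq [Inhabited X] {c : α → γ} {x y : α → List X}
    (hc : PolyTime c) (hx : PolyTime x) (hy : PolyTime y) :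
    PolyTime fun a => M.listEq (c a) (x a) (y a) := by
  unfold listEq; fun_prop

/-- Remove repetitions. -/
def dedup (c : γ) (L : List (List X)) : List (List X) :=
  L.foldr (fun l A => bif A.all (fun m => !(M.listEq c l m)) then l :: A else A) []

@[fun_prop] theorem polyTime_dedup [Inhabited X] {c : α → γ} {L : α → List (List X)}
    (hc : PolyTime c) (hL : PolyTime L) : PolyTime fun a => M.dedup (c a) (L a) := by
  have hL' := hL.polyBdd
  exact PolyTime.foldr (g := fun a l (A : List (List X)) =>
      bif A.all (fun m => !(M.listEq (c a) l m)) then l :: A else A)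
    (by fun_prop) (by fun_prop) (by fun_prop) (B := fun a => sz (L a) + 1) (by fun_prop)
    fun a x hx t => by
      have h1 := sz_le_of_mem hx
      cases t.all (fun m => !(M.listEq (c a) x m))
      · simp
      · simp only [cond_true, sz_cons]
        omega

end
end Arith

namespace Interp

variable {γ X : Type} [Enc γ] [Enc X] [Inhabited X] {M : Arith γ X} {c : γ} {p : ℕ} {R : Type*}
    [CommRing R] [Algebra (ZMod p) R] (I : Interp M c p R)

/-- The polynomial with the given coefficients. -/
noncomputable def poly (l : List X) : R[X] := I.evalList Polynomial.X l

theorem poly_cons (x : X) (l : List X) :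
    I.poly (x :: l) = C (I.val x) + Polynomial.X * I.poly l := rfl

theorem coeff_poly {l : List X} {i : ℕ} (hi : i < l.length) :
    (I.poly l).coeff i = I.val l[i] := by
  induction l generalizing i with
  | nil => simp at hi
  | cons x l ih =>
    rw [poly_cons]
    rcases i with _ | i
    · simp
    · simpa [coeff_C] using ih (by simpa using hi)

theorem degree_poly_lt (l : List X) : (I.poly l).degree < l.length := by
  rw [degree_lt_iff_coeff_zero]
  intro i hi
  induction l generalizing i with
  | nil => rfl
  | cons x l ih =>
    rcases i with _ | i
    · simp at hi
    · simpa [poly_cons, coeff_C] using ih i (by simpa using hi)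

theorem horner_spec {l : List X} {x : X} (hl : ∀ y ∈ l, I.wf y) (hx : I.wf x) :
    I.wf (M.horner c l x) ∧ I.val (M.horner c l x) = (I.poly l).eval (I.val x) := by
  induction l with
  | nil => exact ⟨I.wf_zero, by simp [poly, Arith.horner, I.val_zero]⟩
  | cons y l ih =>
    obtain ⟨h1, h2⟩ := ih fun z hz => hl z (by simp [hz])
    have hy := hl y (by simp)
    have h3 := I.wf_mul hx h1
    refine ⟨I.wf_add hy h3, (I.val_add hy h3).trans ?_⟩
    rw [I.val_mul hx h1, h2, poly_cons]
    simp

theorem zipWith_add_spec {a b : List X} {d : ℕ} (ha : I.ListWf d a) (hb : I.ListWf d b) :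
    I.ListWf d (List.zipWith (M.add c) a b) ∧
    I.poly (List.zipWith (M.add c) a b) = I.poly a + I.poly b := by
  induction a generalizing b d with
  | nil =>
    have h1 := ha.1
    have h2 := hb.1
    rw [← h1, List.length_nil, List.length_eq_zero_iff] at h2
    subst h2
    exact ⟨ha, by simp [poly]⟩
  | cons x a ih =>
    have h1 := ha.1
    have h2 := hb.1
    rcases b with _ | ⟨y, b⟩
    · simp [← h1] at h2
    · obtain ⟨h3, h4⟩ := ih (b := b) (d := a.length)
        ⟨rfl, fun z hz => ha.2 z (by simp [hz])⟩
        ⟨by simpa [← h1] using h2, fun z hz => hb.2 z (by simp [hz])⟩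
      have hx := ha.2 x (by simp)
      have hy := hb.2 y (by simp)
      refine ⟨⟨by simp [← h1] at h2 ⊢; omega, ?_⟩, ?_⟩
      · simpa [I.wf_add hx hy] using h3.2
      · rw [List.zipWith_cons_cons, poly_cons, h4, I.val_add hx hy, poly_cons, poly_cons, C_add]
        ring

/-- This length is the one `encPoly` uses, where the zero polynomial is given by one zero
coefficient. -/
theorem trim_spec {l : List X} (hl : ∀ y ∈ l, I.wf y) : (∀ y ∈ M.trim c l, I.wf y) ∧
    I.poly (M.trim c l) = I.poly l ∧ (M.trim c l).length = (I.poly l).natDegree + 1 := by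
  have key : ∀ t, l.foldr (fun a t => bif t.isEmpty && M.isZero c a then [] else a :: t) [] = t →
      (t = [] ∧ I.poly l = 0) ∨ (t ≠ [] ∧ I.poly l ≠ 0 ∧ (∀ y ∈ t, I.wf y) ∧
        I.poly t = I.poly l ∧ t.length = (I.poly l).natDegree + 1) := by
    induction l with
    | nil => rintro t rfl; exact Or.inl ⟨rfl, rfl⟩
    | cons x l ih =>
      rintro t rfl
      have hx := hl x (by simp)
      rcases ih (fun z hz => hl z (by simp [hz])) _ rfl with ⟨h1, h2⟩ | ⟨h1, h2, h3, h4, h5⟩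
      · rw [List.foldr_cons, h1, poly_cons, h2]
        cases h : M.isZero c x
        · have h' : I.val x ≠ 0 := fun h' => by simp [(I.isZero_iff hx).2 h'] at h
          refine Or.inr ⟨by simp, by simpa using h', by simpa using hx, by simp [poly], by simp⟩
        · exact Or.inl ⟨by simp, by simp [(I.isZero_iff hx).1 h]⟩
      · rw [List.foldr_cons, poly_cons, List.isEmpty_eq_false_iff.2 h1]
        have h6 : (C (I.val x) + Polynomial.X * I.poly l).natDegree = (I.poly l).natDegree + 1 := by
          have : Nontrivial R := by
            by_contra h
            rw [not_nontrivial_iff_subsingleton] at h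
            exact h2 (Subsingleton.elim _ _)
          rw [natDegree_C_add, natDegree_X_mul h2]
        refine Or.inr ⟨by simp, fun h => ?_, ?_, by simp [poly_cons, h4], by simp [h5, h6]⟩
        · rw [h] at h6
          simp at h6
        · simpa [hx] using h3
  rcases key _ rfl with ⟨h1, h2⟩ | ⟨h1, h2, h3, h4, h5⟩
  · simp only [Arith.trim, h1, h2]
    simp [I.wf_zero, poly, I.val_zero]
  · simp only [Arith.trim, List.isEmpty_eq_false_iff.2 h1, cond_false]
    exact ⟨h3, h4, h5⟩

theorem listEq_iff {a b : List X} (ha : ∀ y ∈ a, I.wf y) (hb : ∀ y ∈ b, I.wf y) :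
    M.listEq c a b = true ↔ a = b := by
  have (hab : a.length = b.length) :
      ((a.zip b).all fun t => M.isZero c (M.sub c t.1 t.2)) = true ↔ a = b := by
    induction a generalizing b with
    | nil => simp [List.length_eq_zero_iff.1 hab.symm]
    | cons x a ih =>
      rcases b with _ | ⟨y, b⟩
      · simp at hab
      · have hx := ha x (by simp)
        have hy := hb y (by simp)
        rw [List.zip_cons_cons, List.all_cons, Bool.and_eq_true,
          ih (fun z hz => ha z (by simp [hz])) (fun z hz => hb z (by simp [hz]))
            (by simpa using hab), I.isZero_iff (I.wf_sub hx hy), I.val_sub hx hy, sub_eq_zero,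
          List.cons.injEq]
        exact and_congr_left fun _ => ⟨I.inj hx hy, congrArg _⟩
  unfold Arith.listEq
  rcases lt_trichotomy a.length b.length with h | h | h
  · simp only [h, decide_true]
    simpa using fun h' : a = b => by simp [h'] at h
  · rw [← this h]
    simp [h]
  · simp only [h, decide_true]
    simpa using fun h' : a = b => by simp [h'] at h

theorem dedup_spec {L : List (List X)} (hL : ∀ l ∈ L, ∀ y ∈ l, I.wf y) :
    (M.dedup c L).Nodup ∧ ∀ l, l ∈ M.dedup c L ↔ l ∈ L := by
  induction L with
  | nil => simp [Arith.dedup]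
  | cons l L ih =>
    obtain ⟨h1, h2⟩ := ih fun m hm => hL m (by simp [hm])
    have h3 : M.dedup c (l :: L) = bif (M.dedup c L).all (fun m => !(M.listEq c l m)) then
      l :: M.dedup c L else M.dedup c L := rfl
    have h4 : (M.dedup c L).all (fun m => !(M.listEq c l m)) = true ↔ l ∉ M.dedup c L := by
      rw [List.all_eq_true]
      have h5 (m : List X) (hm : m ∈ M.dedup c L) : M.listEq c l m = true ↔ l = m :=
        I.listEq_iff (hL l (by simp)) (hL m (by simp [(h2 m).1 hm]))
      constructor
      · intro h hl
        simpa [(h5 l hl).2 rfl] using h l hl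
      · intro h m hm
        by_contra h'
        simp only [Bool.not_eq_true, Bool.not_eq_false'] at h'
        exact h ((h5 m hm).1 h' ▸ hm)
    rw [h3]
    by_cases h : l ∈ M.dedup c L
    · rw [Bool.eq_false_iff.2 (h4.not.2 (not_not.2 h)), cond_false]
      refine ⟨h1, fun m => ?_⟩
      rw [h2, List.mem_cons]
      exact ⟨Or.inr, fun h' => h'.elim (fun e => e ▸ (h2 l).1 h) id⟩
    · rw [h4.2 h, cond_true]
      exact ⟨List.nodup_cons.2 ⟨h, h1⟩, fun m => by rw [List.mem_cons, List.mem_cons, h2]⟩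

end Interp

namespace Interp

variable {γ X : Type} [Enc γ] [Enc X] [Inhabited X] {M : Arith γ X} {c : γ} {p : ℕ} {R : Type*}
    [Field R] [Algebra (ZMod p) R] (I : Interp M c p R)

/-- The inverse is the power with exponent p^m - 2 = p (p^(m-1) - 1) + (p - 2); the fold produces
the exponent p^(m-1) - 1 by appending digits p - 1 in base p. -/
theorem inv_spec [Finite R] (hp : 2 ≤ p) {β : Type} {l : List β} (hl : l ≠ [])
    (hR : Nat.card R = p ^ l.length) {x : X} (hx : I.wf x) :
    I.wf (M.inv c p l x) ∧ (I.val x ≠ 0 → I.val (M.inv c p l x) = (I.val x)⁻¹) := by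
  obtain ⟨h1, h2⟩ := I.pow_spec hx (p - 1)
  obtain ⟨h3, h4⟩ := I.pow_spec hx (p - 2)
  have key (m : List β) : I.wf (m.foldl (fun y _ =>
      M.mul c (M.pow c y p.bits) (M.pow c x (p - 1).bits)) (M.one c)) ∧
      I.val (m.foldl (fun y _ =>
        M.mul c (M.pow c y p.bits) (M.pow c x (p - 1).bits)) (M.one c)) =
      I.val x ^ (p ^ m.length - 1) := by
    induction m using List.reverseRecOn with
    | nil => exact ⟨I.wf_one, by simp [I.val_one]⟩
    | append_singleton m b ih =>
      rw [List.foldl_append]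
      obtain ⟨h5, h6⟩ := I.pow_spec ih.1 p
      refine ⟨I.wf_mul h5 h1, (I.val_mul h5 h1).trans ?_⟩
      rw [h6, ih.2, h2, ← pow_mul, ← pow_add, List.length_append, List.length_singleton, pow_succ,
        Nat.sub_mul]
      congr 1
      have := Nat.le_mul_of_pos_left p (Nat.pos_of_ne_zero (pow_ne_zero m.length (by omega : p ≠ 0)))
      omega
  obtain ⟨h5, h6⟩ := key l.tail
  obtain ⟨h7, h8⟩ := I.pow_spec h5 p
  refine ⟨I.wf_mul h7 h3, fun h0 => (I.val_mul h7 h3).trans (eq_inv_of_mul_eq_one_right ?_)⟩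
  rw [h8, h6, h4, ← pow_mul, ← pow_add, ← pow_succ']
  have hc : 0 < l.length := List.length_pos_iff.2 hl
  have := Fintype.ofFinite R
  have h9 := FiniteField.pow_card_sub_one_eq_one _ h0
  rw [← Nat.card_eq_fintype_card, hR] at h9
  convert h9 using 2
  obtain ⟨r, hr⟩ : ∃ r, l.length = r + 1 := ⟨l.length - 1, by omega⟩
  rw [List.length_tail, hr, Nat.add_sub_cancel, pow_succ, Nat.sub_mul]
  have := Nat.le_mul_of_pos_left p (Nat.pos_of_ne_zero (pow_ne_zero r (by omega : p ≠ 0)))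
  omega

/-- As the nodes are distinct, the node polynomial does not vanish at the next node, so a suitable
multiple of it corrects the value there; at the earlier nodes it vanishes and changes nothing. -/
theorem newtonFold_spec [Finite R] (hp : 2 ≤ p) {β : Type} {l : List β} (hl : l ≠ [])
    (hR : Nat.card R = p ^ l.length) {J : List (X × X)} (hJ : ∀ q ∈ J, I.wf q.1 ∧ I.wf q.2)
    (hd : (J.map fun q => I.val q.1).Nodup) :
    I.ListWf J.length (J.foldl (M.newtonStep c p l) ([], [M.one c])).1 ∧
    I.ListWf (J.length + 1) (J.foldl (M.newtonStep c p l) ([], [M.one c])).2 ∧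
    I.poly (J.foldl (M.newtonStep c p l) ([], [M.one c])).2 =
      (J.map fun q => Polynomial.X - C (I.val q.1)).prod ∧
    ∀ q ∈ J, (I.poly (J.foldl (M.newtonStep c p l) ([], [M.one c])).1).eval (I.val q.1) =
      I.val q.2 := by
  induction J using List.reverseRecOn with
  | nil => exact ⟨⟨rfl, by simp⟩, ⟨rfl, by simp [I.wf_one]⟩, by simp [poly, I.val_one], by simp⟩
  | append_singleton J q ih =>
    rw [List.map_append, List.nodup_append] at hd
    obtain ⟨h1, h2, h3, h4⟩ := ih (fun q hq => hJ q (by simp [hq])) hd.1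
    obtain ⟨hq1, hq2⟩ := hJ q (by simp)
    rw [List.foldl_append, List.foldl_cons, List.foldl_nil]
    generalize J.foldl (M.newtonStep c p l) ([], [M.one c]) = s at *
    obtain ⟨w1, e1⟩ := I.horner_spec h1.2 hq1
    obtain ⟨w2, e2⟩ := I.horner_spec h2.2 hq1
    have h5 : (I.poly s.2).eval (I.val q.1) ≠ 0 := by
      rw [h3, eval_list_prod, List.map_map]
      refine List.prod_ne_zero fun h => ?_
      obtain ⟨r, hr, h⟩ := List.mem_map.1 h
      simp only [Function.comp, eval_sub, eval_X, eval_C, sub_eq_zero] at h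
      exact hd.2.2 _ (List.mem_map_of_mem hr) _ (List.mem_singleton_self _) h.symm
    obtain ⟨w3, e3⟩ := I.inv_spec hp hl hR w2
    specialize e3 (by rwa [e2])
    have w4 := I.wf_sub hq2 w1
    have w5 := I.wf_mul w4 w3
    have h6 : I.ListWf (J.length + 1) (s.1 ++ [M.zero c]) :=
      ⟨by simp [h1.1], fun y hy => by
        rcases List.mem_append.1 hy with hy | hy
        · exact h1.2 y hy
        · rw [List.mem_singleton.1 hy]; exact I.wf_zero⟩
    have e6 : I.poly (s.1 ++ [M.zero c]) = I.poly s.1 := by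
      rw [poly, evalList_append_singleton, I.val_zero]; simp [poly]
    have h7 := I.scale_spec (g := (Polynomial.X : R[X])) w5 h2
    obtain ⟨h8, e8⟩ := I.zipWith_add_spec h6 h7.1
    have h9 := I.scale_spec (g := (Polynomial.X : R[X])) (I.wf_neg hq1) h2
    have h10 : I.ListWf (J.length + 1 + 1) (s.2.map (M.mul c (M.neg c q.1)) ++ [M.zero c]) :=
      ⟨by simp [h2.1], fun y hy => by
        rcases List.mem_append.1 hy with hy | hy
        · exact h9.1.2 y hy
        · rw [List.mem_singleton.1 hy]; exact I.wf_zero⟩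
    have e10 : I.poly (s.2.map (M.mul c (M.neg c q.1)) ++ [M.zero c]) =
        - C (I.val q.1) * I.poly s.2 := by
      rw [poly, evalList_append_singleton, I.val_zero, h9.2, I.val_neg hq1]; simp [poly]
    have h11 : I.ListWf (J.length + 1 + 1) (M.zero c :: s.2) :=
      ⟨by simp [h2.1], by simpa [I.wf_zero] using h2.2⟩
    obtain ⟨h12, e12⟩ := I.zipWith_add_spec h11 h10
    rw [List.length_append, List.length_singleton]
    refine ⟨h8, h12, e12.trans ?_, fun r hr => ?_⟩
    · rw [e10, poly_cons, I.val_zero, List.map_append, List.prod_append, ← h3]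
      simp
      ring
    · refine (congrArg (eval _) e8).trans ?_
      have h13 : I.poly (s.2.map (M.mul c (M.mul c (M.sub c q.2 (M.horner c s.1 q.1))
          (M.inv c p l (M.horner c s.2 q.1))))) = _ := h7.2
      rw [e6, h13, I.val_mul w4 w3, I.val_sub hq2 w1, e3, e2, e1, eval_add, eval_mul]
      change _ + eval _ (C _) * eval _ (I.poly s.2) = _
      rw [eval_C]
      rcases List.mem_append.1 hr with hr | hr
      · have : (I.poly s.2).eval (I.val r.1) = 0 := by
          rw [h3, eval_list_prod, List.map_map, List.prod_eq_zero_iff]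
          exact List.mem_map.2 ⟨r, hr, by simp⟩
        rw [this, mul_zero, add_zero, h4 r hr]
      · rw [List.mem_singleton.1 hr]
        field_simp
        ring

theorem newton_spec [Finite R] (hp : 2 ≤ p) {β : Type} {l : List β} (hl : l ≠ [])
    (hR : Nat.card R = p ^ l.length) {J : List (X × X)} (hJ : ∀ q ∈ J, I.wf q.1 ∧ I.wf q.2)
    (hd : (J.map fun q => I.val q.1).Nodup) :
    (∀ x ∈ M.newton c p l J, I.wf x) ∧ ∀ f : R[X], f.degree < J.length →
      (∀ q ∈ J, f.eval (I.val q.1) = I.val q.2) → I.poly (M.newton c p l J) = f := by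
  classical
  obtain ⟨h1, -, -, h4⟩ := I.newtonFold_spec hp hl hR hJ hd
  refine ⟨h1.2, fun f hf hfJ => ?_⟩
  have hcard : (J.map fun q => I.val q.1).toFinset.card = J.length := by
    rw [List.toFinset_card_of_nodup hd, List.length_map]
  refine eq_of_degrees_lt_of_eval_finset_eq (J.map fun q => I.val q.1).toFinset ?_ ?_ ?_
  · rw [hcard]
    have := I.degree_poly_lt (M.newton c p l J)
    rwa [show (M.newton c p l J).length = _ from h1.1] at this
  · rwa [hcard]
  · intro x hx
    obtain ⟨q, hq, rfl⟩ := List.mem_map.1 (List.mem_toFinset.1 hx)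
    rw [hfJ q hq]
    exact h4 q hq

end Interp


/-! ### Elements of large degree -/

/-- There is a small `N` modulo which `q` has large order. -/
theorem exists_order_gt {p q K m : ℕ} (hp : p.Prime) (hq : 2 ≤ q) (hm4 : 4 ≤ m)
    (hm : 2 * m ^ 2 * q ^ (K * K) ≤ 4 ^ m) :
    ∃ N ≤ 2 * m, 0 < N ∧ ¬ p ∣ N ∧ ∀ i, 0 < i → i < K → ¬ N ∣ q ^ i - 1 := by
  by_contra! hcon
  -- If there were no such `N`, every prime power up to 2m not divisible by p would divide `P`. The
  -- prime powers exactly dividing the central binomial coefficient of m are at most 2m, so it would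
  -- divide `P` times a power of p that is at most 2m. Then 4^m < m q^(K²) 2m, against `hm`.
  set P := ∏ i ∈ Finset.Ico 1 K, (q ^ i - 1)
  have hP0 : P ≠ 0 := Finset.prod_ne_zero_iff.2 fun i hi => by
    have := Nat.one_lt_pow (n := i) (by simp at hi; omega) (show 1 < q by omega)
    omega
  have hP : P ≤ q ^ (K * K) := by
    calc P ≤ ∏ i ∈ Finset.Ico 1 K, q ^ K := Finset.prod_le_prod' fun i hi =>
          (Nat.sub_le _ _).trans (Nat.pow_le_pow_right (by omega) (by simp at hi; omega))
      _ = q ^ (K * (K - 1)) := by simp [← pow_mul]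
      _ ≤ q ^ (K * K) := Nat.pow_le_pow_right (by omega) (Nat.mul_le_mul_left _ (by omega))
  have hc0 := Nat.centralBinom_ne_zero m
  have hle (l : ℕ) : l ^ m.centralBinom.factorization l ≤ 2 * m := by
    rw [Nat.centralBinom_eq_two_mul_choose]
    exact Nat.pow_factorization_choose_le (by omega)
  have hdvd : m.centralBinom ∣ P * p ^ m.centralBinom.factorization p := by
    have hpp : p ^ m.centralBinom.factorization p ≠ 0 := pow_ne_zero _ hp.ne_zero
    rw [← Nat.factorization_prime_le_iff_dvd hc0 (mul_ne_zero hP0 hpp)]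
    intro l hl
    rw [Nat.factorization_mul hP0 hpp, Finsupp.add_apply]
    rcases eq_or_ne l p with rfl | hlp
    · simp [hp.factorization_self]
    · refine le_trans ?_ (Nat.le_add_right _ _)
      rw [← hl.pow_dvd_iff_le_factorization hP0]
      obtain ⟨i, hi0, hiK, hi⟩ := hcon (l ^ m.centralBinom.factorization l) (hle l)
        (Nat.pos_of_ne_zero (pow_ne_zero _ hl.ne_zero))
        fun h => hlp ((Nat.prime_dvd_prime_iff_eq hp hl).1 (hp.dvd_of_dvd_pow h)).symm
      exact hi.trans (Finset.dvd_prod_of_mem _ (by simp; omega))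
  have h1 := Nat.le_of_dvd (Nat.pos_of_ne_zero (mul_ne_zero hP0 (pow_ne_zero _ hp.ne_zero))) hdvd
  have h2 := Nat.four_pow_lt_mul_centralBinom m hm4
  have h3 : m * m.centralBinom ≤ m * (q ^ (K * K) * (2 * m)) :=
    Nat.mul_le_mul_left _ (h1.trans (Nat.mul_le_mul hP (hle p)))
  nlinarith

theorem exists_order_gt_of_le {p q K b : ℕ} (hp : p.Prime) (hq : 2 ≤ q) (hK : 3 ≤ K)
    (hb : K + (Nat.log 2 q + 1) ≤ b) :
    ∃ N ≤ b ^ 3, 0 < N ∧ ¬ p ∣ N ∧ ∀ i, 0 < i → i < K → ¬ N ∣ q ^ i - 1 := by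
  set L := Nat.log 2 q + 1
  -- As q < 2^L, the first summand gives q^(K²) ≤ 2^m, and m ≥ 7 gives 2m² ≤ 2^m; together these are
  -- the hypothesis of `exists_order_gt`.
  set m := K * K * L + 7
  have h1 : 2 * m ^ 2 ≤ 2 ^ m := by
    have (m : ℕ) (hm : 7 ≤ m) : 2 * m ^ 2 ≤ 2 ^ m := by
      induction m, hm using Nat.le_induction with
      | base => norm_num
      | succ m hm ih => 
        have : 2 ^ (m + 1) = 2 * 2 ^ m := by ring
        nlinarith
    exact this m (by omega)
  have h2 : q ^ (K * K) ≤ 2 ^ m := by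
    calc q ^ (K * K) ≤ (2 ^ L) ^ (K * K) :=
          Nat.pow_le_pow_left (Nat.lt_pow_succ_log_self (by norm_num) q).le _
      _ = 2 ^ (K * K * L) := by rw [← pow_mul, mul_comm]
      _ ≤ 2 ^ m := Nat.pow_le_pow_right two_pos (by omega)
  obtain ⟨N, hN, h⟩ := exists_order_gt (K := K) (m := m) hp hq (by omega)
    ((Nat.mul_le_mul h1 h2).trans_eq (by rw [← mul_pow]; norm_num))
  refine ⟨N, hN.trans ?_, h⟩
  calc 2 * m ≤ (K + L) ^ 3 := by
        have : 1 ≤ L := by omega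
        have h3 : 9 ≤ K * K := by nlinarith
        have h4 : 27 ≤ K * K * K := by nlinarith
        simp only [m]
        nlinarith [Nat.zero_le (3 * K * L * L + L ^ 3), Nat.mul_le_mul h3 this]
    _ ≤ b ^ 3 := Nat.pow_le_pow_left hb 3

/-! ### Interpolation at the conjugates of an element -/

section Frobenius

variable {F K : Type*} [Field F] [Fintype F] [Field K] [Algebra F K]

theorem frobenius_pow (x : K) (i : ℕ) : ((FiniteField.frobeniusAlgHom F K) ^ i) x = x ^ Fintype.card F ^ i := by
  induction i with
  | zero => simp
  | succ i ih => rw [pow_succ', AlgHom.mul_apply, ih, FiniteField.coe_frobeniusAlgHom, pow_succ,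
      pow_mul]

/-- Frobenius fixes the coefficients. Thus the single value of `f` at `x` determines its values at
all conjugates. -/
theorem aeval_pow_card (f : F[X]) (x : K) (i : ℕ) :
    aeval (x ^ Fintype.card F ^ i) f = (aeval x f) ^ Fintype.card F ^ i := by
  rw [← frobenius_pow, ← frobenius_pow, aeval_algHom_apply]

theorem pow_card_injOn {z : K} {n : ℕ} (hz : ∀ i, 0 < i → i ≤ n → z ^ Fintype.card F ^ i ≠ z) :
    Set.InjOn (fun i => z ^ Fintype.card F ^ i) (Finset.range (n + 1)) := by
  have key : ∀ i j, i < j → j ≤ n → z ^ Fintype.card F ^ i ≠ z ^ Fintype.card F ^ j := by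
    intro i j hij hj h
    obtain ⟨d, rfl⟩ := Nat.exists_eq_add_of_lt hij
    refine hz (d + 1) (by omega) (by omega) ?_
    have : i + d + 1 = d + 1 + i := by ring
    rw [this, pow_add, pow_mul, ← frobenius_pow, ← frobenius_pow z (d + 1), ← frobenius_pow] at h
    rw [← frobenius_pow]
    exact (RingHom.injective _ h).symm
  intro i hi j hj h
  simp only [Finset.coe_range, Set.mem_Iio] at hi hj
  rcases lt_trichotomy i j with h' | h' | h'
  · exact (key i j h' (by omega) h).elim
  · exact h'
  · exact (key j i h' (by omega) h.symm).elim

/-- A zero at `z` would bring zeros at `n + 1` distinct conjugates. Applied to the leading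
coefficient of Q in Y, this shows that the denominators are nonzero. -/
theorem aeval_ne_zero_of_orbit {z : K} {n : ℕ} (hz : ∀ i, 0 < i → i ≤ n → z ^ Fintype.card F ^ i ≠ z)
    {f : F[X]} (hf : f ≠ 0) (hn : f.natDegree ≤ n) : aeval z f ≠ 0 := by
  intro h
  refine hf ((Polynomial.map_eq_zero (algebraMap F K)).1
    (eq_zero_of_degree_lt_of_eval_index_eq_zero (Finset.range (n + 1))
      (v := fun i => z ^ Fintype.card F ^ i)
      (pow_card_injOn hz) (f := f.map (algebraMap F K)) ?_ fun i _ => ?_))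
  · rw [degree_map, Finset.card_range]
    exact (degree_le_natDegree.trans_lt (by exact_mod_cast Nat.lt_succ_of_le hn))
  · rw [eval_map_algebraMap, aeval_pow_card, h, zero_pow (pow_ne_zero _ Fintype.card_ne_zero)]

/-- One step of fraction-free interpolation at the nodes `z, z ^ q, z ^ q ^ 2, …`; the state
consists of the numerator and the denominator of the value at `a` of the interpolating polynomial
and of the last node. -/
def nevilleStep {K : Type*} [CommRing K] (e : ℕ) (a z : K) (s : K × K × K) : K × K × K :=
  ((a - s.2.2 ^ e) * (s.1 * s.2.1 ^ e) - (a - z) * (s.1 ^ e * s.2.1),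
    s.2.1 * s.2.1 ^ e * (z - s.2.2 ^ e), s.2.2 ^ e)

/-- Neville's recursion. Write q = |F|, z_i = z^(q^i), and let H interpolate `f` at z_0, …, z_s.
Raising the coefficients of H to the q-th power gives a polynomial H' interpolating at z_1, …,
z_(s+1), and ((X - z_(s+1)) H - (X - z_0) H') / (z_0 - z_(s+1)) interpolates at all of them. After
`n` steps the degree bound identifies the result with `f`. -/
theorem neville_spec {z : K} {n : ℕ} (hz : ∀ i, 0 < i → i ≤ n → z ^ Fintype.card F ^ i ≠ z) {f : F[X]}
    (hf : f.degree < ((n + 1 : ℕ) : WithBot ℕ)) (a : F) {d : K} (hd : d ≠ 0) :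
    ∃ d' ≠ 0, ((nevilleStep (Fintype.card F) (algebraMap F K a) z)^[n] (aeval z f * d, d, z)).1 =
      algebraMap F K (f.eval a) * d' := by
  have key : ∀ s ≤ n, ∃ d' ≠ 0, ∃ H : K[X], H.degree < ((s + 1 : ℕ) : WithBot ℕ) ∧
      (∀ i ≤ s, H.eval (z ^ Fintype.card F ^ i) = aeval (z ^ Fintype.card F ^ i) f) ∧
      (nevilleStep (Fintype.card F) (algebraMap F K a) z)^[s] (aeval z f * d, d, z) =
        (H.eval (algebraMap F K a) * d', d', z ^ Fintype.card F ^ s) := by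
    intro s
    induction s with
    | zero =>
      intro _
      exact ⟨d, hd, C (aeval z f), degree_C_le.trans_lt (by norm_num),
        fun i hi => by simp [Nat.le_zero.1 hi], by simp⟩
    | succ s ih =>
      intro hs
      obtain ⟨e, he, H, hH, hH', h⟩ := ih (by omega)
      set φ := FiniteField.frobeniusAlgHom F K
      have hφ (x : K) : φ x = x ^ Fintype.card F := by simp [φ]
      have hzs := sub_ne_zero.2 (hz (s + 1) (by omega) hs).symm
      have hHφ (x : K) : (H.map (φ : K →+* K)).eval (x ^ Fintype.card F) = (H.eval x) ^ Fintype.card F := by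
        rw [← hφ, ← hφ]
        exact eval_map_apply (f := (φ : K →+* K)) x
      have hd0 (P : K[X]) (hP : P.degree < ((s + 1 : ℕ) : WithBot ℕ)) (y : K) :
          ((X - C y) * P).degree < ((s + 1 + 1 : ℕ) : WithBot ℕ) := by
        rw [degree_mul, degree_X_sub_C, add_comm]
        by_cases h0 : P = 0
        · simp [h0]
        · rw [degree_eq_natDegree h0] at hP ⊢
          norm_cast at hP ⊢
          omega
      refine ⟨e * e ^ Fintype.card F * (z - z ^ Fintype.card F ^ (s + 1)), mul_ne_zero (mul_ne_zero he (pow_ne_zero _ he)) hzs,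
        C (z - z ^ Fintype.card F ^ (s + 1))⁻¹ * ((X - C (z ^ Fintype.card F ^ (s + 1))) * H -
          (X - C z) * H.map (φ : K →+* K)), ?_, fun i hi => ?_, ?_⟩
      · rw [degree_C_mul (inv_ne_zero hzs)]
        refine (degree_sub_le _ _).trans_lt (max_lt ?_ ?_)
        · exact hd0 _ hH _
        · exact hd0 _ (by rwa [degree_map]) _
      · simp only [eval_mul, eval_C, eval_sub, eval_X]
        have h0 : i ≤ s → H.eval (z ^ Fintype.card F ^ i) = aeval (z ^ Fintype.card F ^ i) f := hH' i
        have h1 : 0 < i → (H.map (φ : K →+* K)).eval (z ^ Fintype.card F ^ i) = aeval (z ^ Fintype.card F ^ i) f := by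
          intro hi0
          obtain ⟨j, rfl⟩ : ∃ j, i = j + 1 := ⟨i - 1, by omega⟩
          rw [pow_succ, pow_mul, hHφ, hH' j (by omega)]
          simpa using (aeval_pow_card f (z ^ Fintype.card F ^ j) 1).symm
        rcases Nat.eq_zero_or_pos i with hi0 | hi0
        · subst hi0
          rw [h0 (by omega)]
          simp only [pow_zero, pow_one, sub_self, zero_mul, sub_zero]
          rw [← mul_assoc, inv_mul_cancel₀ hzs, one_mul]
        · rcases Nat.lt_or_ge s i with his | his
          · obtain rfl : i = s + 1 := by omega
            rw [h1 hi0, sub_self, zero_mul, zero_sub, ← neg_mul, neg_sub, ← mul_assoc,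
              inv_mul_cancel₀ hzs, one_mul]
          · rw [h1 hi0, h0 his, ← sub_mul, sub_sub_sub_cancel_left, ← mul_assoc,
              inv_mul_cancel₀ hzs, one_mul]
      · rw [Function.iterate_succ_apply', h]
        -- Since `a` is fixed by Frobenius, the value at `a` of the conjugate of `H` is the q-th
        -- power of that of `H`; the recursion therefore needs only values, not coefficients.
        have ha : algebraMap F K a ^ Fintype.card F = algebraMap F K a := by
          rw [← map_pow, FiniteField.pow_card]
        have h2 := hHφ (algebraMap F K a)
        rw [ha] at h2
        simp only [nevilleStep, eval_mul, eval_C, eval_sub, eval_X, h2, ← pow_mul, ← pow_succ]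
        refine Prod.ext ?_ rfl
        simp only
        field_simp
        ring
  obtain ⟨d', hd', H, hH, hH', h⟩ := key n le_rfl
  refine ⟨d', hd', ?_⟩
  have : H = f.map (algebraMap F K) := by
    refine eq_of_degrees_lt_of_eval_index_eq (Finset.range (n + 1))
      (v := fun i => z ^ Fintype.card F ^ i) (pow_card_injOn hz)
      (by rwa [Finset.card_range]) (by rwa [Finset.card_range, degree_map]) fun i hi => ?_
    rw [hH' i (by simp at hi; omega), eval_map_algebraMap]
  rw [h, this, eval_map_algebraMap, aeval_algebraMap_apply, coe_aeval_eq_eval]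

end Frobenius

/-- Fitting's lemma: beyond the dimension the kernels of the powers of multiplication by `u` are
stable, hence so are the images, and `u ^ n` lies in the image of `u ^ (2 n)`. -/
theorem exists_eq_sq_mul {k A : Type*} [Field k] [CommRing A] [Algebra k A] [FiniteDimensional k A]
    (u : A) {n : ℕ} (hn : Module.finrank k A ≤ n) : ∃ a, u ^ n = (u ^ n) ^ 2 * a := by
  set T : A →ₗ[k] A := LinearMap.mulLeft k u
  have hT (m : ℕ) (a : A) : (T ^ m) a = u ^ m * a := by
    rw [LinearMap.pow_mulLeft, LinearMap.mulLeft_apply]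
  have h1 : LinearMap.ker (T ^ n) = LinearMap.ker (T ^ (n * 2)) := by
    rw [Module.End.ker_pow_eq_ker_pow_finrank_of_le hn,
      Module.End.ker_pow_eq_ker_pow_finrank_of_le (show _ ≤ n * 2 by omega)]
  have h2 : LinearMap.range (T ^ (n * 2)) ≤ LinearMap.range (T ^ n) := by
    rw [mul_two, pow_add]
    exact LinearMap.range_comp_le_range _ _
  have h3 : LinearMap.range (T ^ (n * 2)) = LinearMap.range (T ^ n) := by
    refine Submodule.eq_of_le_of_finrank_eq h2 ?_
    have h4 := LinearMap.finrank_range_add_finrank_ker (T ^ n)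
    have h5 := LinearMap.finrank_range_add_finrank_ker (T ^ (n * 2))
    rw [← h1] at h5
    omega
  have h6 : u ^ n ∈ LinearMap.range (T ^ n) := ⟨1, by rw [hT, mul_one]⟩
  rw [← h3] at h6
  obtain ⟨a, ha⟩ := h6
  refine ⟨a, ha.symm.trans ?_⟩
  rw [hT, pow_mul]


/-! ### The algorithm -/

namespace Arith

section
variable {γ X α β β' : Type} [Enc γ] [Enc X] [Enc α] [Enc β] [Enc β'] (M : Arith γ X)

/-- The coefficients `-l i * a ^ (D - 1 - i)`, `i < D`, where `a` is the last element of the list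
`l` of length `D + 1`. -/
def relation (c : γ) (l : List X) : List X :=
  (l.dropLast.foldr (fun x s => (M.neg c (M.mul c x s.2) :: s.1,
    M.mul c (l.getLastD (M.zero c)) s.2)) ([], M.one c)).1

@[fun_prop] theorem polyTime_relation {c : α → γ} {l : α → List X} (hc : PolyTime c)
    (hl : PolyTime l) : PolyTime fun a => M.relation (c a) (l a) := by
  refine PolyTime.fst (PolyTime.foldr (l := fun a => (l a).dropLast) (s := fun a => ([], M.one (c a)))
    (g := fun a x (s : List X × X) => (M.neg (c a) (M.mul (c a) x s.2) :: s.1,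
      M.mul (c a) ((l a).getLastD (M.zero (c a))) s.2)) (by fun_prop) (by fun_prop) (by fun_prop)
    (B := fun a => 2 * M.bound.eval (sz (c a)) + 1) (by fun_prop) fun a x _ s => ?_)
  have h1 := M.sz_neg_le (c a) (M.mul (c a) x s.2)
  have h2 := M.sz_mul_le (c a) ((l a).getLastD (M.zero (c a))) s.2
  rcases s with ⟨s, t⟩
  simp only [sz_pair, sz_cons] at *
  omega

theorem sz_frob_le (c : γ) (d : List Bool) (l : List β) (x : X) :
    sz (M.frob c d l x) ≤ sz x + (M.bound.eval (sz c) + sz (M.one c)) := by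
  rcases List.eq_nil_or_concat l with rfl | ⟨l, y, rfl⟩
  · exact Nat.le_add_right _ _
  · rw [List.concat_eq_append, frob, List.foldl_concat]
    exact (M.sz_pow_le _ _ _).trans (Nat.le_add_left _ _)

/-- The step `nevilleStep` on representations. -/
def neville (c : γ) (d : List Bool) (l : List β) (a z : X) (s : X × X × X) : X × X × X :=
  (M.sub c (M.mul c (M.sub c a (M.frob c d l s.2.2)) (M.mul c s.1 (M.frob c d l s.2.1)))
      (M.mul c (M.sub c a z) (M.mul c (M.frob c d l s.1) s.2.1)),
    M.mul c (M.mul c s.2.1 (M.frob c d l s.2.1)) (M.sub c z (M.frob c d l s.2.2)),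
    M.frob c d l s.2.2)

@[fun_prop] theorem polyTime_neville {c : α → γ} {d : α → List Bool} {l : α → List β} {x z : α → X}
    {s : α → X × X × X} (hc : PolyTime c) (hd : PolyTime d) (hl : PolyTime l) (hx : PolyTime x)
    (hz : PolyTime z) (hs : PolyTime s) :
    PolyTime fun a => M.neville (c a) (d a) (l a) (x a) (z a) (s a) := by
  unfold neville; fun_prop

/-- An element that vanishes where `y = b * e` after interpolation at the nodes `z, z ^ q, …`. -/
def agreeTest (c : γ) (d : List Bool) (l : List β) (w : List β') (y e z a b : X) : X :=
  -- The interpolation starts from the fraction (y - b e) / e. The final p-power has exponent `p ^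
  -- (M.basis c).length`, at least the dimension of the ring, so that `exists_eq_sq_mul` applies.
  M.frob c d (M.basis c) (w.foldl (fun s _ => M.neville c d l a z s)
    (M.sub c y (M.mul c b e), e, z)).1

@[fun_prop] theorem polyTime_agreeTest {c : α → γ} {d : α → List Bool} {l : α → List β}
    {w : α → List β'} {y e z x b : α → X} (hc : PolyTime c) (hd : PolyTime d) (hl : PolyTime l)
    (hw : PolyTime w) (hy : PolyTime y) (he : PolyTime e) (hz : PolyTime z) (hx : PolyTime x)
    (hb : PolyTime b) :
    PolyTime fun a => M.agreeTest (c a) (d a) (l a) (w a) (y a) (e a) (z a) (x a) (b a) := by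
  have : PolyTime fun a => (w a).foldl (fun s _ => M.neville (c a) (d a) (l a) (x a) (z a) s)
      (M.sub (c a) (y a) (M.mul (c a) (b a) (e a)), e a, z a) :=
    PolyTime.foldl (l := w) (g := fun a s _ => M.neville (c a) (d a) (l a) (x a) (z a) s)
      (by fun_prop) (by fun_prop) (by fun_prop)
      (B := fun a => 3 * M.bound.eval (sz (c a)) + sz (M.one (c a))) (by fun_prop) fun a _ _ s => by
        have h1 := M.sz_frob_le (c a) (d a) (l a) s.2.2
        have h2 := M.sz_add_le (c a)
        have h3 := M.sz_mul_le (c a)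
        rcases s with ⟨s, t, u⟩
        simp only [neville, sz_pair, sub] at *
        refine (Nat.add_le_add_right (Nat.add_le_add (h2 _ _) (Nat.add_le_add_right
          (Nat.add_le_add (h3 _ _) h1) 1)) 1).trans ?_
        omega
  unfold agreeTest
  fun_prop

variable [Inhabited X]

/-- The ring `R[x] / (x ^ N - 1)`, where `N` is the length of `l`. -/
def cyclic (c : γ) (l : List β) : γ × List X := (c, M.one c :: l.tail.map fun _ => M.zero c)

@[fun_prop] theorem polyTime_cyclic {c : α → γ} {l : α → List β} (hc : PolyTime c)
    (hl : PolyTime l) : PolyTime fun a => M.cyclic (c a) (l a) := by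
  unfold cyclic; fun_prop

/-- The value of a polynomial at the generator of an extension. -/
noncomputable def Ext.aeval (c : γ × List X) (l : List X) : List X :=
  l.foldr (fun a y => M.ext.add c (Ext.const M c a) (Ext.shift M c y)) (M.ext.zero c)

@[fun_prop] theorem Ext.polyTime_aeval {c : α → γ × List X} {l : α → List X} (hc : PolyTime c)
    (hl : PolyTime l) : PolyTime fun a => Ext.aeval M (c a) (l a) :=
  PolyTime.foldr (g := fun b a y => M.ext.add (c b) (Ext.const M (c b) a) (Ext.shift M (c b) y))
    (by fun_prop) (by fun_prop) (by fun_prop) (B := fun a => M.ext.bound.eval (sz (c a)))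
    (by fun_prop) fun a b _ y => (M.ext.sz_add_le _ _ _).trans (by omega)

/-- The agreement lists found in the algebra given by `Q` over `R[x] / (x ^ N - 1)`, where `N` is
the length of `l`. Here `d` and `h` describe the cardinality of `R`. -/
noncomputable def patterns (c : γ) (d : List Bool) (h : List β') (w : List (X × X)) (Q : List (List X))
    (l : List β) : List (List (X × X)) :=
  -- `e` describes E = R[x]/(x^N - 1), and `A` describes E[y] modulo the monic form of Q(x, Y). The
  -- element `y` stands for `lc` times f(x), and `lc` is the common starting denominator of all
  -- tests.
  let e := M.cyclic c l
  let QE := Q.map (Ext.aeval M e)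
  let A := (e, M.ext.relation e QE)
  let y := Ext.shift M.ext A (M.ext.ext.one A)
  let x := Ext.const M.ext A (Ext.shift M e (M.ext.one e))
  let lc := Ext.const M.ext A (QE.getLastD (M.ext.zero e))
  (M.ext.ext.splitAll A (w.map fun t => (t, M.ext.ext.agreeTest A d h w y lc x
    (Ext.const M.ext A (Ext.const M e t.1)) (Ext.const M.ext A (Ext.const M e t.2))))
    (M.ext.ext.basis A)).map Prod.fst

@[fun_prop] theorem polyTime_patterns {c : α → γ} {d : α → List Bool} {h : α → List β'}
    {w : α → List (X × X)} {Q : α → List (List X)} {l : α → List β} (hc : PolyTime c)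
    (hd : PolyTime d) (hh : PolyTime h) (hw : PolyTime w) (hQ : PolyTime Q) (hl : PolyTime l) :
    PolyTime fun a => M.patterns (c a) (d a) (h a) (w a) (Q a) (l a) := by
  have hE : PolyTime fun a => M.cyclic (c a) (l a) := by fun_prop
  have hQE : PolyTime fun a => (Q a).map (Ext.aeval M (M.cyclic (c a) (l a))) :=
    PolyTime.map (g := fun a => Ext.aeval M (M.cyclic (c a) (l a))) hQ (by fun_prop)
  have hA : PolyTime fun a => (M.cyclic (c a) (l a), M.ext.relation (M.cyclic (c a) (l a))
    ((Q a).map (Ext.aeval M (M.cyclic (c a) (l a))))) := by fun_prop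
  unfold patterns
  fun_prop

/-- The positions at which a polynomial agrees with the word `w`. -/
def agreeing (c : γ) (w : List (X × X)) (f : List X) : List (X × X) :=
  w.filter fun t => M.isZero c (M.sub c (M.horner c f t.1) t.2)

@[fun_prop] theorem polyTime_agreeing {c : α → γ} {w : α → List (X × X)} {f : α → List X}
    (hc : PolyTime c) (hw : PolyTime w) (hf : PolyTime f) :
    PolyTime fun a => M.agreeing (c a) (w a) (f a) := by
  unfold agreeing; fun_prop

/-- Test for closeness. -/
def isClose (c : γ) (k : ℕ) (w : List (X × X)) (f : List X) : Bool :=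
  -- The condition (k - 1) n ≤ A² on the agreement A is tested as k n ≤ n + A², without roots or
  -- subtraction.
  !(decide (k < f.length)) && !(decide
    (w.length + (M.agreeing c w f).length * (M.agreeing c w f).length < k * w.length))

@[fun_prop] theorem polyTime_isClose {c : α → γ} {k : α → ℕ} {w : α → List (X × X)}
    {f : α → List X} (hc : PolyTime c) (hk : PolyTime k) (hw : PolyTime w) (hf : PolyTime f) :
    PolyTime fun a => M.isClose (c a) (k a) (w a) (f a) := by
  unfold isClose; fun_prop

end

/-! ### Enumeration of field elements, for k = 1 -/

section Enumeration
variable {α β β' : Type} [Enc α] [Enc β] [Enc β']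

/-- The natural numbers less than `p` and at most the length of `l`. -/
def residues (p : ℕ) (l : List β) : List ℕ := (l.tails.map List.length).filter fun i => decide (i < p)

@[fun_prop] theorem polyTime_residues {p : α → ℕ} {l : α → List β} (hp : PolyTime p)
    (hl : PolyTime l) : PolyTime fun a => residues (p a) (l a) := by
  unfold residues; fun_prop

/-- The lists of residues modulo `p` of the same length as `h`, or some of them if there are more
than the length of `l`. -/
def tuples (p : ℕ) (h : List β') (l : List β) : List (List ℕ) :=
  h.foldl (fun S _ => (l.zip (S.flatMap fun t => (residues p l).map fun i => i :: t)).map Prod.snd)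
    [[]]

@[fun_prop] theorem polyTime_tuples {p : α → ℕ} {h : α → List β'} {l : α → List β}
    (hp : PolyTime p) (hh : PolyTime h) (hl : PolyTime l) :
    PolyTime fun a => tuples (p a) (h a) (l a) := by
  have hl' := hl.polyBdd
  have hr : PolyTime fun a => residues (p a) (l a) := by fun_prop
  refine PolyTime.foldl_of_inv (l := h) (s := fun _ => [[]]) (g := fun a S _ =>
    ((l a).zip (S.flatMap fun t => (residues (p a) (l a)).map fun i => i :: t)).map Prod.snd)
    hh (by fun_prop) (by fun_prop)
    (fun a i S => S.length ≤ (l a).length + 1 ∧ ∀ t ∈ S, sz t ≤ 1 + i * (sz (residues (p a) (l a)) + 1))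
    (by simp)
    (B := fun a => (sz (l a) + 1) * (1 + sz (h a) * (sz (residues (p a) (l a)) + 1) + 1) + 1)
    (fun a i x S hx _ hS => ⟨by simp, fun t ht => ?_⟩) (by fun_prop) fun a i S hi hS => ?_
  · obtain ⟨u, hu, rfl⟩ := List.mem_map.1 ht
    obtain ⟨v, hv, hu⟩ := List.mem_flatMap.1 (List.of_mem_zip hu).2
    obtain ⟨j, hj, hu⟩ := List.mem_map.1 hu
    rw [← hu]
    have h1 := hS.2 v hv
    have h2 := sz_le_of_mem hj
    simp only [sz_cons, add_mul]
    omega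
  · have h0 := length_lt_sz (l a)
    have h1 := (length_lt_sz (h a)).le
    refine (sz_list_le (B := 1 + sz (h a) * (sz (residues (p a) (l a)) + 1)) fun t ht =>
      (hS.2 t ht).trans ?_).trans ?_
    · gcongr
      omega
    · gcongr
      omega

end Enumeration

/-! ### The decoder -/

section Main
variable {γ X α β : Type} [Enc γ] [Enc X] [Enc α] [Enc β]

/-- Bounds for the orders of the roots of unity. -/
def sizeList (p : ℕ) (h : List ℕ) (w : List (X × X)) (Q : List (List X)) : List Unit :=
  (w.map fun _ => ()) ++ (Q.flatten.map fun _ => ()) ++ h.flatMap fun _ => p.bits.map fun _ => ()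

@[fun_prop] theorem polyTime_sizeList {p : α → ℕ} {h : α → List ℕ} {w : α → List (X × X)}
    {Q : α → List (List X)} (hp : PolyTime p) (hh : PolyTime h) (hw : PolyTime w)
    (hQ : PolyTime Q) : PolyTime fun a => sizeList (p a) (h a) (w a) (Q a) := by
  unfold sizeList; fun_prop

/-- A list of length `n ^ 3`, where `n` is the length of `l`. -/
def cubeList (l : List Unit) : List Unit := l.flatMap fun _ => l.flatMap fun _ => l

@[fun_prop] theorem polyTime_cubeList {l : α → List Unit} (hl : PolyTime l) :
    PolyTime fun a => cubeList (l a) := by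
  unfold cubeList; fun_prop

/-- Polynomials among which are all the close ones. -/
noncomputable def candidates (p : ℕ) (h : List ℕ) (w : List (List ℕ × List ℕ))
    (Q : List (List (List ℕ))) : List (List (List ℕ)) :=
  -- The constants serve the case k = 1. For k ≥ 2, the suffixes of the cubed list run through all
  -- orders N up to the bound of `exists_order_gt_of_le`, in unary.
  ((tuples p h Q).map fun t => [t]) ++
    (cubeList (sizeList p h w Q)).tails.flatMap fun l =>
      (prime.ext.patterns (p, h) p.bits h w Q l).map fun J =>
        prime.ext.trim (p, h) (prime.ext.newton (p, h) p h J)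

@[fun_prop] theorem polyTime_candidates {p : α → ℕ} {h : α → List ℕ} {w : α → List (List ℕ × List ℕ)}
    {Q : α → List (List (List ℕ))} (hp : PolyTime p) (hh : PolyTime h) (hw : PolyTime w)
    (hQ : PolyTime Q) : PolyTime fun a => candidates (p a) (h a) (w a) (Q a) := by
  unfold candidates; fun_prop

/-- The list of the close polynomials. -/
noncomputable def listDecode
    (t : (ℕ × List ℕ) × ℕ × List (List ℕ × List ℕ) × List (List (List ℕ))) : List (List (List ℕ)) :=
  -- The input gives the monic minimal polynomial of the generator; negating its lower coefficients
  -- expresses the top power of the generator in the basis.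
  let h := t.1.2.dropLast.map (prime.neg t.1.1)
  prime.ext.dedup (t.1.1, h) ((candidates t.1.1 h t.2.2.1 t.2.2.2).filter fun f =>
    prime.ext.isClose (t.1.1, h) t.2.1 t.2.2.1 f)

theorem polyTime_listDecode : PolyTime listDecode := by
  have h : PolyTime fun t : (ℕ × List ℕ) × ℕ × List (List ℕ × List ℕ) × List (List (List ℕ)) =>
      t.1.2.dropLast.map (prime.neg t.1.1) :=
    .map (g := fun (t : (ℕ × List ℕ) × ℕ × List (List ℕ × List ℕ) × List (List (List ℕ))) =>
      prime.neg t.1.1) (by fun_prop) (by fun_prop)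
  unfold listDecode
  fun_prop

end Main

end Arith


/-! ### Correctness of the algorithm -/

/-- Fraction-free interpolation uses ring operations only. It can be run in the algebra and its
outcome evaluated by a homomorphism to a field. -/
theorem map_nevilleStep {R S : Type*} [CommRing R] [CommRing S] (φ : R →+* S) (e : ℕ) (a z : R)
    (s : R × R × R) : nevilleStep e (φ a) (φ z) (φ s.1, φ s.2.1, φ s.2.2) =
      (φ (nevilleStep e a z s).1, φ (nevilleStep e a z s).2.1, φ (nevilleStep e a z s).2.2) := by
  simp [nevilleStep]

theorem map_nevilleStep_iterate {R S : Type*} [CommRing R] [CommRing S] (φ : R →+* S) (e : ℕ)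
    (a z : R) (n : ℕ) (s : R × R × R) :
    φ ((nevilleStep e a z)^[n] s).1 =
      ((nevilleStep e (φ a) (φ z))^[n] (φ s.1, φ s.2.1, φ s.2.2)).1 := by
  induction n generalizing s with
  | zero => rfl
  | succ n ih => rw [Function.iterate_succ_apply, ih, Function.iterate_succ_apply, map_nevilleStep]

namespace Interp

section Basic
variable {γ X : Type} [Enc γ] [Enc X] {M : Arith γ X} {c : γ} {p : ℕ} {R : Type*}
    [CommRing R] [Algebra (ZMod p) R] (I : Interp M c p R)

theorem neville_spec {β : Type} (l : List β) {a z : X} {s : X × X × X} (ha : I.wf a) (hz : I.wf z)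
    (hs : I.wf s.1 ∧ I.wf s.2.1 ∧ I.wf s.2.2) :
    (I.wf (M.neville c p.bits l a z s).1 ∧ I.wf (M.neville c p.bits l a z s).2.1 ∧
      I.wf (M.neville c p.bits l a z s).2.2) ∧
    (I.val (M.neville c p.bits l a z s).1, I.val (M.neville c p.bits l a z s).2.1,
      I.val (M.neville c p.bits l a z s).2.2) =
    nevilleStep (p ^ l.length) (I.val a) (I.val z) (I.val s.1, I.val s.2.1, I.val s.2.2) := by
  obtain ⟨h1, h2, h3⟩ := hs
  obtain ⟨f1, g1⟩ := I.frob_spec h1 p l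
  obtain ⟨f2, g2⟩ := I.frob_spec h2 p l
  obtain ⟨f3, g3⟩ := I.frob_spec h3 p l
  have k1 := I.wf_sub ha f3
  have k2 := I.wf_mul h1 f2
  have k3 := I.wf_sub ha hz
  have k4 := I.wf_mul f1 h2
  have k5 := I.wf_mul h2 f2
  have k6 := I.wf_sub hz f3
  have k7 := I.wf_mul k1 k2
  have k8 := I.wf_mul k3 k4
  refine ⟨⟨I.wf_sub k7 k8, I.wf_mul k5 k6, f3⟩, ?_⟩
  simp only [Arith.neville, nevilleStep]
  rw [I.val_sub k7 k8, I.val_mul k1 k2, I.val_mul k3 k4, I.val_mul h1 f2, I.val_mul f1 h2,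
    I.val_mul k5 k6, I.val_mul h2 f2, I.val_sub ha f3, I.val_sub ha hz, I.val_sub hz f3, g1, g2, g3]

include I in
-- An `Interp` requires of the basis list only that it spans; this suffices to bound the Fitting
-- exponent.
theorem finrank_le_length [Fact p.Prime] :
    FiniteDimensional (ZMod p) R ∧ Module.finrank (ZMod p) R ≤ (M.basis c).length := by
  classical
  have h : Submodule.span (ZMod p) (((M.basis c).map I.val).toFinset : Set R) = ⊤ := by
    rw [← I.span_basis]
    congr 1
    ext a
    simp
  refine ⟨⟨⟨_, h⟩⟩, ?_⟩
  rw [← finrank_top, ← h]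
  exact (finrank_span_finset_le_card _).trans ((List.toFinset_card_le _).trans (by simp))

theorem agreeTest_spec [Fact p.Prime] {β β' : Type} (l : List β) (w : List β') {y e z a b : X}
    (hy : I.wf y) (he : I.wf e) (hz : I.wf z) (ha : I.wf a) (hb : I.wf b) :
    I.wf (M.agreeTest c p.bits l w y e z a b) ∧
    (∃ t, I.val (M.agreeTest c p.bits l w y e z a b) =
      I.val (M.agreeTest c p.bits l w y e z a b) ^ 2 * t) ∧
    ∀ {K : Type*} [Field K] (φ : R →+* K), φ (I.val (M.agreeTest c p.bits l w y e z a b)) = 0 ↔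
      ((nevilleStep (p ^ l.length) (φ (I.val a)) (φ (I.val z)))^[w.length]
        (φ (I.val y) - φ (I.val b) * φ (I.val e), φ (I.val e), φ (I.val z))).1 = 0 := by
  have key (s : X × X × X) (hs : I.wf s.1 ∧ I.wf s.2.1 ∧ I.wf s.2.2) :
      I.wf (w.foldl (fun s _ => M.neville c p.bits l a z s) s).1 ∧
      I.val (w.foldl (fun s _ => M.neville c p.bits l a z s) s).1 =
        ((nevilleStep (p ^ l.length) (I.val a) (I.val z))^[w.length]
          (I.val s.1, I.val s.2.1, I.val s.2.2)).1 := by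
    induction w generalizing s with
    | nil => exact ⟨hs.1, rfl⟩
    | cons _ w ih =>
      obtain ⟨h1, h2⟩ := I.neville_spec l ha hz hs
      obtain ⟨h3, h4⟩ := ih _ h1
      rw [h2] at h4
      exact ⟨h3, h4⟩
  have hbe := I.wf_mul hb he
  obtain ⟨h1, h2⟩ := key (M.sub c y (M.mul c b e), e, z) ⟨I.wf_sub hy hbe, he, hz⟩
  obtain ⟨h3, h4⟩ := I.frob_spec h1 p (M.basis c)
  obtain ⟨_, h5⟩ := I.finrank_le_length
  have hp := (Fact.out : p.Prime).one_lt
  refine ⟨h3, ?_, fun φ => ?_⟩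
  · rw [Arith.agreeTest, h4]
    exact exists_eq_sq_mul (k := ZMod p) _ (h5.trans (Nat.lt_pow_self hp).le)
  · rw [Arith.agreeTest, h4, map_pow, pow_eq_zero_iff (pow_ne_zero _ (by omega)), h2,
      map_nevilleStep_iterate]
    simp only [I.val_sub hy hbe, I.val_mul hb he, map_sub, map_mul]

/-- Multiplying Σ l_i y^i + b y^D = 0 by b^(D-1) gives the monic equation (b y)^D + Σ l_i b^(D-1-i)
(b y)^i = 0. Monicity is what makes the quotient free, so that lists of coefficients represent its
elements. -/
theorem relation_spec {K : Type*} [Field K] (φ : R →+* K) {l : List X} {b : X}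
    (hl : ∀ x ∈ l, I.wf x) (hb : I.wf b) (hb0 : φ (I.val b) ≠ 0) {y : K}
    (hy : (I.poly (l ++ [b])).eval₂ φ y = 0) :
    I.ListWf l.length (M.relation c (l ++ [b])) ∧
    (Polynomial.X ^ l.length - I.poly (M.relation c (l ++ [b]))).eval₂ φ (φ (I.val b) * y) = 0 := by
  have key (m : List X) (hm : ∀ x ∈ m, I.wf x) :
      let s := m.foldr (fun x s => (M.neg c (M.mul c x s.2) :: s.1, M.mul c b s.2)) ([], M.one c)
      I.ListWf m.length s.1 ∧ I.wf s.2 ∧ I.val s.2 = I.val b ^ m.length ∧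
      φ (I.val b) * (I.poly s.1).eval₂ φ (φ (I.val b) * y) =
        - (φ (I.val b) ^ m.length * (I.poly m).eval₂ φ y) := by
    induction m with
    | nil => simp [ListWf, I.wf_one, I.val_one, poly]
    | cons x m ih =>
      obtain ⟨h1, h2, h3, h4⟩ := ih fun z hz => hm z (by simp [hz])
      have hx := hm x (by simp)
      have h5 := I.wf_mul hx h2
      refine ⟨⟨by simp [h1.1], ?_⟩, I.wf_mul hb h2, ?_, ?_⟩
      · intro z hz
        rcases List.mem_cons.1 hz with rfl | hz
        exacts [I.wf_neg h5, h1.2 z hz]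
      · rw [List.foldr_cons, I.val_mul hb h2, h3, List.length_cons, pow_succ']
      · simp only [List.foldr_cons, poly_cons, eval₂_add, eval₂_mul, eval₂_C, eval₂_X]
        rw [I.val_neg h5, I.val_mul hx h2, h3, map_neg, map_mul, map_pow, List.length_cons]
        linear_combination (φ (I.val b) * y) * h4
  have happ : ∀ l : List X, (I.poly (l ++ [b])).eval₂ φ y =
      (I.poly l).eval₂ φ y + φ (I.val b) * y ^ l.length := by
    intro l
    induction l with
    | nil => simp [poly]
    | cons x l ih =>
      simp only [List.cons_append, poly_cons, eval₂_add, eval₂_mul, eval₂_C, eval₂_X, ih,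
        List.length_cons]
      ring
  obtain ⟨h1, -, -, h2⟩ := key l hl
  have h3 : M.relation c (l ++ [b]) =
      (l.foldr (fun x s => (M.neg c (M.mul c x s.2) :: s.1, M.mul c b s.2)) ([], M.one c)).1 := by
    simp [Arith.relation]
  rw [h3]
  refine ⟨h1, mul_left_cancel₀ hb0 ?_⟩
  rw [eval₂_sub, mul_sub, h2, eval₂_X_pow]
  rw [happ] at hy
  linear_combination φ (I.val b) ^ l.length * hy

end Basic

/-! ### Quotients by monic polynomials -/

section Adjoin
open Arith

variable {γ X : Type} [Enc γ] [Enc X] [Inhabited X] {M : Arith γ X} {c : γ} {p : ℕ} {R : Type*}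
    [CommRing R] [Algebra (ZMod p) R] (I : Interp M c p R)

/-- The polynomial `X ^ d - h`, where `d` is the length of `h`. -/
noncomputable def modulus (h : List X) : R[X] := Polynomial.X ^ h.length - I.poly h

theorem monic_modulus (h : List X) : (I.modulus h).Monic :=
  monic_X_pow_sub (I.degree_poly_lt h)

theorem natDegree_modulus [Nontrivial R] (h : List X) : (I.modulus h).natDegree = h.length := by
  refine natDegree_eq_of_degree_eq_some ?_
  rw [modulus, degree_sub_eq_left_of_degree_lt, degree_X_pow]
  rw [degree_X_pow]
  exact I.degree_poly_lt h

theorem evalList_eq_aeval {A : Type*} [CommRing A] [Algebra R A] (g : A) (l : List X) :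
    I.evalList g l = aeval g (I.poly l) := by
  induction l with
  | nil => exact (map_zero _).symm
  | cons x l ih =>
    rw [poly_cons, map_add, map_mul, aeval_C, aeval_X, ← ih]
    rfl

variable [Nontrivial R]

theorem listWf_of_wf {h : List X} (hh : ∀ x ∈ h, I.wf x) :
    I.ListWf (AdjoinRoot.powerBasis' (I.monic_modulus h)).dim h :=
  ⟨(I.natDegree_modulus h).symm, hh⟩

theorem dim_modulus_pos {h : List X} (h0 : h ≠ []) :
    0 < (AdjoinRoot.powerBasis' (I.monic_modulus h)).dim := by
  rw [AdjoinRoot.powerBasis'_dim, I.natDegree_modulus]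
  exact List.length_pos_iff.2 h0

theorem gen_modulus_pow (h : List X) : (AdjoinRoot.powerBasis' (I.monic_modulus h)).gen ^
    (AdjoinRoot.powerBasis' (I.monic_modulus h)).dim =
      I.evalList (AdjoinRoot.powerBasis' (I.monic_modulus h)).gen h := by
  rw [evalList_eq_aeval, AdjoinRoot.powerBasis'_dim, AdjoinRoot.powerBasis'_gen,
    I.natDegree_modulus, ← sub_eq_zero]
  have : aeval (AdjoinRoot.root (I.modulus h)) (Polynomial.X ^ h.length - I.poly h) = 0 :=
    (AdjoinRoot.aeval_eq _).trans AdjoinRoot.mk_self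
  rwa [map_sub, map_pow, aeval_X] at this

/-- Lists of coefficients represent the elements of `R[X] / (X ^ d - h)`. -/
noncomputable def adjoin (h : List X) (hh : ∀ x ∈ h, I.wf x) (h0 : h ≠ []) :
    Interp M.ext (c, h) p (AdjoinRoot (I.modulus h)) :=
  I.ext (AdjoinRoot.powerBasis' (I.monic_modulus h)) h (I.dim_modulus_pos h0) (I.listWf_of_wf hh)
    (I.gen_modulus_pow h)

variable {h : List X} (hh : ∀ x ∈ h, I.wf x) (h0 : h ≠ [])

theorem adjoin_const {x : X} (hx : I.wf x) : (I.adjoin h hh h0).wf (Ext.const M (c, h) x) ∧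
    (I.adjoin h hh h0).val (Ext.const M (c, h) x) = AdjoinRoot.of _ (I.val x) :=
  I.const_spec (I.listWf_of_wf hh) (I.dim_modulus_pos h0) hx

theorem adjoin_shift {x : List X} (hx : (I.adjoin h hh h0).wf x) :
    (I.adjoin h hh h0).wf (Ext.shift M (c, h) x) ∧
    (I.adjoin h hh h0).val (Ext.shift M (c, h) x) =
      AdjoinRoot.root _ * (I.adjoin h hh h0).val x :=
  I.shift_spec (I.listWf_of_wf hh) (I.dim_modulus_pos h0) (I.gen_modulus_pow h) hx

theorem adjoin_aeval {l : List X} (hl : ∀ x ∈ l, I.wf x) :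
    (I.adjoin h hh h0).wf (Ext.aeval M (c, h) l) ∧
    (I.adjoin h hh h0).val (Ext.aeval M (c, h) l) = AdjoinRoot.mk _ (I.poly l) := by
  set J := I.adjoin h hh h0
  induction l with
  | nil => exact ⟨J.wf_zero, J.val_zero.trans (by simp [poly])⟩
  | cons x l ih =>
    obtain ⟨h1, h2⟩ := ih fun y hy => hl y (by simp [hy])
    obtain ⟨h3, h4⟩ := I.adjoin_const hh h0 (hl x (by simp))
    obtain ⟨h5, h6⟩ := I.adjoin_shift hh h0 h1
    refine ⟨J.wf_add h3 h5, (J.val_add h3 h5).trans ?_⟩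
    rw [h4, h6, h2, poly_cons, map_add, map_mul, AdjoinRoot.mk_C, AdjoinRoot.mk_X]

end Adjoin

end Interp


namespace Interp
open Arith

/-! ### Agreement sets occur among the patterns -/

section Patterns

variable {γ X : Type} [Enc γ] [Enc X] [Inhabited X] {M : Arith γ X} {c : γ} {p : ℕ} [Fact p.Prime]
    {R : Type*} [Field R] [Fintype R] [Algebra (ZMod p) R] (I : Interp M c p R)

/-- A root of unity whose order is not divisible by the characteristic and does not divide small
`q ^ i - 1` has many conjugates. -/
theorem exists_orbit {N n : ℕ} (hN : 0 < N) (hpN : ¬ p ∣ N)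
    (h : ∀ i, 0 < i → i ≤ n → ¬ N ∣ Fintype.card R ^ i - 1) :
    ∃ z : AlgebraicClosure R, z ^ N = 1 ∧ ∀ i, 0 < i → i ≤ n → z ^ Fintype.card R ^ i ≠ z := by
  have : NeZero (N : R) := ⟨fun h => hpN <| by
    rw [← map_natCast (algebraMap (ZMod p) R), map_eq_zero, ZMod.natCast_eq_zero_iff] at h
    exact h⟩
  obtain ⟨z, hz⟩ := HasEnoughRootsOfUnity.exists_primitiveRoot (AlgebraicClosure R) N
  refine ⟨z, hz.pow_eq_one, fun i hi hin he => h i hi hin (hz.dvd_of_pow_eq_one _ ?_)⟩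
  have hz0 : z ≠ 0 := hz.ne_zero hN.ne'
  refine mul_right_cancel₀ hz0 ?_
  rw [← pow_succ, Nat.sub_add_cancel (Nat.one_le_pow _ _ Fintype.card_pos), he, one_mul]

theorem poly_one_cons_zeros {β : Type} (l : List β) :
    I.poly (M.one c :: l.map fun _ => M.zero c) = 1 := by
  have : I.poly (l.map fun _ => M.zero c) = 0 := by
    induction l with
    | nil => rfl
    | cons _ l ih => rw [List.map_cons, poly_cons, ih, I.val_zero]; simp
  rw [poly_cons, this, I.val_one]
  simp

/-- The value at `f` of the polynomial whose coefficients are the polynomials `l`. -/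
theorem eval₂_poly_map {γ' X' : Type} [Enc γ'] [Enc X'] [Inhabited X'] {M' : Arith γ' X'} {c' : γ'} {E K : Type*}
    [CommRing E] [Algebra (ZMod p) E] [Field K] [Algebra R K] (J : Interp M' c' p E) (φ : E →+* K)
    {v : List X → X'} {z : K} (f : R[X]) {Q : List (List X)}
    (hv : ∀ l ∈ Q, φ (J.val (v l)) = aeval z (I.poly l)) :
    (J.poly (Q.map v)).eval₂ φ (aeval z f) =
      aeval z ((Q.map I.poly).foldr (fun a s => a + f * s) 0) := by
  induction Q with
  | nil => simp [poly]
  | cons l Q ih =>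
    rw [List.map_cons, poly_cons, eval₂_add, eval₂_mul, eval₂_C, eval₂_X,
      ih fun m hm => hv m (by simp [hm]), hv l (by simp)]
    simp

theorem patterns_spec {β β' : Type} {h : List β'} (hR : Fintype.card R = p ^ h.length)
    [Enc β'] [Enc β] {w : List (X × X)} (hw : ∀ t ∈ w, I.wf t.1 ∧ I.wf t.2) {Q : List (List X)} {b : List X}
    (hQ : ∀ l ∈ Q, ∀ x ∈ l, I.wf x) (hb : ∀ x ∈ b, I.wf x) (hb0 : I.poly b ≠ 0) (hQ0 : Q ≠ [])
    {K : ℕ} (hbK : (I.poly b).natDegree < K) (hwK : w.length < K) {f : R[X]}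
    (hf : f.degree < ((w.length + 1 : ℕ) : WithBot ℕ))
    (hfQ : ((Q ++ [b]).map I.poly).foldr (fun a s => a + f * s) 0 = 0)
    {l : List β} (hl : 0 < l.length) (hpl : ¬ p ∣ l.length)
    (hlK : ∀ i, 0 < i → i < K → ¬ l.length ∣ Fintype.card R ^ i - 1)
    {P : X × X → Bool} (hP : ∀ t ∈ w, P t = true ↔ f.eval (I.val t.1) = I.val t.2) :
    (w.filter P).reverse ∈ M.patterns c p.bits h w (Q ++ [b]) l := by
  classical
  obtain ⟨z, hz1, hz⟩ := exists_orbit (R := R) (p := p) (n := K - 1) hl hpl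
    fun i hi hiK => hlK i hi (by omega)
  set o := M.one c :: l.tail.map fun _ => M.zero c with ho
  have hol : o.length = l.length := by simp [ho]; omega
  have howf : ∀ x ∈ o, I.wf x := by
    intro x hx
    simp only [ho, List.mem_cons, List.mem_map] at hx
    rcases hx with rfl | ⟨_, _, rfl⟩
    exacts [I.wf_one, I.wf_zero]
  have ho0 : o ≠ [] := by simp [ho]
  let J := I.adjoin o howf ho0
  -- The evaluation x ↦ z, well defined as z^N = 1. Being a map to a field, it also shows that the
  -- cyclic ring is nonzero.
  let φ : AdjoinRoot (I.modulus o) →+* AlgebraicClosure R :=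
    AdjoinRoot.lift (algebraMap R (AlgebraicClosure R)) z (by
      rw [modulus, eval₂_sub, eval₂_X_pow, hol, hz1, ho, poly_one_cons_zeros, eval₂_one, sub_self])
  have hφ (l : List X) (hl : ∀ x ∈ l, I.wf x) : J.wf (Ext.aeval M (c, o) l) ∧
      φ (J.val (Ext.aeval M (c, o) l)) = aeval z (I.poly l) := by
    obtain ⟨h1, h2⟩ := I.adjoin_aeval howf ho0 hl
    refine ⟨h1, ?_⟩
    rw [h2, AdjoinRoot.lift_mk]
    rfl
  obtain ⟨hbwf, hbval⟩ := hφ b hb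
  have hb0' : φ (J.val (Ext.aeval M (c, o) b)) ≠ 0 := by
    rw [hbval]
    exact aeval_ne_zero_of_orbit hz hb0 (by omega)
  have hQwf : ∀ x ∈ Q.map (Ext.aeval M (c, o)), J.wf x := by
    intro x hx
    obtain ⟨l, hl, rfl⟩ := List.mem_map.1 hx
    exact (hφ l (hQ l hl)).1
  have hroot : (J.poly (Q.map (Ext.aeval M (c, o)) ++ [Ext.aeval M (c, o) b])).eval₂ φ
      (aeval z f) = 0 := by
    have := I.eval₂_poly_map J φ f (z := z) (Q := Q ++ [b]) (v := Ext.aeval M (c, o)) fun l hl =>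
      (hφ l (by
        rcases List.mem_append.1 hl with hl | hl
        · exact hQ l hl
        · rw [List.mem_singleton.1 hl]; exact hb)).2
    rw [hfQ, map_zero, List.map_append] at this
    exact this
  obtain ⟨⟨hrl, hrwf⟩, hr⟩ := J.relation_spec φ hQwf hbwf hb0' hroot
  set rel := M.ext.relation (c, o) (Q.map (Ext.aeval M (c, o)) ++ [Ext.aeval M (c, o) b]) with hrel
  have hrel0 : rel ≠ [] := by
    rw [← List.length_pos_iff, hrl, List.length_map]
    exact List.length_pos_iff.2 hQ0
  have : Nontrivial (AdjoinRoot (I.modulus o)) := φ.domain_nontrivial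
  let JA := J.adjoin rel hrwf hrel0
  -- The evaluation y ↦ lc(z) f(z), where lc is the polynomial of `b`. It respects the relation
  -- because `f` is a root of the bivariate polynomial.
  let ψ : AdjoinRoot (J.modulus rel) →+* AlgebraicClosure R :=
    AdjoinRoot.lift φ (φ (J.val (Ext.aeval M (c, o) b)) * aeval z f) (by rw [← hrl] at hr; exact hr)
  have hψ {x : List X} (hx : J.wf x) : JA.wf (Ext.const M.ext ((c, o), rel) x) ∧
      ψ (JA.val (Ext.const M.ext ((c, o), rel) x)) = φ (J.val x) := by
    obtain ⟨h1, h2⟩ := J.adjoin_const hrwf hrel0 hx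
    exact ⟨h1, (congrArg ψ h2).trans (AdjoinRoot.lift_of _)⟩
  have hψ' {x : X} (hx : I.wf x) : JA.wf (Ext.const M.ext ((c, o), rel) (Ext.const M (c, o) x)) ∧
      ψ (JA.val (Ext.const M.ext ((c, o), rel) (Ext.const M (c, o) x))) =
        algebraMap R _ (I.val x) := by
    obtain ⟨h1, h2⟩ := I.adjoin_const howf ho0 hx
    obtain ⟨h3, h4⟩ := hψ h1
    exact ⟨h3, by rw [h4, h2, AdjoinRoot.lift_of]⟩
  obtain ⟨hlwf, hlval⟩ := hψ hbwf
  have hx : JA.wf (Ext.const M.ext ((c, o), rel) (Ext.shift M (c, o) (M.ext.one (c, o)))) ∧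
      ψ (JA.val (Ext.const M.ext ((c, o), rel) (Ext.shift M (c, o) (M.ext.one (c, o))))) = z := by
    obtain ⟨h1, h2⟩ := I.adjoin_shift howf ho0 J.wf_one
    obtain ⟨h3, h4⟩ := hψ h1
    exact ⟨h3, by rw [h4, h2, J.val_one, mul_one, AdjoinRoot.lift_root]⟩
  have hy : JA.wf (Ext.shift M.ext ((c, o), rel) (M.ext.ext.one ((c, o), rel))) ∧
      ψ (JA.val (Ext.shift M.ext ((c, o), rel) (M.ext.ext.one ((c, o), rel)))) =
        φ (J.val (Ext.aeval M (c, o) b)) * aeval z f := by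
    obtain ⟨h1, h2⟩ := J.adjoin_shift hrwf hrel0 JA.wf_one
    exact ⟨h1, (congrArg ψ (h2.trans (by rw [JA.val_one, mul_one]))).trans (AdjoinRoot.lift_root _)⟩
  have htest (t : X × X) (ht : t ∈ w) := JA.agreeTest_spec h w hy.1 hlwf hx.1
    (hψ' (hw t ht).1).1 (hψ' (hw t ht).2).1
  have hunf : M.patterns c p.bits h w (Q ++ [b]) l = (M.ext.ext.splitAll ((c, o), rel)
      (w.map fun t => (t, M.ext.ext.agreeTest ((c, o), rel) p.bits h w
        (Ext.shift M.ext ((c, o), rel) (M.ext.ext.one ((c, o), rel)))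
        (Ext.const M.ext ((c, o), rel) (Ext.aeval M (c, o) b))
        (Ext.const M.ext ((c, o), rel) (Ext.shift M (c, o) (M.ext.one (c, o))))
        (Ext.const M.ext ((c, o), rel) (Ext.const M (c, o) t.1))
        (Ext.const M.ext ((c, o), rel) (Ext.const M (c, o) t.2))))
      (M.ext.ext.basis ((c, o), rel))).map Prod.fst := by
    have hcyc : M.cyclic c l = (c, o) := rfl
    simp only [Arith.patterns, hcyc, List.map_append, List.map_cons, List.map_nil, ← hrel,
      List.getLastD_concat]
  rw [hunf]
  obtain ⟨m, hm, hm'⟩ := JA.splitAll_spec ψ (L := w.map fun t => (t, _)) (P := P)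
    (fun q hq => by
      obtain ⟨t, ht, rfl⟩ := List.mem_map.1 hq
      exact ⟨(htest t ht).1, (htest t ht).2.1⟩) JA.wf_basis JA.span_basis
    (fun q hq => by
      obtain ⟨t, ht, rfl⟩ := List.mem_map.1 hq
      refine (hP t ht).trans (Iff.symm (((htest t ht).2.2 ψ).trans ?_))
      rw [(hψ' (hw t ht).1).2, (hψ' (hw t ht).2).2, hx.2, hy.2, hlval, ← hR]
      -- Interpolating f - β in place of f turns agreement at α into vanishing at α. The starting
      -- denominator is lc(z), which is nonzero.
      obtain ⟨d', hd', hd⟩ := _root_.neville_spec (K := AlgebraicClosure R)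
        (fun i hi hin => hz i hi (by omega)) (n := w.length)
        (f := f - C (I.val t.2)) ((degree_sub_le _ _).trans_lt (max_lt hf
          (degree_C_le.trans_lt (by exact_mod_cast Nat.succ_pos _)))) (I.val t.1) hb0'
      rw [show φ (J.val (Ext.aeval M (c, o) b)) * aeval z f - algebraMap R _ (I.val t.2) *
        φ (J.val (Ext.aeval M (c, o) b)) = aeval z (f - C (I.val t.2)) *
          φ (J.val (Ext.aeval M (c, o) b)) by rw [map_sub, aeval_C]; ring, hd]
      simp [hd', sub_eq_zero])
  refine List.mem_map.2 ⟨m, hm, hm'.trans ?_⟩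
  rw [List.map_map]
  congr 2
  exact List.map_id w

end Patterns

end Interp


/-! ### Lists of positions and the enumeration of tuples -/

theorem foldr_map_range {S : Type*} [CommSemiring S] (g : S) (v : ℕ → S) (n : ℕ) :
    ((List.range n).map v).foldr (fun a s => a + g * s) 0 = ∑ i ∈ Finset.range n, v i * g ^ i := by
  induction n generalizing v with
  | zero => simp
  | succ n ih =>
    rw [List.range_succ_eq_map, List.map_cons, List.map_map, List.foldr_cons, ih,
      Finset.sum_range_succ', Finset.mul_sum, add_comm]
    congr 1
    · exact Finset.sum_congr rfl fun i _ => by simp only [Function.comp_apply]; ring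
    · simp

theorem length_filter_ofFn {α : Type*} {n : ℕ} (g : Fin n → α) (P : α → Bool) :
    ((List.ofFn g).filter P).length = {j : Fin n | P (g j) = true}.ncard := by
  classical
  rw [List.ofFn_eq_map, List.filter_map, List.length_map,
    ← List.toFinset_card_of_nodup ((List.nodup_finRange n).filter _), ← Set.ncard_coe_finset]
  congr 1
  ext j
  simp

namespace Arith

section
variable {γ X τ : Type} [Enc γ] [Enc X] [Enc τ] (M : Arith γ X)

/-- Each label is added at most once, in its turn. So spurious patterns too consist of distinct
positions, as Newton interpolation requires. -/
theorem splitAll_sublist (c : γ) (L : List (τ × X)) (W : List X) :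
    ∀ n ∈ M.splitAll c L W, n.1.reverse.Sublist (L.map Prod.fst) := by
  induction L using List.reverseRecOn with
  | nil => simp [splitAll]
  | append_singleton L q ih =>
    intro n hn
    rw [splitAll, List.foldl_append] at hn
    obtain ⟨m, hm, hn⟩ := List.mem_flatMap.1 hn
    have h1 := ih m hm
    have h2 := List.mem_of_mem_filter hn
    simp only [List.mem_cons, List.not_mem_nil, or_false] at h2
    rw [List.map_append]
    rcases h2 with rfl | rfl
    · rw [List.reverse_cons]
      exact h1.append (List.Sublist.refl _)
    · exact h1.trans (List.sublist_append_left _ _)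

theorem patterns_sublist {β β' : Type} [Enc β] [Enc β'] [Inhabited X] (c : γ) (d : List Bool)
    (h : List β') (w : List (X × X)) (Q : List (List X)) (l : List β) :
    ∀ J ∈ M.patterns c d h w Q l, J.reverse.Sublist w := by
  intro J hJ
  obtain ⟨n, hn, rfl⟩ := List.mem_map.1 hJ
  have := M.ext.ext.splitAll_sublist _ _ _ n hn
  rwa [List.map_map, show Prod.fst ∘ _ = id from rfl, List.map_id] at this

end

theorem mem_residues {β : Type} {p i : ℕ} {l : List β} :
    i ∈ residues p l ↔ i ≤ l.length ∧ i < p := by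
  simp only [residues, List.mem_filter, List.mem_map, List.mem_tails, decide_eq_true_eq]
  constructor
  · rintro ⟨⟨t, ht, rfl⟩, h⟩
    exact ⟨ht.length_le, h⟩
  · rintro ⟨h, h'⟩
    exact ⟨⟨l.drop (l.length - i), List.drop_suffix _ _, by rw [List.length_drop]; omega⟩, h'⟩

theorem nodup_residues {β : Type} (p : ℕ) (l : List β) : (residues p l).Nodup := by
  refine List.Nodup.filter _ ?_
  induction l with
  | nil => simp
  | cons x l ih =>
    rw [List.tails_cons, List.map_cons, List.nodup_cons]
    refine ⟨fun h => ?_, ih⟩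
    obtain ⟨t, ht, h⟩ := List.mem_map.1 h
    have := ((List.mem_tails _ _).1 ht).length_le
    simp at h
    omega

theorem length_residues_le {β : Type} (p : ℕ) (l : List β) : (residues p l).length ≤ p := by
  rw [← List.toFinset_card_of_nodup (nodup_residues p l)]
  conv_rhs => rw [← Finset.card_range p]
  exact Finset.card_le_card fun i hi => by
    rw [List.mem_toFinset, mem_residues] at hi
    exact Finset.mem_range.2 hi.2

theorem tuples_wf {β β' : Type} (p : ℕ) (h : List β') (l : List β) :
    ∀ t ∈ tuples p h l, t.length = h.length ∧ ∀ i ∈ t, i < p := by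
  induction h using List.reverseRecOn with
  | nil => simp [tuples]
  | append_singleton h x ih =>
    intro t ht
    rw [tuples, List.foldl_append] at ht
    obtain ⟨u, hu, rfl⟩ := List.mem_map.1 ht
    obtain ⟨v, hv, hu⟩ := List.mem_flatMap.1 (List.of_mem_zip hu).2
    obtain ⟨j, hj, hu⟩ := List.mem_map.1 hu
    obtain ⟨h1, h2⟩ := ih v hv
    rw [← hu]
    refine ⟨by simp [h1], fun i hi => ?_⟩
    rcases List.mem_cons.1 hi with rfl | hi
    exacts [(mem_residues.1 hj).2, h2 i hi]

/-- The truncation to the length of `l`, which keeps the enumeration polynomial for large fields,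
removes nothing if the field has at most that many elements. -/
theorem mem_tuples {β β' : Type} {p : ℕ} (hp : 0 < p) {h : List β'} {l : List β}
    (hl : p ^ h.length ≤ l.length) {t : List ℕ} (ht : t.length = h.length) (htp : ∀ i ∈ t, i < p) :
    t ∈ tuples p h l := by
  suffices (tuples p h l).length ≤ p ^ h.length ∧
      ∀ t : List ℕ, t.length = h.length → (∀ i ∈ t, i < p) → t ∈ tuples p h l from
    this.2 t ht htp
  clear ht htp t
  induction h using List.reverseRecOn with
  | nil => simp [tuples]
  | append_singleton h x ih =>
    rw [List.length_append, List.length_singleton] at hl ⊢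
    have hlp : p ^ h.length ≤ l.length := (Nat.pow_le_pow_right hp (Nat.le_succ _)).trans hl
    obtain ⟨h1, h2⟩ := ih hlp
    have h3 : ((tuples p h l).flatMap fun t => (residues p l).map fun i => i :: t).length ≤
        p ^ (h.length + 1) := by
      rw [List.length_flatMap]
      simp only [List.length_map, List.map_const', List.sum_replicate, smul_eq_mul, pow_succ]
      exact Nat.mul_le_mul h1 (length_residues_le p l)
    have h4 : tuples p (h ++ [x]) l =
        (tuples p h l).flatMap fun t => (residues p l).map fun i => i :: t := by
      rw [tuples, List.foldl_append]
      exact List.map_snd_zip (h3.trans hl)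
    rw [h4]
    refine ⟨h3, fun t ht htp => ?_⟩
    rcases t with _ | ⟨i, t⟩
    · simp at ht
    · refine List.mem_flatMap.2 ⟨t, h2 t (by simpa using ht) fun j hj => htp j (by simp [hj]),
        List.mem_map.2 ⟨i, mem_residues.2 ⟨?_, htp i (by simp)⟩, rfl⟩⟩
      exact (htp i (by simp)).le.trans ((Nat.le_self_pow (by omega) p).trans hl)

theorem length_cubeList (l : List Unit) : (cubeList l).length = l.length ^ 3 := by
  simp [cubeList, List.length_flatMap]
  ring

end Arith

/-! ### Coordinates of field elements and of polynomials -/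

section PowerBasis
open Arith

variable {p : ℕ} [Fact p.Prime] {F : Type*} [Field F] [Finite F] [Algebra (ZMod p) F]
    (pb : PowerBasis (ZMod p) F)

namespace PowerBasis

/-- The coordinates of an element. -/
noncomputable def coords (x : F) : List ℕ := List.ofFn fun i => (pb.basis.repr x i).val

/-- The coordinates of the coefficients of a polynomial. -/
noncomputable def polyCoords (f : F[X]) : List (List ℕ) :=
  (List.range (f.natDegree + 1)).map fun i => pb.coords (f.coeff i)

/-- The coefficients of the minimal polynomial of the generator. -/
noncomputable def minpolyCoeffs : List ℕ :=
  (List.range ((minpoly (ZMod p) pb.gen).natDegree + 1)).map fun i =>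
    ((minpoly (ZMod p) pb.gen).coeff i).val

/-- The coordinates of the power of the generator whose exponent is the degree. -/
noncomputable def genPow : List ℕ := pb.minpolyCoeffs.dropLast.map (Arith.prime.neg p)

theorem enc_coords (x : F) : Enc.enc (pb.coords x) = encElt pb x := by
  simp only [Enc.enc, coords, encElt, List.map_ofFn]
  rfl

theorem enc_polyCoords (f : F[X]) : Enc.enc (pb.polyCoords f) = encPoly (encElt pb) f := by
  simp only [encPoly, ← enc_coords, polyCoords]
  change encList (List.map _ (List.map _ _)) = _
  rw [List.map_map]
  rfl

theorem length_genPow : pb.genPow.length = pb.dim := by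
  simp [genPow, minpolyCoeffs, pb.natDegree_minpoly]

theorem genPow_wf : (Interp.prime p Fact.out).ListWf pb.dim pb.genPow := by
  refine ⟨pb.length_genPow, fun x hx => ?_⟩
  obtain ⟨y, hy, rfl⟩ := List.mem_map.1 hx
  obtain ⟨i, _, rfl⟩ := List.mem_map.1 (List.mem_of_mem_dropLast hy)
  exact (Interp.prime p Fact.out).wf_neg (ZMod.val_lt _)

theorem gen_pow_dim :
    pb.gen ^ pb.dim = (Interp.prime p Fact.out).evalList pb.gen pb.genPow := by
  have h1 : pb.genPow = (List.range pb.dim).map fun i =>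
      Arith.prime.neg p ((minpoly (ZMod p) pb.gen).coeff i).val := by
    rw [genPow, minpolyCoeffs, List.range_succ, List.map_append, List.map_singleton,
      List.dropLast_concat, List.map_map, pb.natDegree_minpoly]
    rfl
  have h2 : ∀ i, (Interp.prime p Fact.out).val (Arith.prime.neg p
      ((minpoly (ZMod p) pb.gen).coeff i).val) = -(minpoly (ZMod p) pb.gen).coeff i := by
    intro i
    rw [(Interp.prime p Fact.out).val_neg (ZMod.val_lt _)]
    exact congrArg _ (ZMod.natCast_zmod_val _)
  rw [h1, Interp.evalList, List.foldr_map]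
  simp only [h2]
  rw [← List.foldr_map (f := fun i => algebraMap (ZMod p) F (-(minpoly (ZMod p) pb.gen).coeff i))
    (g := fun a s => a + pb.gen * s), foldr_map_range]
  have h3 := minpoly.aeval (ZMod p) pb.gen
  rw [aeval_eq_sum_range, pb.natDegree_minpoly, Finset.sum_range_succ, ← pb.natDegree_minpoly,
    coeff_natDegree, (minpoly.monic pb.isIntegral_gen).leadingCoeff, pb.natDegree_minpoly,
    one_smul] at h3
  rw [← sub_eq_zero, ← h3, add_comm, sub_eq_add_neg, ← Finset.sum_neg_distrib]
  congr 1
  exact Finset.sum_congr rfl fun i _ => by rw [map_neg, Algebra.smul_def]; ring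

/-- Coordinates represent the elements of the field. -/
noncomputable def interp : Interp Arith.prime.ext (p, pb.genPow) p F :=
  (Interp.prime p Fact.out).ext pb pb.genPow pb.dim_pos pb.genPow_wf pb.gen_pow_dim

theorem coords_spec (x : F) : pb.interp.wf (pb.coords x) ∧ pb.interp.val (pb.coords x) = x := by
  have h1 : (pb.coords x).length = pb.dim := by simp [coords]
  refine ⟨⟨h1, fun i hi => ?_⟩, pb.basis.ext_elem fun i => ?_⟩
  · obtain ⟨j, rfl⟩ := (List.mem_ofFn' _ _).1 hi
    exact ZMod.val_lt _
  · refine ((Interp.prime p Fact.out).coord_evalList pb h1 i i.2).trans ?_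
    simp [coords, Interp.prime]

theorem polyCoords_wf (f : F[X]) : ∀ x ∈ pb.polyCoords f, pb.interp.wf x := by
  intro x hx
  obtain ⟨i, _, rfl⟩ := List.mem_map.1 hx
  exact (pb.coords_spec _).1

theorem poly_polyCoords (f : F[X]) : pb.interp.poly (pb.polyCoords f) = f := by
  rw [polyCoords, Interp.poly, Interp.evalList, List.foldr_map]
  simp only [(pb.coords_spec _).2]
  rw [← List.foldr_map (f := fun i => algebraMap F F[X] (f.coeff i))
    (g := fun a s => a + Polynomial.X * s), foldr_map_range]
  exact f.as_sum_range_C_mul_X_pow.symm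

/-- Representatives are unique, so a list of the right length is literally the canonical one; hence
removing repeated lists removes repeated polynomials, and the output encoding is exact. -/
theorem eq_polyCoords {l : List (List ℕ)} (hl : ∀ x ∈ l, pb.interp.wf x)
    (h : l.length = (pb.interp.poly l).natDegree + 1) :
    l = pb.polyCoords (pb.interp.poly l) := by
  refine List.ext_getElem (by simp [polyCoords, h]) fun i hi hi' => ?_
  refine pb.interp.inj (hl _ (List.getElem_mem hi)) (pb.polyCoords_wf _ _ (List.getElem_mem hi')) ?_
  simp [polyCoords, (pb.coords_spec _).2, pb.interp.coeff_poly hi]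

theorem length_polyCoords (f : F[X]) : (pb.polyCoords f).length = f.natDegree + 1 := by
  simp [polyCoords]

end PowerBasis

end PowerBasis


/-! ### Correctness of the decoder -/

section Decoder
open Arith

variable {p : ℕ} [Fact p.Prime] {F : Type*} [Field F] [Finite F] [Algebra (ZMod p) F]
    (pb : PowerBasis (ZMod p) F) {n k : ℕ} {α β : Fin n → F} {Q : F[X][Y]}

namespace PowerBasis

/-- The coordinates of a received word. -/
noncomputable def wordCoords (α β : Fin n → F) : List (List ℕ × List ℕ) :=
  List.ofFn fun j => (pb.coords (α j), pb.coords (β j))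

/-- The coordinates of a bivariate polynomial. -/
noncomputable def bivariateCoords (Q : F[X][Y]) : List (List (List ℕ)) :=
  (List.range (Q.natDegree + 1)).map fun i => pb.polyCoords (Q.coeff i)

theorem natCard_eq : Nat.card F = p ^ pb.genPow.length := by
  have := pb.finite
  rw [length_genPow, ← pb.finrank, Module.natCard_eq_pow_finrank (K := ZMod p), Nat.card_zmod]

theorem wordCoords_wf (α β : Fin n → F) :
    ∀ t ∈ pb.wordCoords α β, pb.interp.wf t.1 ∧ pb.interp.wf t.2 := by
  intro t ht
  obtain ⟨j, rfl⟩ := (List.mem_ofFn' _ _).1 ht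
  exact ⟨(pb.coords_spec _).1, (pb.coords_spec _).1⟩

theorem length_wordCoords (α β : Fin n → F) : (pb.wordCoords α β).length = n := by
  simp [wordCoords]

theorem nodup_wordCoords (hα : Function.Injective α) (β : Fin n → F) :
    ((pb.wordCoords α β).map fun t => pb.interp.val t.1).Nodup := by
  rw [wordCoords, List.map_ofFn, List.nodup_ofFn]
  intro i j h
  simp only [Function.comp_apply, (pb.coords_spec _).2] at h
  exact hα h

theorem length_filter_wordCoords (f : F[X]) {P : List ℕ × List ℕ → Bool}
    (hP : ∀ t ∈ pb.wordCoords α β, P t = true ↔ f.eval (pb.interp.val t.1) = pb.interp.val t.2) :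
    ((pb.wordCoords α β).filter P).length = agreement α β f := by
  rw [wordCoords, length_filter_ofFn, agreement]
  congr 1
  ext j
  have := hP (pb.coords (α j), pb.coords (β j)) ((List.mem_ofFn' _ _).2 ⟨j, rfl⟩)
  rw [(pb.coords_spec _).2, (pb.coords_spec _).2] at this
  exact this

end PowerBasis

theorem isClose_iff (hk : 1 ≤ k) (f : F[X]) :
    IsClose k α β f ↔ f.natDegree + 1 ≤ k ∧ k * n ≤ n + agreement α β f * agreement α β f := by
  refine and_congr ?_ ?_
  · by_cases hf : f = 0
    · simp [hf, hk]
    · rw [degree_eq_natDegree hf]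
      norm_cast
  · rw [Real.sqrt_le_left (Nat.cast_nonneg _), ← Nat.cast_le (α := ℝ)]
    push_cast
    constructor <;> intro h <;> nlinarith

/-- The square of the agreement is at least (k - 1) n, which exceeds (k - 1)² because n > k and k >
1. -/
theorem agreement_ge (hkn : k < n) (hk : 1 ≤ k) {f : F[X]} (hf : IsClose k α β f) (hk2 : 2 ≤ k) :
    k ≤ agreement α β f := by
  have h := ((isClose_iff hk f).1 hf).2
  by_contra! hlt
  obtain ⟨j, rfl⟩ : ∃ j, k = j + 1 := ⟨k - 1, by omega⟩
  have : agreement α β f * agreement α β f ≤ j * j := Nat.mul_le_mul (by omega) (by omega)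
  nlinarith

namespace PowerBasis

theorem isClose_spec (hk : 1 ≤ k) {l : List (List ℕ)} (hl : ∀ x ∈ l, pb.interp.wf x)
    (h : l.length = (pb.interp.poly l).natDegree + 1) :
    prime.ext.isClose (p, pb.genPow) k (pb.wordCoords α β) l = true ↔
      IsClose k α β (pb.interp.poly l) := by
  have : (prime.ext.agreeing (p, pb.genPow) (pb.wordCoords α β) l).length =
      agreement α β (pb.interp.poly l) := by
    refine pb.length_filter_wordCoords _ fun t ht => ?_
    obtain ⟨h1, h2⟩ := pb.wordCoords_wf α β t ht
    obtain ⟨h3, h4⟩ := pb.interp.horner_spec hl h1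
    rw [pb.interp.isZero_iff (pb.interp.wf_sub h3 h2), pb.interp.val_sub h3 h2, h4, sub_eq_zero]
  rw [isClose_iff hk, ← h, isClose, this, length_wordCoords]
  simp

/-- Covers spurious candidates too, so that the closeness test is meaningful on all of them. -/
theorem candidates_wf (hα : Function.Injective α) :
    ∀ l ∈ candidates p pb.genPow (pb.wordCoords α β) (pb.bivariateCoords Q),
      (∀ x ∈ l, pb.interp.wf x) ∧ l.length = (pb.interp.poly l).natDegree + 1 := by
  intro l hl
  rcases List.mem_append.1 hl with hl | hl
  · obtain ⟨t, ht, rfl⟩ := List.mem_map.1 hl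
    obtain ⟨h1, h2⟩ := tuples_wf _ _ _ t ht
    refine ⟨fun x hx => ?_, ?_⟩
    · rw [List.mem_singleton.1 hx]
      exact ⟨h1.trans pb.length_genPow, h2⟩
    · have : pb.interp.poly [t] = C (pb.interp.val t) := by
        rw [Interp.poly_cons, show pb.interp.poly [] = 0 from rfl, mul_zero, add_zero]
      rw [this]
      simp
  · obtain ⟨m, -, hl⟩ := List.mem_flatMap.1 hl
    obtain ⟨J, hJ, rfl⟩ := List.mem_map.1 hl
    have h1 := prime.ext.patterns_sublist _ _ _ _ _ _ J hJ
    have h2 : (J.map fun q => pb.interp.val q.1).Nodup := by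
      rw [← List.nodup_reverse, ← List.map_reverse]
      exact (pb.nodup_wordCoords hα β).sublist (h1.map _)
    obtain ⟨h3, -⟩ := pb.interp.newton_spec (Fact.out : p.Prime).two_le
      (l := pb.genPow) (List.length_pos_iff.1 (pb.length_genPow ▸ pb.dim_pos)) pb.natCard_eq
      (J := J) (fun q hq => pb.wordCoords_wf α β q (h1.subset (List.mem_reverse.2 hq))) h2
    obtain ⟨h4, h5, h6⟩ := pb.interp.trim_spec h3
    exact ⟨h4, by rw [h6, h5]⟩

theorem map_poly_bivariateCoords (Q : F[X][Y]) : (pb.bivariateCoords Q).map pb.interp.poly =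
    (List.range (Q.natDegree + 1)).map Q.coeff := by
  rw [bivariateCoords, List.map_map]
  exact List.map_congr_left fun i _ => pb.poly_polyCoords _

theorem exists_natDegree_coeff_eq (hQ : Q ≠ 0) : ∃ i ≤ Q.natDegree, (Q.coeff i).natDegree = degX Q := by
  obtain ⟨i, hi, h⟩ := Finset.exists_mem_eq_sup Q.support (nonempty_support_iff.2 hQ)
    fun i => (Q.coeff i).natDegree
  exact ⟨i, le_natDegree_of_mem_supp _ hi, h.symm⟩

theorem natDegree_coeff_le (Q : F[X][Y]) (i : ℕ) : (Q.coeff i).natDegree ≤ degX Q := by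
  by_cases h : i ∈ Q.support
  · exact Finset.le_sup (f := fun i => (Q.coeff i).natDegree) h
  · rw [notMem_support_iff.1 h]
    simp

/-- The three pieces of the list account for n, for the at least deg_X Q + 1 coefficients of Q, and
for the bit length of p times the degree of the field, which exceeds log |F|. -/
theorem le_length_sizeList (hQ : Q ≠ 0) : n + degX Q + 1 + (Nat.log 2 (Nat.card F) + 1) ≤
    (sizeList p pb.genPow (pb.wordCoords α β) (pb.bivariateCoords Q)).length := by
  obtain ⟨i, hi, h⟩ := exists_natDegree_coeff_eq hQ
  have h1 : degX Q + 1 ≤ (pb.bivariateCoords Q).flatten.length := by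
    rw [← h, ← pb.length_polyCoords, List.length_flatten]
    exact List.le_sum_of_mem (List.mem_map_of_mem (List.mem_map.2
      ⟨i, List.mem_range.2 (by omega), rfl⟩))
  have h2 : Nat.log 2 (Nat.card F) < pb.genPow.length * p.size := by
    refine Nat.log_lt_of_lt_pow Nat.card_pos.ne' ?_
    rw [pb.natCard_eq, mul_comm, pow_mul]
    exact Nat.pow_lt_pow_left (Nat.lt_size_self p)
      (pb.length_genPow ▸ pb.dim_pos.ne')
  simp only [sizeList, List.length_append, List.length_replicate, length_wordCoords, List.length_flatMap,
    List.map_const', List.sum_replicate, smul_eq_mul, Nat.size_eq_bits_len] at *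
  omega

theorem exists_candidate (hk : 1 ≤ k) (hkn : k < n) (hα : Function.Injective α) (hQ : Q ≠ 0)
    (hroot : ∀ f : F[X], IsClose k α β f → Q.eval f = 0) {f : F[X]} (hf : IsClose k α β f) :
    ∃ l ∈ candidates p pb.genPow (pb.wordCoords α β) (pb.bivariateCoords Q),
      pb.interp.poly l = f := by
  classical
  have := Fintype.ofFinite F
  have hp := (Fact.out : p.Prime)
  obtain rfl | hk2 := hk.eq_or_lt
  -- For k = 1 the threshold is zero, so all constants are roots of Q and the field has at most
  -- deg_Y Q elements.
  · have hclose (a : F) : IsClose 1 α β (C a) := by simp [isClose_iff]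
    have hcard : Nat.card F ≤ Q.natDegree := by
      rw [← Fintype.card_eq_nat_card, ← Finset.card_univ,
        ← Finset.card_image_of_injective _ (C_injective (R := F))]
      refine card_le_degree_of_subset_roots fun g hg => ?_
      obtain ⟨a, -, rfl⟩ := Finset.mem_image.1 hg
      exact (mem_roots hQ).2 (hroot _ (hclose a))
    obtain ⟨a, rfl⟩ : ∃ a, f = C a :=
      ⟨_, eq_C_of_natDegree_le_zero (by have := ((isClose_iff le_rfl f).1 hf).1; omega)⟩
    obtain ⟨h1, h2⟩ := pb.coords_spec a
    refine ⟨[pb.coords a], List.mem_append_left _ (List.mem_map.2 ⟨_, mem_tuples hp.pos ?_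
      (h1.1.trans pb.length_genPow.symm) h1.2, rfl⟩), ?_⟩
    · rw [← pb.natCard_eq, bivariateCoords, List.length_map, List.length_range]
      omega
    · rw [Interp.poly_cons, h2, show pb.interp.poly [] = 0 from rfl, mul_zero, add_zero]
  · set w := pb.wordCoords α β with hw
    have hwn : w.length = n := pb.length_wordCoords α β
    -- A nonzero Q without Y has no Y-roots; this makes the relation defining the algebra nonempty.
    have hD : Q.natDegree ≠ 0 := by
      intro hD
      have h := hroot f hf
      rw [eq_C_of_natDegree_eq_zero hD] at h hQ
      rw [eval_C] at h
      exact hQ (by rw [h, C_0])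
    -- Enough conjugates for two purposes: n + 1 interpolation nodes, and more than deg_X Q points
    -- to keep the leading coefficient of Q from vanishing at z.
    obtain ⟨N, hNb, hN0, hpN, hN⟩ := exists_order_gt_of_le (K := n + degX Q + 1) hp
      (show 2 ≤ Nat.card F from Finite.one_lt_card) (by omega) (pb.le_length_sizeList (α := α) (β := β) hQ)
    set B := cubeList (sizeList p pb.genPow (pb.wordCoords α β) (pb.bivariateCoords Q))
    have hB : N ≤ B.length := by rwa [length_cubeList]
    have hl : (B.drop (B.length - N)).length = N := by rw [List.length_drop]; omega
    have hdeg : f.degree < k := hf.1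
    let P : List ℕ × List ℕ → Bool := fun t =>
      decide (f.eval (pb.interp.val t.1) = pb.interp.val t.2)
    have hP : ∀ t ∈ w, P t = true ↔ f.eval (pb.interp.val t.1) = pb.interp.val t.2 :=
      fun t _ => decide_eq_true_iff
    have hmap := pb.map_poly_bivariateCoords Q
    have hsplit : pb.bivariateCoords Q = (List.range Q.natDegree).map
        (fun i => pb.polyCoords (Q.coeff i)) ++ [pb.polyCoords (Q.coeff Q.natDegree)] := by
      rw [bivariateCoords, List.range_succ, List.map_append, List.map_singleton]
    have hmem : (w.filter P).reverse ∈ prime.ext.patterns (p, pb.genPow) p.bits pb.genPow w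
        (pb.bivariateCoords Q) (B.drop (B.length - N)) := by
      have hfQ : ((pb.bivariateCoords Q).map pb.interp.poly).foldr (fun a s => a + f * s) 0 = 0 := by
        rw [hmap, foldr_map_range, ← eval_eq_sum_range]
        exact hroot f hf
      rw [hsplit] at hfQ ⊢
      refine pb.interp.patterns_spec (h := pb.genPow) (K := n + degX Q + 1)
        (by rw [Fintype.card_eq_nat_card, pb.natCard_eq]) (pb.wordCoords_wf α β)
        (fun l hl => ?_) (pb.polyCoords_wf _) ?_ ?_ ?_ (by rw [pb.length_wordCoords]; omega) ?_ hfQ (by omega) (by rwa [hl]) ?_ hP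
      · obtain ⟨i, _, rfl⟩ := List.mem_map.1 hl
        exact pb.polyCoords_wf _
      · rw [pb.poly_polyCoords]
        exact leadingCoeff_ne_zero.2 hQ
      · simpa using hD
      · rw [pb.poly_polyCoords]
        have := natDegree_coeff_le Q Q.natDegree
        omega
      · exact hdeg.trans (by exact_mod_cast (by omega : k < w.length + 1))
      · rwa [hl, Fintype.card_eq_nat_card]
    refine ⟨_, List.mem_append_right _ (List.mem_flatMap.2 ⟨_, (List.mem_tails _ _).2
      (List.drop_suffix (B.length - N) B), List.mem_map.2 ⟨_, hmem, rfl⟩⟩), ?_⟩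
    have h2 : (((w.filter P).reverse).map fun q => pb.interp.val q.1).Nodup := by
      rw [List.map_reverse, List.nodup_reverse]
      exact (pb.nodup_wordCoords hα β).sublist (List.filter_sublist.map _)
    obtain ⟨h3, h4⟩ := pb.interp.newton_spec hp.two_le
      (l := pb.genPow) (List.length_pos_iff.1 (pb.length_genPow ▸ pb.dim_pos)) pb.natCard_eq
      (J := (w.filter P).reverse)
      (fun q hq => pb.wordCoords_wf α β q (List.mem_of_mem_filter (List.mem_reverse.1 hq))) h2
    rw [(pb.interp.trim_spec h3).2.1]
    refine h4 f (hdeg.trans_le ?_) fun q hq => ?_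
    · rw [List.length_reverse, pb.length_filter_wordCoords f hP]
      exact_mod_cast agreement_ge hkn hk hf hk2
    · have := List.mem_filter.1 (List.mem_reverse.1 hq)
      exact (hP q this.1).1 this.2

/-- The input of the algorithm. -/
noncomputable def inputCoords (k : ℕ) (α β : Fin n → F) (Q : F[X][Y]) :
    (ℕ × List ℕ) × ℕ × List (List ℕ × List ℕ) × List (List (List ℕ)) :=
  ((p, pb.minpolyCoeffs), k, pb.wordCoords α β, pb.bivariateCoords Q)

theorem enc_inputCoords (k : ℕ) (α β : Fin n → F) (Q : F[X][Y]) :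
    Enc.enc (pb.inputCoords k α β Q) = encInput pb k α β Q := by
  have h1 : Enc.enc pb.minpolyCoeffs = encPoly (encZMod p) (minpoly (ZMod p) pb.gen) := by
    change encList (List.map _ (List.map _ _)) = _
    rw [List.map_map]
    rfl
  have h2 : Enc.enc (pb.wordCoords α β) = encWord pb α β := by
    simp only [encWord, ← enc_coords]
    change encList (List.map _ (List.ofFn _)) = _
    rw [List.map_ofFn]
    rfl
  have h3 : Enc.enc (pb.bivariateCoords Q) = encPoly (encPoly (encElt pb)) Q := by
    rw [encPoly]
    simp only [← enc_polyCoords]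
    change encList (List.map _ (List.map _ _)) = _
    rw [List.map_map]
    rfl
  rw [encInput, encField, ← h1, ← h2, ← h3]
  rfl

theorem listDecode_spec (hk : 1 ≤ k) (hkn : k < n) (hα : Function.Injective α) (hQ : Q ≠ 0)
    (hroot : ∀ f : F[X], IsClose k α β f → Q.eval f = 0) :
    ∃ L : List F[X], L.Nodup ∧ (∀ f : F[X], f ∈ L ↔ IsClose k α β f) ∧
      Enc.enc (listDecode (pb.inputCoords k α β Q)) = encOutput pb L := by
  set C := (candidates p pb.genPow (pb.wordCoords α β) (pb.bivariateCoords Q)).filter fun f =>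
    prime.ext.isClose (p, pb.genPow) k (pb.wordCoords α β) f with hC
  have hD : listDecode (pb.inputCoords k α β Q) = prime.ext.dedup (p, pb.genPow) C := rfl
  have hwf (l) (hl : l ∈ C) := pb.candidates_wf (Q := Q) hα l (List.mem_of_mem_filter hl)
  obtain ⟨h1, h2⟩ := pb.interp.dedup_spec fun l hl => (hwf l hl).1
  have hcan (l) (hl : l ∈ prime.ext.dedup (p, pb.genPow) C) :
      l = pb.polyCoords (pb.interp.poly l) :=
    pb.eq_polyCoords (hwf l ((h2 l).1 hl)).1 (hwf l ((h2 l).1 hl)).2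
  refine ⟨(prime.ext.dedup (p, pb.genPow) C).map pb.interp.poly, ?_, fun f => ?_, ?_⟩
  · refine List.Nodup.map_on (fun l hl m hm hlm => ?_) h1
    rw [hcan l hl, hcan m hm, hlm]
  · rw [List.mem_map]
    constructor
    · rintro ⟨l, hl, rfl⟩
      have hl' := (h2 l).1 hl
      exact (pb.isClose_spec hk (hwf l hl').1 (hwf l hl').2).1 (List.mem_filter.1 hl').2
    · intro hf
      obtain ⟨l, hl, rfl⟩ := pb.exists_candidate hk hkn hα hQ hroot hf
      obtain ⟨h3, h4⟩ := pb.candidates_wf hα l hl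
      exact ⟨l, (h2 l).2 (List.mem_filter.2 ⟨hl, (pb.isClose_spec hk h3 h4).2 hf⟩), rfl⟩
  · rw [hD, encOutput, List.map_map]
    change encList _ = _
    congr 1
    refine List.map_congr_left fun l hl => ?_
    rw [Function.comp_apply, ← enc_polyCoords, ← hcan l hl]

end PowerBasis

end Decoder


/-! ### Input size and running time -/

theorem Polynomial.exists_eval_le_mul_pow (b : ℕ[X]) :
    ∃ c : ℕ, ∀ s, 1 ≤ s → b.eval s ≤ c * s ^ c := by
  -- The sum of the coefficients serves as factor and the degree as exponent; one constant dominates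
  -- both.
  refine ⟨b.eval 1 + b.natDegree, fun s hs => ?_⟩
  rw [eval_eq_sum_range]
  calc ∑ i ∈ Finset.range (b.natDegree + 1), b.coeff i * s ^ i
      ≤ ∑ i ∈ Finset.range (b.natDegree + 1), b.coeff i * s ^ (b.eval 1 + b.natDegree) := by
        refine Finset.sum_le_sum fun i hi => Nat.mul_le_mul_left _ (Nat.pow_le_pow_right hs ?_)
        rw [Finset.mem_range] at hi
        omega
    _ = b.eval 1 * s ^ (b.eval 1 + b.natDegree) := by
        rw [← Finset.sum_mul, eval_eq_sum_range]
        simp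
    _ ≤ _ := Nat.mul_le_mul_right _ (Nat.le_add_right _ _)

theorem sz_map_range_le {α : Type} [Enc α] {g : ℕ → α} {m N B : ℕ} (hm : m ≤ N)
    (h : ∀ i, sz (g i) ≤ B) : sz ((List.range m).map g) ≤ N * (B + 1) + 1 := by
  refine (sz_list_le (B := B) fun a ha => ?_).trans ?_
  · obtain ⟨i, _, rfl⟩ := List.mem_map.1 ha
    exact h i
  · rw [List.length_map, List.length_range]
    gcongr

theorem sz_ofFn_le {α : Type} [Enc α] {m N B : ℕ} {g : Fin m → α} (hm : m ≤ N)
    (h : ∀ i, sz (g i) ≤ B) : sz (List.ofFn g) ≤ N * (B + 1) + 1 := by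
  refine (sz_list_le (B := B) fun a ha => ?_).trans ?_
  · obtain ⟨i, rfl⟩ := (List.mem_ofFn' _ _).1 ha
    exact h i
  · rw [List.length_ofFn]
    gcongr

theorem PowerBasis.exists_sz_inputCoords_le : ∃ b : ℕ[X], ∀ {p : ℕ} [Fact p.Prime] {F : Type*}
    [Field F] [Finite F] [Algebra (ZMod p) F] (pb : PowerBasis (ZMod p) F) {n k : ℕ} (_ : k < n)
    (α β : Fin n → F) (Q : F[X][Y]), sz (pb.inputCoords k α β Q) ≤
      b.eval (n + degX Q + Q.natDegree + Nat.log 2 (Nat.card F)) := by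
  -- `e` bounds numbers up to `2 ^ (s + 1)`, `d` bounds field elements and the minimal polynomial,
  -- and `f` bounds the coefficients of Q in Y.
  let e : ℕ[X] := 4 * X + 9
  let d : ℕ[X] := (X + 1) * (e + 1) + 1
  let f : ℕ[X] := (X + 1) * (d + 1) + 1
  refine ⟨(e + d + 1) + (e + ((X + 1) * (d + d + 1 + 1) + 1 + ((X + 1) * (f + 1) + 1) + 1) + 1) + 1,
    fun {p} _ {F} _ _ _ pb n k hkn α β Q => ?_⟩
  set s := n + degX Q + Q.natDegree + Nat.log 2 (Nat.card F) with hs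
  have hp := (Fact.out : p.Prime)
  have hcard := pb.natCard_eq
  rw [pb.length_genPow] at hcard
  -- The dimension is at most log |F|, since |F| = p^dim ≥ 2^dim.
  have hdim : pb.dim ≤ s := by
    refine le_trans ?_ (Nat.le_add_left _ _)
    refine Nat.le_log_of_pow_le one_lt_two ?_
    rw [hcard]
    exact Nat.pow_le_pow_left hp.two_le _
  have hnat {m : ℕ} (hm : m ≤ 2 ^ (s + 1)) : sz m ≤ e.eval s := by
    refine (sz_nat_le m).trans ?_
    have : m.size ≤ s + 1 + 1 := Nat.size_le.2 (hm.trans_lt (Nat.pow_lt_pow_succ one_lt_two))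
    simp [e]
    omega
  have hps : p ≤ 2 ^ (s + 1) := by
    have h1 : p ≤ Nat.card F := by
      rw [hcard]
      exact Nat.le_self_pow pb.dim_pos.ne' p
    exact h1.trans ((Nat.lt_pow_succ_log_self one_lt_two _).le.trans
      (Nat.pow_le_pow_right two_pos (by omega)))
  have hks : k ≤ 2 ^ (s + 1) :=
    (show k ≤ s + 1 by omega).trans (Nat.lt_pow_self one_lt_two).le
  have hval (a : ZMod p) : sz a.val ≤ e.eval s := hnat ((ZMod.val_lt a).le.trans hps)
  have hd : (s + 1) * (e.eval s + 1) + 1 = d.eval s := by simp [d]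
  have hf : (s + 1) * (d.eval s + 1) + 1 = f.eval s := by simp [f]
  have hcoords (x : F) : sz (pb.coords x) ≤ d.eval s :=
    hd ▸ sz_ofFn_le (by omega) fun i => hval _
  have hmin : sz pb.minpolyCoeffs ≤ d.eval s :=
    hd ▸ sz_map_range_le (by rw [pb.natDegree_minpoly]; omega) fun i => hval _
  have hpoly (i : ℕ) : sz (pb.polyCoords (Q.coeff i)) ≤ f.eval s := by
    have := natDegree_coeff_le Q i
    exact hf ▸ sz_map_range_le (by omega) fun i => hcoords _
  have hbiv : sz (pb.bivariateCoords Q) ≤ (s + 1) * (f.eval s + 1) + 1 :=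
    sz_map_range_le (by omega) hpoly
  have hword : sz (pb.wordCoords α β) ≤ (s + 1) * (d.eval s + d.eval s + 1 + 1) + 1 :=
    sz_ofFn_le (by omega) fun i => by
      rw [sz_pair]
      have := hcoords (α i)
      have := hcoords (β i)
      omega
  have := hnat hps
  have := hnat hks
  simp only [inputCoords, sz_pair, eval_add, eval_mul, eval_one, eval_X] at *
  omega

theorem mainTheorem2 :
    ∃ (P : Prog) (c : ℕ),
      ∀ (p : ℕ) [Fact p.Prime] (F : Type*) [Field F] [Finite F] [Algebra (ZMod p) F]
        (pb : PowerBasis (ZMod p) F) (n k : ℕ) (_ : 1 ≤ k) (_ : k < n)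
        (α β : Fin n → F) (_ : Function.Injective α)
        (Q : F[X][Y]) (_ : Q ≠ 0)
        (_ : ∀ f : F[X], IsClose k α β f → Q.eval f = 0),
        ∃ (L : List F[X]) (t : ℕ),
          L.Nodup ∧ (∀ f : F[X], f ∈ L ↔ IsClose k α β f) ∧
          Runs P (encInput pb k α β Q) (encOutput pb L) t ∧
          t ≤ c * (n + degX Q + Q.natDegree + Nat.log 2 (Nat.card F)) ^ c := by
  obtain ⟨P, b, hP⟩ := Arith.polyTime_listDecode
  obtain ⟨b', hb'⟩ := PowerBasis.exists_sz_inputCoords_le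
  obtain ⟨c, hc⟩ := (b.comp b').exists_eval_le_mul_pow
  refine ⟨P, c, fun p _ F _ _ _ pb n k hk hkn α β hα Q hQ hroot => ?_⟩
  obtain ⟨L, hL, hL', henc⟩ := pb.listDecode_spec hk hkn hα hQ hroot
  obtain ⟨-, t, ht, hr⟩ := hP (pb.inputCoords k α β Q)
  rw [pb.enc_inputCoords, henc] at hr
  refine ⟨L, t, hL, hL', hr, ht.trans ((b.eval_mono_nat (hb' pb hkn α β Q)).trans ?_)⟩
  rw [← eval_comp]
  exact hc _ (by omega)
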